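/- Let $\epsilon\in\mathbb C^\times$. Let $\mathrm{Vir}^b$ be the universal Virasoro vertex algebra (the vacuum module, generated by $T^b(z)=\sum_n L^{(b)}_nz^{-n-2}$) of central charge $1+6(b+b^{-1})^2$ over the field $\mathbb C(b)$, and let $\mathcal V_{\sqrt2\mathbb Z}$ be the lattice vertex algebra with the fields $e(z)=e^{\sqrt2\varphi}(z)$, $f(z)=e^{-\sqrt2\varphi}(z)$, $h(z)=\sqrt2\,\partial\varphi(z)$ (equivalently, $\hat{\mathfrak{sl}}_2$ at level $1$), with modes $a(z)=\sum_n a_nz^{-n-1}$, and with standard Virasoro operators $L_n=L_n^{\mathcal V_{\sqrt2\mathbb Z}}$, the modes of $\frac12(\partial\varphi)^2$. On $\mathcal V^b=\mathrm{Vir}^b\otimes\mathcal V_{\sqrt2\mathbb Z}$ consider the fields (all products normally ordered) \begin{align*} T^{(b_1)}&=\tfrac{b+b^{-1}}{2(b-b^{-1})\epsilon}e^{-\sqrt2\varphi}+\tfrac{b}{2(b-b^{-1})}(\partial\varphi)^2-\tfrac{b^{-1}}{\sqrt2(b-b^{-1})}\partial^2\varphi-\tfrac{(1+2b^{-2})\epsilon}{b^2-b^{-2}}(\partial\varphi)^2e^{\sqrt2\varphi}\\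 &\quad-\tfrac{\sqrt2b^{-1}\epsilon}{b-b^{-1}}\partial^2\varphi\, e^{\sqrt2\varphi}-\tfrac{2\epsilon^2}{b^2-b^{-2}}e^{2\sqrt2\varphi}-\tfrac{b^{-1}}{b-b^{-1}}T^b-\tfrac{2\epsilon}{b^2-b^{-2}}T^be^{\sqrt2\varphi},\\ T^{(b_2)}&=-\tfrac{b+b^{-1}}{2(b-b^{-1})\epsilon}e^{-\sqrt2\varphi}-\tfrac{b^{-1}}{2(b-b^{-1})}(\partial\varphi)^2+\tfrac{b}{\sqrt2(b-b^{-1})}\partial^2\varphi+\tfrac{(1+2b^{2})\epsilon}{b^2-b^{-2}}(\partial\varphi)^2e^{\sqrt2\varphi}\\ &\quad+\tfrac{\sqrt2b\epsilon}{b-b^{-1}}\partial^2\varphi\, e^{\sqrt2\varphi}+\tfrac{2\epsilon^2}{b^2-b^{-2}}e^{2\sqrt2\varphi}+\tfrac{b}{b-b^{-1}}T^b+\tfrac{2\epsilon}{b^2-b^{-2}}T^be^{\sqrt2\varphi}, \end{align*} and write $T^{(b_i)}(z)=\sum_nL_n^{(b_i)}z^{-n-2}$, $b_2^2=b^2-1$.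 Let $\mathcal O\subset\mathbb C(b)$ be the ring of rational functions regular at $b=\infty$, let $\mathcal V_{\mathcal O}\subset\mathcal V^b$ be the $\mathcal O$-submodule generated from the vacuum by the modes of $b^{-2}T^b,e,f,h$, and let $\mathcal V^\infty=\mathcal V_{\mathcal O}/b^{-1}\mathcal V_{\mathcal O}$ be the limit $b\to\infty$. Then: 1. $\mathcal V_{\mathcal O}$ spans $\mathcal V^b$ over $\mathbb C(b)$ and is closed under the vertex operators $Y(a,z)$, $a\in\mathcal V_{\mathcal O}$; these induce on $\mathcal V^\infty$ the vertex operators generated by the limits of $b^{-2}T^b,e,f,h$. 2. For all $n\in\mathbb Z$ the operators $L_n^{(b_1)}$, $L_n^{(b_2)}/b_2^2$ and $L_n^{(b)}/b^2$ preserve $\mathcal V_{\mathcal O}$, hence act on $\mathcal V^\infty$. The last two have the same limit $\ell_n$, which commutes with all modes of all vertex operators of $\mathcal V^\infty$. The limits of the $L_n^{(b_1)}$ satisfy the Virasoro relations with central charge $1$. 3. $\mathcal V^\infty$ fibres over the space of regular Sturm-Liouville operators $\partial_z^2+q(z)$, $q(z)=\sum_{n}q_nz^{-n-2}$, $q_n=0$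 for $n\ge-1$: there is a linear isomorphism $\mathcal V^\infty\cong\mathbb C[x_{-2},x_{-3},\dots]\otimes\mathcal V_{\sqrt2\mathbb Z}$ which maps the vacuum to $1\otimes 1$, under which $\ell_n$ is multiplication by the coordinate function $x_n\colon q\mapsto q_n$ if $n\le-2$ and is $0$ if $n\ge-1$, and under which, for $v\in\mathcal V_{\sqrt2\mathbb Z}$, the vertex operator of $1\otimes v$ in $\mathcal V^\infty$ is $1\otimes Y(v,z)$. 4. For an arbitrary formal series $q(z)=\sum_{n\in\mathbb Z}q_nz^{-n-2}$ the fibre $\mathcal V^\infty|_q=\mathcal V^\infty/\sum_n(\ell_n-q_n)\mathcal V^\infty$ is nonzero if and only if $q_n=0$ for all $n\ge-1$. In this case evaluation at $q$ identifies it with $\mathcal V_{\sqrt2\mathbb Z}$, compatibly with the vertex operators of $\mathcal V_{\sqrt2\mathbb Z}$, and $L_n^{(b_1)}$ acts on it by the deformed Virasoro operator $$\frac1{2\epsilon}f_{n+1}+L_n-q_n-2\epsilon\sum_{k\in\mathbb Z}q_k\,e_{n-k-1}.$$ All terms other than $L_n$ lower the degree: they map the $L_0$-eigenspace of eigenvalue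 $d$ into the sum of those of eigenvalues $<d-n$. 5. For $n=-1,0,1$ the operators $L_n^{(b_2)}$ and $L_n^{(b)}$ preserve $\mathcal V_{\mathcal O}$, and on $\mathcal V^\infty$ (where $\ell_{-1}=\ell_0=\ell_1=0$) $$L_n^{(b_2)}=-\frac1{2\epsilon}f_{n+1}-\frac{n+1}{2}h_n+\epsilon\,n(n+1)\,e_{n-1}+L_n^{(b)}+2\epsilon\sum_{k\in\mathbb Z}\ell_k\,e_{n-k-1}.$$ They define an action of $\mathfrak{sl}_2$ on $\mathcal V^\infty$, $[L_m^{(b_2)},L_n^{(b_2)}]=(m-n)L_{m+n}^{(b_2)}$, with $[L^{(b_2)}_n,\ell_k]=(n-k)\ell_{n+k}$ for all $k$. 6. The identification of the zero fibre $\mathcal V^\infty|_0$ with $\mathcal V_{\sqrt2\mathbb Z}$ turns the vertex operators of $\mathcal V^\infty$ into those of $\mathcal V_{\sqrt2\mathbb Z}$, i.e. it is an isomorphism of vertex algebras, under which $L_n^{(b_1)}$ becomes the Virasoro action deformed by the $\mathfrak{sl}_2$-connection $d+\frac1{2\epsilon}fz^0$, that is $L_n+\frac1{2\epsilon}f_{n+1}$.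 Here the Virasoro action deformed by a regular connection $d+\sum_nA_nz^{-n-1}$ is $L_n+\sum_{n'+n''=n}(A_{n''})_{n'}+\frac12\sum_{n'+n''=n}\operatorname{tr}(A_{n'}A_{n''})$. The $\mathfrak{sl}_2$-action descends to the zero fibre, where it is given by $-\frac1{2\epsilon}f_{n+1}-\frac{n+1}2h_n+\epsilon\,n(n+1)e_{n-1}$, $n=-1,0,1$. -/

import Mathlib

open scoped TensorProduct

noncomputable section

namespace Urod

/-! ### Fields, normally ordered products, state-field correspondence -/

section Fields

variable {R V : Type*} [CommRing R] [AddCommGroup V] [Module R V]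

/-- The mode `A_(n)` of a field `A(z) = ∑ₙ A_(n) z^(-n-1)`. -/
def mode (A : VertexOperator R V) (n : ℤ) : Module.End R V := VertexOperator.ncoeff A n

theorem mode_trunc (A : VertexOperator R V) (x : V) :
    ∃ N : ℤ, ∀ n, N ≤ n → mode A n x = 0 := by
  refine ⟨-HahnSeries.order ((HahnModule.of R).symm (A x)), fun n hn => ?_⟩
  exact VertexOperator.ncoeff_eq_zero_of_lt_order A n x (by omega)

/-- The field with prescribed modes `a n`, which must be truncated from above on every vector. -/
def ofModes (a : ℤ → Module.End R V) (h : ∀ x, ∃ N : ℤ, ∀ n, N ≤ n → a n x = 0) :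
    VertexOperator R V :=
  VertexOperator.of_coeff (fun k => a (-k - 1)) (by
    intro x
    obtain ⟨N, hN⟩ := h x
    refine ⟨-N - 1, fun k hk => ?_⟩
    by_contra hlt
    exact hk (hN _ (by omega)))

@[simp]
theorem mode_ofModes (a : ℤ → Module.End R V) (h) (n : ℤ) : mode (ofModes a h) n = a n := by
  simp [mode, ofModes]

/-- The identity field. -/
def idField : VertexOperator R V :=
  ofModes (fun n => if n = -1 then 1 else 0)
    (fun x => ⟨0, fun n hn => by rw [if_neg (by omega)]; rfl⟩)

/-- The derivative `∂A(z)`, with modes `(∂A)_(n) = -n A_(n-1)`. -/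
def derivField (A : VertexOperator R V) : VertexOperator R V :=
  ofModes (fun n => (-n : ℤ) • mode A (n - 1)) (fun x => by
    obtain ⟨N, hN⟩ := mode_trunc A x
    exact ⟨N + 1, fun n hn => by simp [hN (n - 1) (by omega)]⟩)

/-- The `j`-th term of the `k`-th mode of the `n`-th product `A_(n)B` of two fields. -/
def nprodTerm (A B : VertexOperator R V) (n k : ℤ) (j : ℕ) : Module.End R V :=
  ((-1 : ℤ) ^ j * Ring.choose n j) •
    (mode A (n - j) * mode B (k + j) - (n.negOnePow : ℤ) • (mode B (n + k - j) * mode A j))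

theorem nprodTerm_trunc (A B : VertexOperator R V) (n : ℤ) (x : V) :
    (∃ N : ℤ, ∀ k, N ≤ k → ∀ j, nprodTerm A B n k j x = 0) ∧
      ∀ k, (Function.support fun j => nprodTerm A B n k j x).Finite := by
  obtain ⟨NA, hA⟩ := mode_trunc A x
  obtain ⟨NB, hB⟩ := mode_trunc B x
  choose M hM using fun j : ℕ => mode_trunc B (mode A j x)
  constructor
  · obtain ⟨C, hC⟩ : ∃ C : ℤ, ∀ j : ℕ, (j : ℤ) < NA → M j + j - n ≤ C := by
      obtain ⟨C, hC⟩ := ((Finset.range NA.toNat).image fun j : ℕ => M j + j - n).bddAbove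
      refine ⟨C, fun j hj => hC ?_⟩
      simp only [Finset.coe_image, Set.mem_image, Finset.coe_range, Set.mem_Iio]
      exact ⟨j, by omega, rfl⟩
    refine ⟨max NB C, fun k hk j => ?_⟩
    have h1 : mode B (k + j) x = 0 := hB _ (by have := le_max_left NB C; omega)
    have h2 : mode B (n + k - j) (mode A j x) = 0 := by
      by_cases hj : (j : ℤ) < NA
      · exact hM j _ (by have := hC j hj; have := le_max_right NB C; omega)
      · rw [hA _ (by omega), map_zero]
    simp [nprodTerm, h1, h2]
  · intro k
    refine (Set.finite_lt_nat (max NA (NB - k)).toNat).subset fun j hj => ?_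
    by_contra hlt
    replace hlt : (max NA (NB - k)).toNat ≤ j := not_lt.1 hlt
    have hmax := Int.self_le_toNat (max NA (NB - k))
    have h1 : mode B (k + j) x = 0 :=
      hB _ (by have := le_max_right NA (NB - k); omega)
    have h2 : mode A j x = 0 := hA _ (by have := le_max_left NA (NB - k); omega)
    exact hj (by simp [nprodTerm, h1, h2])

/-- The `n`-th product `A_(n)B` of two fields (`n ∈ ℤ`), that is
`(A_(n)B)(w) = Res_z (A(z)B(w) (z-w)^n - B(w)A(z) (-w+z)^n)`; in modes
`(A_(n)B)_(k) = ∑_{j ≥ 0} (-1)^j (n choose j) (A_(n-j) B_(k+j) - (-1)^n B_(n+k-j) A_(j))`. -/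
def nprod (A : VertexOperator R V) (n : ℤ) (B : VertexOperator R V) : VertexOperator R V :=
  ofModes
    (fun k =>
      { toFun := fun x => ∑ᶠ j : ℕ, nprodTerm A B n k j x
        map_add' := fun x y => by
          simp only [map_add]
          exact finsum_add_distrib ((nprodTerm_trunc A B n x).2 k) ((nprodTerm_trunc A B n y).2 k)
        map_smul' := fun r x => by
          simp only [map_smul, RingHom.id_apply]
          exact (smul_finsum' r ((nprodTerm_trunc A B n x).2 k)).symm })
    (fun x => by
      obtain ⟨N, hN⟩ := (nprodTerm_trunc A B n x).1
      refine ⟨N, fun k hk => ?_⟩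
      simp [hN k hk])

/-- The normally ordered product `:A(z)B(z):`. -/
def normOrd (A B : VertexOperator R V) : VertexOperator R V := nprod A (-1) B

/-- The state-field correspondence `a ↦ Y(a, z)` of the vertex algebra with vacuum vector `vac`
that is generated by the (mutually local) fields in `G`, given by its graph:
`StateField vac G a A` means that `A(z) = Y(a, z)`.  It is obtained from the identity field and the
generating fields by linear combinations and by `Y(a_(n) b, z) = Y(a, z)_(n) Y(b, z)`. -/
inductive StateField (vac : V) (G : Set (VertexOperator R V)) : V → VertexOperator R V → Prop
  | vacuum : StateField vac G vac idField
  | gen (A : VertexOperator R V) : A ∈ G → StateField vac G (mode A (-1) vac) A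
  | add (a b : V) (A B : VertexOperator R V) :
      StateField vac G a A → StateField vac G b B → StateField vac G (a + b) (A + B)
  | smul (r : R) (a : V) (A : VertexOperator R V) :
      StateField vac G a A → StateField vac G (r • a) (r • A)
  | nprod (n : ℤ) (a b : V) (A B : VertexOperator R V) :
      StateField vac G a A → StateField vac G b B → StateField vac G (mode A n b) (nprod A n B)

variable {W : Type*} [AddCommGroup W] [Module R W]

/-- The field `A(z) ⊗ 1` on `V ⊗ W`. -/
def leftField (A : VertexOperator R V) : VertexOperator R (V ⊗[R] W) :=
  ofModes (fun n => (mode A n).rTensor W) (fun x => by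
    induction x using TensorProduct.induction_on with
    | zero => exact ⟨0, fun n _ => by simp⟩
    | tmul v w =>
      obtain ⟨N, hN⟩ := mode_trunc A v
      exact ⟨N, fun n hn => by simp [hN n hn]⟩
    | add x y hx hy =>
      obtain ⟨N, hN⟩ := hx
      obtain ⟨M, hM⟩ := hy
      exact ⟨max N M, fun n hn => by
        rw [map_add, hN n ((le_max_left _ _).trans hn), hM n ((le_max_right _ _).trans hn),
          add_zero]⟩)

/-- The field `1 ⊗ A(z)` on `V ⊗ W`. -/
def rightField (A : VertexOperator R W) : VertexOperator R (V ⊗[R] W) :=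
  ofModes (fun n => (mode A n).lTensor V) (fun x => by
    induction x using TensorProduct.induction_on with
    | zero => exact ⟨0, fun n _ => by simp⟩
    | tmul v w =>
      obtain ⟨N, hN⟩ := mode_trunc A w
      exact ⟨N, fun n hn => by simp [hN n hn]⟩
    | add x y hx hy =>
      obtain ⟨N, hN⟩ := hx
      obtain ⟨M, hM⟩ := hy
      exact ⟨max N M, fun n hn => by
        rw [map_add, hN n ((le_max_left _ _).trans hn), hM n ((le_max_right _ _).trans hn),
          add_zero]⟩)

end Fields

/-! ### The Virasoro vertex algebra of central charge `c` -/

section Virasoro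

variable (F : Type*) [Field F]

/-- The relations `[Lₘ, Lₙ] = (m - n) Lₘ₊ₙ + (c/12) (m³ - m) δₘ,₋ₙ`. -/
inductive VirRel (c : F) : FreeAlgebra F ℤ → FreeAlgebra F ℤ → Prop
  | comm (m n : ℤ) : VirRel c
      (FreeAlgebra.ι F m * FreeAlgebra.ι F n)
      (FreeAlgebra.ι F n * FreeAlgebra.ι F m + ((m - n : ℤ) : F) • FreeAlgebra.ι F (m + n) +
        algebraMap F _ (if m + n = 0 then c / 12 * ((m : F) ^ 3 - (m : F)) else 0))

/-- The enveloping algebra of the Virasoro algebra, with the central element specialised to `c`. -/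
abbrev VirAlg (c : F) : Type _ := RingQuot (VirRel F c)

/-- The generator `Lₙ`. -/
def virGen (c : F) (n : ℤ) : VirAlg F c := RingQuot.mkAlgHom F (VirRel F c) (FreeAlgebra.ι F n)

/-- The vacuum module of central charge `c`: the universal module generated by a vector `|0⟩` with
`Lₙ|0⟩ = 0` for `n ≥ -1`, that is the Verma module of highest weight `0` modulo `L₋₁|0⟩`. -/
def VirVac (c : F) : Type _ :=
  VirAlg F c ⧸ (Ideal.span {x | ∃ n : ℤ, -1 ≤ n ∧ x = virGen F c n} : Ideal (VirAlg F c))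

instance (c : F) : AddCommGroup (VirVac F c) := inferInstanceAs (AddCommGroup (VirAlg F c ⧸ _))

instance (c : F) : Module (VirAlg F c) (VirVac F c) :=
  inferInstanceAs (Module (VirAlg F c) (VirAlg F c ⧸ _))

instance (c : F) : Module F (VirVac F c) := inferInstanceAs (Module F (VirAlg F c ⧸ _))

instance (c : F) : IsScalarTower F (VirAlg F c) (VirVac F c) :=
  inferInstanceAs (IsScalarTower F (VirAlg F c) (VirAlg F c ⧸ _))

/-- The vacuum vector. -/
def virVacuum (c : F) : VirVac F c :=
  (Submodule.Quotient.mk 1 :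
    VirAlg F c ⧸ (Ideal.span {x | ∃ n : ℤ, -1 ≤ n ∧ x = virGen F c n} : Ideal (VirAlg F c)))

variable {F} in
theorem virVacuum_generates (c : F) (x : VirVac F c) : ∃ u : VirAlg F c, u • virVacuum F c = x := by
  obtain ⟨u, rfl⟩ := Submodule.Quotient.mk_surjective _ x
  refine ⟨u, ?_⟩
  change Submodule.Quotient.mk (u * 1) = Submodule.Quotient.mk u
  rw [mul_one]

variable {F} in
theorem virGen_smul_vacuum (c : F) (n : ℤ) (hn : -1 ≤ n) : virGen F c n • virVacuum F c = 0 := by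
  change Submodule.Quotient.mk (virGen F c n * 1) = Submodule.Quotient.mk 0
  rw [mul_one, Submodule.Quotient.mk_zero, Submodule.Quotient.mk_eq_zero]
  exact Ideal.subset_span ⟨n, hn, rfl⟩

/-- The action of `Lₙ` on the vacuum module. -/
def virL (c : F) (n : ℤ) : Module.End F (VirVac F c) :=
  Algebra.lsmul F F (VirVac F c) (virGen F c n)

variable {F}

theorem virL_apply (c : F) (n : ℤ) (x : VirVac F c) : virL F c n x = virGen F c n • x := rfl

theorem virGen_comm (c : F) (m n : ℤ) :
    virGen F c m * virGen F c n = virGen F c n * virGen F c m +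
      ((m - n : ℤ) : F) • virGen F c (m + n) +
        algebraMap F _ (if m + n = 0 then c / 12 * ((m : F) ^ 3 - (m : F)) else 0) := by
  have h := RingQuot.mkAlgHom_rel F (VirRel.comm (c := c) m n)
  simp only [map_mul, map_add, map_smul, AlgHom.commutes] at h
  exact h

theorem virL_trunc (c : F) (x : VirVac F c) : ∃ N : ℤ, ∀ n, N ≤ n → virL F c n x = 0 := by
  have key : ∀ a : FreeAlgebra F ℤ, ∀ y : VirVac F c,
      (∃ N : ℤ, ∀ n, N ≤ n → virGen F c n • y = 0) →
      ∃ N : ℤ, ∀ n, N ≤ n → virGen F c n • (RingQuot.mkAlgHom F (VirRel F c) a • y) = 0 := by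
    intro a
    induction a using FreeAlgebra.induction with
    | grade0 r =>
      rintro y ⟨N, hN⟩
      refine ⟨N, fun n hn => ?_⟩
      rw [AlgHom.commutes, ← mul_smul, ← Algebra.commutes, mul_smul, hN n hn, smul_zero]
    | grade1 k =>
      rintro y ⟨N, hN⟩
      refine ⟨max (max N (N - k)) (1 - k), fun n hn => ?_⟩
      have h1 : N ≤ n := ((le_max_left _ _).trans (le_max_left _ _)).trans hn
      have h2 : N - k ≤ n := ((le_max_right _ _).trans (le_max_left _ _)).trans hn
      have h3 : 1 - k ≤ n := (le_max_right _ _).trans hn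
      change virGen F c n • (virGen F c k • y) = 0
      rw [← mul_smul, virGen_comm, if_neg (by omega), map_zero, add_zero, add_smul, mul_smul,
        hN n h1, smul_zero, zero_add, smul_assoc, hN (n + k) (by omega)]
      exact smul_zero _
    | mul a b ha hb =>
      intro y hy
      obtain ⟨N, hN⟩ := ha _ (hb y hy)
      exact ⟨N, fun n hn => by rw [map_mul, mul_smul]; exact hN n hn⟩
    | add a b ha hb =>
      intro y hy
      obtain ⟨N, hN⟩ := ha y hy
      obtain ⟨M, hM⟩ := hb y hy
      exact ⟨max N M, fun n hn => by
        rw [map_add, add_smul, smul_add, hN n ((le_max_left _ _).trans hn),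
          hM n ((le_max_right _ _).trans hn), add_zero]⟩
  obtain ⟨u, rfl⟩ := virVacuum_generates c x
  obtain ⟨a, rfl⟩ := RingQuot.mkAlgHom_surjective F (VirRel F c) u
  exact key a (virVacuum F c) ⟨-1, virGen_smul_vacuum c⟩

/-- The Virasoro field `T(z) = ∑ₙ Lₙ z^(-n-2)`. -/
def virField (c : F) : VertexOperator F (VirVac F c) :=
  ofModes (fun n => virL F c (n - 1)) (fun x => by
    obtain ⟨N, hN⟩ := virL_trunc c x
    exact ⟨N + 1, fun n hn => hN _ (by omega)⟩)

end Virasoro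

/-! ### The lattice vertex algebra of the lattice `√2ℤ` -/

section Lattice

variable (F : Type*) [Field F]

/-- The underlying space `F[√2ℤ] ⊗ F[h₋₁, h₋₂, …]`, where `h = √2 ∂φ`.  The variable `X k` is
`h₋ₖ₋₁`, and `Finsupp.single m P` is `P · e^{m√2φ}`. -/
abbrev LatVOA : Type _ := ℤ →₀ MvPolynomial ℕ F

/-- The vacuum vector. -/
def latVacuum : LatVOA F := Finsupp.single 0 1

/-- The modes of `h(z) = √2 ∂φ(z)`: `hₙ` for `n < 0` is multiplication by the variable `hₙ`, `h₀`
is `2m` on the sector of `e^{m√2φ}`, and `hₙ` for `n > 0` is `2n ∂/∂h₋ₙ`. -/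
def heisMode (n : ℤ) : Module.End F (LatVOA F) :=
  Finsupp.lsum F fun m : ℤ => (Finsupp.lsingle m).comp
    (if n < 0 then LinearMap.mulLeft F (MvPolynomial.X (-n - 1).toNat)
    else if n = 0 then ((2 * m : ℤ) : F) • LinearMap.id
    else ((2 * n : ℤ) : F) • (MvPolynomial.pderiv (n - 1).toNat).toLinearMap)

variable {F} in
theorem heisMode_single (n m : ℤ) (P : MvPolynomial ℕ F) :
    heisMode F n (Finsupp.single m P) = Finsupp.single m
      ((if n < 0 then LinearMap.mulLeft F (MvPolynomial.X (-n - 1).toNat)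
      else if n = 0 then ((2 * m : ℤ) : F) • LinearMap.id
      else ((2 * n : ℤ) : F) • (MvPolynomial.pderiv (n - 1).toNat).toLinearMap) P) := by
  simp [heisMode]

/-- The field `h(z) = √2 ∂φ(z)`. -/
def heisField : VertexOperator F (LatVOA F) :=
  ofModes (heisMode F) (fun x => by
    induction x using Finsupp.induction_linear with
    | zero => exact ⟨0, fun n _ => by simp⟩
    | add x y hx hy =>
      obtain ⟨N, hN⟩ := hx
      obtain ⟨M, hM⟩ := hy
      exact ⟨max N M, fun n hn => by
        rw [map_add, hN n ((le_max_left _ _).trans hn), hM n ((le_max_right _ _).trans hn),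
          add_zero]⟩
    | single m P =>
      refine ⟨P.vars.sup id + 2, fun n hn => ?_⟩
      have hv : (n - 1).toNat ∉ P.vars := fun hmem => by
        have h1 : (n - 1).toNat ≤ P.vars.sup id := Finset.le_sup (f := id) hmem
        omega
      rw [heisMode_single, if_neg (by omega), if_neg (by omega), LinearMap.smul_apply]
      change Finsupp.single m (_ • MvPolynomial.pderiv _ P) = 0
      rw [MvPolynomial.pderiv_eq_zero_of_notMem_vars hv, smul_zero, Finsupp.single_zero])

/-- The power series `∑_{n ≥ 1} m h₋ₙ zⁿ / n`. -/
def creationExponent (m : ℤ) : PowerSeries (MvPolynomial ℕ F) :=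
  PowerSeries.mk fun n => if n = 0 then 0 else
    MvPolynomial.C ((m : F) / (n : F)) * MvPolynomial.X (n - 1)

/-- The power series `exp (∑_{n ≥ 1} m h₋ₙ zⁿ / n)`. -/
def creationExp (m : ℤ) : PowerSeries (MvPolynomial ℕ F) :=
  PowerSeries.mk fun k => ∑ j ∈ Finset.range (k + 1),
    MvPolynomial.C ((Nat.factorial j : F)⁻¹) * PowerSeries.coeff k (creationExponent F m ^ j)

/-- The operator `exp (-∑_{n ≥ 1} m hₙ z⁻ⁿ / n)`.  Since `hₙ = 2n ∂/∂h₋ₙ`, it is the substitution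
`h₋ₙ ↦ h₋ₙ - 2m z⁻ⁿ`. -/
def annihilationExp (m : ℤ) : MvPolynomial ℕ F →+* LaurentSeries (MvPolynomial ℕ F) :=
  MvPolynomial.eval₂Hom (HahnSeries.C.comp MvPolynomial.C) fun k =>
    HahnSeries.C (MvPolynomial.X k) -
      HahnSeries.single (-((k : ℤ) + 1)) (MvPolynomial.C ((2 * m : ℤ) : F))

/-- The field
`e^{m√2φ}(z) = exp (∑_{n ≥ 1} m h₋ₙ zⁿ/n) exp (-∑_{n ≥ 1} m hₙ z⁻ⁿ/n) e^{m√2φ} z^{m h₀}`. -/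
def expField (m : ℤ) : VertexOperator F (LatVOA F) :=
  Finsupp.lsum F fun m' : ℤ =>
    { toFun := fun P => HahnModule.of F
        ((HahnSeries.single (2 * m * m') (1 : MvPolynomial ℕ F) *
          (HahnSeries.ofPowerSeries ℤ _ (creationExp F m) * annihilationExp F m P)).map
            (Finsupp.singleAddHom (m + m')))
      map_add' := fun P Q => by
        rw [← HahnModule.of_add]
        congr 1
        ext1
        funext n
        simp [mul_add]
      map_smul' := fun r P => by
        apply (HahnModule.of F).symm.injective
        ext1
        funext n
        change Finsupp.single (m + m') ((HahnSeries.single (2 * m * m') (1 : MvPolynomial ℕ F) *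
            (HahnSeries.ofPowerSeries ℤ _ (creationExp F m) *
              annihilationExp F m (r • P))).coeff n) =
          r • Finsupp.single (m + m') ((HahnSeries.single (2 * m * m') (1 : MvPolynomial ℕ F) *
            (HahnSeries.ofPowerSeries ℤ _ (creationExp F m) * annihilationExp F m P)).coeff n)
        have h : annihilationExp F m (r • P) =
            HahnSeries.C (MvPolynomial.C r) * annihilationExp F m P := by
          rw [MvPolynomial.smul_eq_C_mul, map_mul]
          simp [annihilationExp]
        rw [h, mul_left_comm (HahnSeries.ofPowerSeries ℤ _ _),
          mul_left_comm (HahnSeries.single _ _), HahnSeries.C_mul_eq_smul, HahnSeries.coeff_smul,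
          smul_eq_mul, ← MvPolynomial.smul_eq_C_mul, Finsupp.smul_single] }

/-- The currents of the affine Lie algebra `sl₂` at level one, `V_{√2ℤ} = L₁(sl₂)`:
`e(z) = e^{√2φ}(z)`. -/
def eField : VertexOperator F (LatVOA F) := expField F 1

/-- `f(z) = e^{-√2φ}(z)`. -/
def fField : VertexOperator F (LatVOA F) := expField F (-1)

/-- The generating fields of `V_{√2ℤ}`. -/
def latGens : Set (VertexOperator F (LatVOA F)) := {eField F, heisField F, fField F}

/-- The standard Virasoro operators of `V_{√2ℤ}`, the modes of `(1/2) :(∂φ)²: = (1/4) :h h:`. -/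
def latL (n : ℤ) : Module.End F (LatVOA F) :=
  (1 / 4 : F) • mode (normOrd (heisField F) (heisField F)) (n + 1)

end Lattice

/-! ### The family `Vir^b ⊗ V_{√2ℤ}` -/

section Family

/-- The field `ℂ(b)` of rational functions in the parameter `b`. -/
abbrev K : Type := RatFunc ℂ

/-- The parameter `b`. -/
def b : K := RatFunc.X

/-- The central charge `c = 1 + 6 (b⁻¹ + b)²` of `Vir^b`. -/
def centralCharge : K := 1 + 6 * (b⁻¹ + b) ^ 2

/-- The space `Vir^b ⊗ V_{√2ℤ}`. -/
abbrev Fam : Type := VirVac K centralCharge ⊗[K] LatVOA K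

/-- The vacuum vector. -/
def famVacuum : Fam := virVacuum K centralCharge ⊗ₜ[K] latVacuum K

/-- The field `T^b(z) = ∑ₙ Lₙ^(b) z^(-n-2)`. -/
def Tb : VertexOperator K Fam := leftField (virField centralCharge)

/-- The operator `Lₙ^(b)`. -/
def Lb (n : ℤ) : Module.End K Fam := mode Tb (n + 1)

/-- The field `e^{m√2φ}(z)` on `Vir^b ⊗ V_{√2ℤ}`. -/
def famExp (m : ℤ) : VertexOperator K Fam := rightField (expField K m)

/-- The field `e^{√2φ}(z)` on `Vir^b ⊗ V_{√2ℤ}`. -/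
def famE : VertexOperator K Fam := rightField (eField K)

/-- The field `e^{-√2φ}(z)` on `Vir^b ⊗ V_{√2ℤ}`. -/
def famF : VertexOperator K Fam := rightField (fField K)

/-- The field `h(z) = √2 ∂φ(z)` on `Vir^b ⊗ V_{√2ℤ}`. -/
def famH : VertexOperator K Fam := rightField (heisField K)

/-- The generating fields of `Vir^b ⊗ V_{√2ℤ}`. -/
def famGens : Set (VertexOperator K Fam) := {Tb, famE, famH, famF}

/-- The conformal field `T^(b₁)(z)`.  In terms of `h = √2 ∂φ` one has `(∂φ)² = (1/2) h²` and
`√2 ∂²φ = ∂h`. -/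
def T1 (ε : ℂ) : VertexOperator K Fam :=
  ((b + b⁻¹) / (2 * (b - b⁻¹) * RatFunc.C ε)) • famF
  + (b / (4 * (b - b⁻¹))) • normOrd famH famH
  - (b⁻¹ / (2 * (b - b⁻¹))) • derivField famH
  - ((1 + 2 * b⁻¹ ^ 2) * RatFunc.C ε / (2 * (b ^ 2 - b⁻¹ ^ 2))) • normOrd famH (normOrd famH famE)
  - (b⁻¹ * RatFunc.C ε / (b - b⁻¹)) • normOrd (derivField famH) famE
  - (2 * RatFunc.C ε ^ 2 / (b ^ 2 - b⁻¹ ^ 2)) • famExp 2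
  - (b⁻¹ / (b - b⁻¹)) • Tb
  - (2 * RatFunc.C ε / (b ^ 2 - b⁻¹ ^ 2)) • normOrd Tb famE

/-- The conformal field `T^(b₂)(z)`. -/
def T2 (ε : ℂ) : VertexOperator K Fam :=
  -((b + b⁻¹) / (2 * (b - b⁻¹) * RatFunc.C ε)) • famF
  - (b⁻¹ / (4 * (b - b⁻¹))) • normOrd famH famH
  + (b / (2 * (b - b⁻¹))) • derivField famH
  + ((1 + 2 * b ^ 2) * RatFunc.C ε / (2 * (b ^ 2 - b⁻¹ ^ 2))) • normOrd famH (normOrd famH famE)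
  + (b * RatFunc.C ε / (b - b⁻¹)) • normOrd (derivField famH) famE
  + (2 * RatFunc.C ε ^ 2 / (b ^ 2 - b⁻¹ ^ 2)) • famExp 2
  + (b / (b - b⁻¹)) • Tb
  + (2 * RatFunc.C ε / (b ^ 2 - b⁻¹ ^ 2)) • normOrd Tb famE

/-- The operator `Lₙ^(b₁)`. -/
def L1 (ε : ℂ) (n : ℤ) : Module.End K Fam := mode (T1 ε) (n + 1)

/-- The operator `Lₙ^(b₂)`. -/
def L2 (ε : ℂ) (n : ℤ) : Module.End K Fam := mode (T2 ε) (n + 1)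

end Family

/-! ### The limit `b → ∞` -/

section Limit

open Classical in
/-- The ring of rational functions in `b` that are regular at `b = ∞`. -/
abbrev O : Subring K := (RatFunc.inftyValuation ℂ).integer

open Classical in
/-- The element `b⁻¹` of `O`. -/
def bInv : O := ⟨b⁻¹, by
  rw [Valuation.mem_integer_iff, map_inv₀, b, RatFunc.inftyValuation.X, ← WithZero.exp_neg,
    ← WithZero.exp_zero, WithZero.exp_le_exp]
  norm_num⟩

open Classical in
/-- The inclusion of the constants `ℂ ⊆ O`. -/
def constHom : ℂ →+* O := RatFunc.C.codRestrict O (fun k => by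
  rw [Valuation.mem_integer_iff]
  by_cases hk : k = 0
  · simp [hk]
  · rw [RatFunc.inftyValuation.C _ hk])

/-- The integral form of `Vir^b ⊗ V_{√2ℤ}`: the `O`-submodule generated from the vacuum by the modes
of `b⁻² T^b(z)`, `e^{±√2φ}(z)` and `h(z)`. -/
def integralForm : Submodule O Fam :=
  sInf {N | famVacuum ∈ N ∧ ∀ A ∈ ({b⁻¹ ^ 2 • Tb, famE, famH, famF} : Set (VertexOperator K Fam)),
    ∀ n : ℤ, ∀ x ∈ N, mode A n x ∈ N}

/-- An operator preserves the integral form. -/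
def Preserves (D : Module.End K Fam) : Prop := ∀ x ∈ integralForm, D x ∈ integralForm

/-- The limit `b → ∞` of `Vir^b ⊗ V_{√2ℤ}`: the reduction of the integral form modulo `b⁻¹`. -/
def Limit : Type := QuotSMulTop bInv integralForm

instance : AddCommGroup Limit := inferInstanceAs (AddCommGroup (QuotSMulTop bInv integralForm))

instance instModuleOLimit : Module O Limit :=
  inferInstanceAs (Module O (QuotSMulTop bInv integralForm))

instance instModuleLimit : Module ℂ Limit := Module.compHom Limit constHom

/-- The reduction map. -/
def toLimit : integralForm →ₗ[O] Limit := Submodule.mkQ _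

/-- The limit of an operator that preserves the integral form (and `0` for other operators). -/
def limitOp (D : Module.End K Fam) : Module.End ℂ Limit :=
  open Classical in
  if h : Preserves D then
    let D' : Limit →ₗ[O] Limit := QuotSMulTop.map bInv 
      { toFun := fun x => ⟨D x, h x x.2⟩
        map_add' := fun x y => Subtype.ext (map_add D (x : Fam) (y : Fam))
        map_smul' := fun r x => Subtype.ext (map_smul D (r : K) (x : Fam)) }
    { toFun := D'
      map_add' := map_add D'
      map_smul' := fun r x => map_smul D' (constHom r) x }
  else 0

theorem limitOp_toLimit {D : Module.End K Fam} (h : Preserves D) (x : integralForm) :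
    limitOp D (toLimit x) = toLimit ⟨D x, h x x.2⟩ := by
  rw [limitOp, dif_pos h]
  rfl

/-- The limit of a field whose modes preserve the integral form. -/
def limitField (A : VertexOperator K Fam) : VertexOperator ℂ Limit :=
  ofModes (fun n => limitOp (mode A n)) (fun x => by
    obtain ⟨y, rfl⟩ : ∃ y, toLimit y = x := Submodule.mkQ_surjective _ x
    obtain ⟨N, hN⟩ := mode_trunc A y
    refine ⟨N, fun n hn => ?_⟩
    by_cases h : Preserves (mode A n)
    · rw [limitOp_toLimit h]
      have : (⟨mode A n y, h y y.2⟩ : integralForm) = 0 := Subtype.ext (hN n hn)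
      rw [this, map_zero]
    · rw [limitOp, dif_neg h, LinearMap.zero_apply])

/-- The vacuum vector of the limit. -/
def limitVacuum : Limit :=
  toLimit ⟨famVacuum, Submodule.mem_sInf.2 fun _ hN => hN.1⟩

/-- The limits of `b⁻² T^b(z)`, `e^{±√2φ}(z)` and `h(z)`, which generate the limit. -/
def limitGens : Set (VertexOperator ℂ Limit) :=
  {limitField (b⁻¹ ^ 2 • Tb), limitField famE, limitField famH, limitField famF}

/-- The central operators `ℓₙ = lim Lₙ^(b₂) / b₂²`, where `b₂² = b² - 1`. -/
def ell (ε : ℂ) (n : ℤ) : Module.End ℂ Limit := limitOp ((b ^ 2 - 1)⁻¹ • L2 ε n)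

end Limit

/-! ### Sturm-Liouville operators and fibres -/

section SturmLiouville

/-- A formal Sturm-Liouville operator `∂² + q(z)`, `q(z) = ∑ₙ qₙ z^(-n-2)`, given by the
coefficients `qₙ`. -/
structure SturmLiouville where
  coeff : ℤ → ℂ

/-- The operator is regular at `z = 0`: `q(z)` contains no negative powers of `z`. -/
def SturmLiouville.IsRegular (q : SturmLiouville) : Prop := ∀ n : ℤ, -1 ≤ n → q.coeff n = 0

/-- The trivial operator `∂²`. -/
instance : Zero SturmLiouville := ⟨⟨fun _ => 0⟩⟩

/-- The coordinate function `∂² + q ↦ qₙ` in the polynomial ring of functions on the space of regular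
Sturm-Liouville operators, whose variable `X k` is the coordinate `q₋ₖ₋₂` (the coefficient of `zᵏ`
in `q(z)`). -/
def coord (n : ℤ) : MvPolynomial ℕ ℂ := if n ≤ -2 then MvPolynomial.X (-n - 2).toNat else 0

/-- The value of a function at a regular Sturm-Liouville operator. -/
def evalAt (q : SturmLiouville) : MvPolynomial ℕ ℂ →ₐ[ℂ] ℂ :=
  MvPolynomial.aeval fun k : ℕ => q.coeff (-(k : ℤ) - 2)

/-- The subspace spanned by all `(ℓₙ - qₙ) x`. -/
def fibreRel (ε : ℂ) (q : SturmLiouville) : Submodule ℂ Limit :=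
  ⨆ n : ℤ, LinearMap.range (ell ε n - q.coeff n • LinearMap.id)

/-- The fibre of the limit over `∂² + q`. -/
abbrev Fibre (ε : ℂ) (q : SturmLiouville) : Type := Limit ⧸ fibreRel ε q

/-- The restriction of an element of the limit to the fibre. -/
def toFibre (ε : ℂ) (q : SturmLiouville) : Limit →ₗ[ℂ] Fibre ε q := (fibreRel ε q).mkQ

/-- The deformed Virasoro operators
`(1/2ε) fₙ₊₁ + Lₙ - qₙ - 2ε ∑ₖ qₖ eₙ₋ₖ₋₁` on `V_{√2ℤ}`. -/
def deformedL (ε : ℂ) (q : SturmLiouville) (n : ℤ) (v : LatVOA ℂ) : LatVOA ℂ :=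
  (1 / (2 * ε)) • mode (fField ℂ) (n + 1) v + latL ℂ n v - q.coeff n • v
    - (2 * ε) • ∑ᶠ k : ℤ, q.coeff k • mode (eField ℂ) (n - k - 1) v

/-- The operators `-(1/2ε) fₙ₊₁ + (1/√2) (∂²φ)ₙ + ε n (n+1) eₙ₋₁` on `V_{√2ℤ}`, where
`(1/√2) ∂²φ = (1/2) ∂h`. -/
def sl2Op (ε : ℂ) (n : ℤ) : Module.End ℂ (LatVOA ℂ) :=
  -(1 / (2 * ε)) • mode (fField ℂ) (n + 1)
    + (1 / 2 : ℂ) • mode (derivField (heisField ℂ)) (n + 1)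
    + (ε * (n * (n + 1))) • mode (eField ℂ) (n - 1)

/-- The operators `L₋₁, L₀, L₁` define an action of the Lie algebra `sl₂ = ⟨L₋₁, L₀, L₁⟩`, with
`[Lₘ, Lₙ] = (m - n) Lₘ₊ₙ`. -/
def IsSl2Action {V : Type*} [AddCommGroup V] [Module ℂ V] (L : ℤ → Module.End ℂ V) : Prop :=
  ⁅L 1, L (-1)⁆ = (2 : ℂ) • L 0 ∧ ⁅L 0, L (-1)⁆ = L (-1) ∧ ⁅L 0, L 1⁆ = -L 1

/-- A formal `sl₂`-connection `d + A(z)`, `A(z) = ∑ₙ Aₙ z^(-n-1)`, given by the coefficients `Aₙ`. -/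
abbrev SlConnection : Type := ℤ → LieAlgebra.SpecialLinear.sl (Fin 2) ℂ

/-- The mode `aₙ` of the current `a(z)` on `V_{√2ℤ} = L₁(sl₂)` for `a ∈ sl₂`. -/
def current (a : LieAlgebra.SpecialLinear.sl (Fin 2) ℂ) (n : ℤ) : Module.End ℂ (LatVOA ℂ) :=
  (a : Matrix (Fin 2) (Fin 2) ℂ) 0 1 • mode (eField ℂ) n
    + (a : Matrix (Fin 2) (Fin 2) ℂ) 0 0 • mode (heisField ℂ) n
    + (a : Matrix (Fin 2) (Fin 2) ℂ) 1 0 • mode (fField ℂ) n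

/-- The Virasoro action on `V_{√2ℤ}` deformed by a regular connection `d + A(z)`:
`Lₙ + ∑_{n'+n''=n} (A_{n''})_{n'} + (1/2) ∑_{n'+n''=n} ⟨A_{n'}, A_{n''}⟩`
with the trace form `⟨x, y⟩ = tr (xy)`. -/
def connectionL (A : SlConnection) (n : ℤ) (v : LatVOA ℂ) : LatVOA ℂ :=
  latL ℂ n v + (∑ᶠ k : ℤ, current (A k) (n - k) v)
    + ((1 / 2 : ℂ) * ∑ᶠ k : ℤ, Matrix.trace
        ((A k : Matrix (Fin 2) (Fin 2) ℂ) * (A (n - k) : Matrix (Fin 2) (Fin 2) ℂ))) • v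

/-- The connection `d + (1/2ε) f z⁰`. -/
def fConnection (ε : ℂ) : SlConnection := fun k =>
  if k = -1 then
    LieAlgebra.SpecialLinear.single 1 0 (by decide) (1 / (2 * ε))
  else 0

end SturmLiouville

end Urod

end

open Urod

noncomputable section

set_option linter.unusedSectionVars false

namespace Urod

/-! ### Modes of products of fields, and additive maps compatible with them -/

section Fields

variable {R V : Type*} [CommRing R] [AddCommGroup V] [Module R V]

/-! At large b the central charge grows like 6b², so the rescaled operators b⁻²Lₙ^(b) have
commutators that tend to 0. In the limit the Virasoro factor therefore becomes a commutative
algebra, generated by operators `el n` that commute with the lattice factor and vanish for n ≥ -1.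
The lattice factor is defined over ℂ and reduces without change. The vectors p(ℓ)v thus span the
limit, which gives a surjection `limitSection` from ℂ[x₋₂, x₋₃, …] ⊗ V_{√2ℤ}.

The main point is that this surjection is injective, i.e. that no relation between the ℓₙ appears at
b = ∞. This is proved with a free boson g. After rescaling, b⁻²T^b acts on a Fock space by (1/4):gg:
with a background charge term, where [gₘ, gₙ] = 2mb⁻²δ. These formulas have coefficients in O, so
the integral form is sent to polynomials over O (`exists_integral_fockPairing`). At b⁻¹ = 0 the
annihilation modes vanish and the realization becomes the Miura map g ↦ (1/4)g² - (i/2)∂g. The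
Riccati equation can be solved recursively for g with g(0) = 0, so the Miura map on functions has a
left inverse (`riccati_miura`). An element in the kernel of `limitSection` has a lift divisible by
b⁻¹; all its Fock images then reduce to 0, and so do its coefficients.

The conformal fields are handled coefficient by coefficient. Each term is a rational function
regular at infinity times a product of generating fields, and limits are compatible with products
because every mode of a product is a pointwise finite sum. In T^(b₁) the terms f, (1/4):hh:, -ℓ and
-2εℓe survive. In T^(b₂)/b₂² only ℓ survives. For n = -1, 0, 1 the central term n³ - n vanishes and
Lₙ^(b) itself preserves the integral form, so Lₙ^(b₂) has a limit without division; there the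
identity :h:he:: + :(∂h)e: = ∂²e produces n(n+1)eₙ₋₁.

The Virasoro and sl₂ relations of the limits follow from the level-one commutators on V_{√2ℤ}. These
are derived from the explicit vertex operators by highest weight arguments: a family of operators
with the right commutators with the Heisenberg and Virasoro modes is determined by its lowest-weight
values on the vectors e^{j√2φ} (`IsBiprimary.eq_zero`), and those values are found by a one-step
recursion from L₁. In [L₁-type operators], the bracket of (1/2ε)f with -2εℓe gives exactly the term
-(m-n)ℓₘ₊ₙ, because the :ℓh: contributions are symmetric in m and n and cancel.

Finally the fibre at q is obtained by evaluating polynomials at q. If some qₙ with n ≥ -1 is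
nonzero, then ℓₙ - qₙ is invertible on the limit and the fibre is zero. -/

@[ext]
theorem field_ext {A B : VertexOperator R V} (h : ∀ n x, mode A n x = mode B n x) : A = B := by
  apply HVertexOperator.coeff_inj
  funext n
  ext x
  have := h (-n - 1) x
  rw [mode, mode, VertexOperator.ncoeff_apply, VertexOperator.ncoeff_apply, neg_sub,
    sub_neg_eq_add, add_sub_cancel_left] at this
  exact this

@[simp]
theorem mode_add (A B : VertexOperator R V) (n : ℤ) : mode (A + B) n = mode A n + mode B n := by
  simp [mode]

@[simp]
theorem mode_sub (A B : VertexOperator R V) (n : ℤ) : mode (A - B) n = mode A n - mode B n := by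
  rw [mode, map_sub]; rfl

@[simp]
theorem mode_smul (r : R) (A : VertexOperator R V) (n : ℤ) : mode (r • A) n = r • mode A n := by
  simp [mode]

@[simp]
theorem mode_idField (n : ℤ) : mode (idField : VertexOperator R V) n = if n = -1 then 1 else 0 := by
  simp [idField]

@[simp]
theorem mode_derivField (A : VertexOperator R V) (n : ℤ) :
    mode (derivField A) n = (-n : ℤ) • mode A (n - 1) := by
  simp [derivField]

theorem mode_nprod_apply (A B : VertexOperator R V) (n k : ℤ) (x : V) :
    mode (nprod A n B) k x = ∑ᶠ j : ℕ, nprodTerm A B n k j x := by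
  simp [nprod]

/-- The summand of a normally ordered product with cutoff `p`. -/
def ordTerm (A B : VertexOperator R V) (p s i : ℤ) : Module.End R V :=
  if i < p then mode A i * mode B (s - i) else mode B (s - i) * mode A i

theorem ordTerm_finite (A B : VertexOperator R V) (p s : ℤ) (x : V) :
    (Function.support fun i => ordTerm A B p s i x).Finite := by
  obtain ⟨NA, hA⟩ := mode_trunc A x
  obtain ⟨NB, hB⟩ := mode_trunc B x
  refine (Set.finite_Icc (min p (s - NB)) (max p NA)).subset fun i hi => ?_
  by_contra hlt
  refine hi ?_
  simp only [Set.mem_Icc, not_and_or, not_le] at hlt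
  simp only [ordTerm]
  split_ifs with h
  · rw [Module.End.mul_apply, hB _ (by omega), map_zero]
  · rw [Module.End.mul_apply, hA _ (by omega), map_zero]

theorem finsum_int_eq {M : Type*} [AddCommGroup M] (f : ℤ → M) (hf : (Function.support f).Finite) :
    ∑ᶠ i, f i = ∑ᶠ j : ℕ, (f (-1 - j) + f j) := by
  have h1 : ∑ᶠ i, f i = ∑ᶠ i ∈ (Set.Ici (0 : ℤ)), f i + ∑ᶠ i ∈ (Set.Iio (0 : ℤ)), f i := by
    rw [← finsum_mem_union' (by rw [Set.disjoint_left]; intro a; simp)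
      (hf.subset Set.inter_subset_right) (hf.subset Set.inter_subset_right)]
    rw [Set.Ici_union_Iio, finsum_mem_univ]
  have e1 : Set.range (fun j : ℕ => (j : ℤ)) = Set.Ici 0 := by
    ext i; simp only [Set.mem_range, Set.mem_Ici]
    exact ⟨fun ⟨j, hj⟩ => by omega, fun h => ⟨i.toNat, by omega⟩⟩
  have e2 : Set.range (fun j : ℕ => (-1 - j : ℤ)) = Set.Iio 0 := by
    ext i; simp only [Set.mem_range, Set.mem_Iio]
    exact ⟨fun ⟨j, hj⟩ => by omega, fun h => ⟨(-1 - i).toNat, by omega⟩⟩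
  rw [h1, ← e1, ← e2, finsum_mem_range (fun a b h => by simpa using h),
    finsum_mem_range (fun a b h => by simpa using h), add_comm]
  rw [← finsum_add_distrib]
  · exact hf.preimage (f := fun j : ℕ => (-1 - j : ℤ)) (fun a _ b _ h => by simpa using h)
  · exact hf.preimage (f := fun j : ℕ => (j : ℤ)) (fun a _ b _ h => by simpa using h)

/-- The j-th term of the (-1)-product combines the indices -1-j and j of A. Indexing by all of ℤ
makes shifts and reflections of the summation index available. -/
theorem mode_normOrd_apply (A B : VertexOperator R V) (k : ℤ) (x : V) :
    mode (normOrd A B) k x = ∑ᶠ i : ℤ, ordTerm A B 0 (k - 1) i x := by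
  rw [finsum_int_eq _ (ordTerm_finite A B 0 (k - 1) x), normOrd, mode_nprod_apply]
  refine finsum_congr fun j => ?_
  -- The binomial coefficient cancels the sign (-1)^j in `nprodTerm`.
  have h : (Ring.choose (-1 : ℤ) j) = (-1) ^ j := by
    have := Ring.choose_neg (1 : ℤ) j
    rw [this]
    rw [show (1 : ℤ) + j - 1 = (j : ℤ) by ring, Ring.choose_natCast, Nat.choose_self]
    rw [Int.negOnePow_def, Units.smul_def]
    simp
  rw [nprodTerm, h, ← mul_pow, ordTerm, ordTerm, if_pos (by omega), if_neg (by omega)]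
  simp [show k - 1 - (-1 - (j : ℤ)) = k + j by ring, show -1 + k - (j : ℤ) = k - 1 - j by ring]

variable {R' V' : Type*} [CommRing R'] [AddCommGroup V'] [Module R' V']

/-- The additive map `φ` commutes with the modes of `A` and `A'`. -/
def Intertwines (φ : V →+ V') (A : VertexOperator R V) (A' : VertexOperator R' V') : Prop :=
  ∀ n x, φ (mode A n x) = mode A' n (φ x)

namespace Intertwines

variable {φ : V →+ V'} {A B : VertexOperator R V} {A' B' : VertexOperator R' V'}

theorem idField (φ : V →+ V') :
    Intertwines φ (idField : VertexOperator R V) (Urod.idField : VertexOperator R' V') := by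
  intro n x
  simp only [mode_idField]
  split_ifs <;> simp

theorem add (hA : Intertwines φ A A') (hB : Intertwines φ B B') :
    Intertwines φ (A + B) (A' + B') := by
  intro n x
  simp [hA n x, hB n x]

/-- Modes of a product are pointwise finite sums of words in modes with integer coefficients, so
additivity of φ suffices. This covers extension of scalars as well as linear maps. -/
theorem nprod (hA : Intertwines φ A A') (n : ℤ) (hB : Intertwines φ B B') :
    Intertwines φ (nprod A n B) (nprod A' n B') := by
  intro k x
  rw [mode_nprod_apply, mode_nprod_apply, φ.map_finsum ((nprodTerm_trunc A B n x).2 k)]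
  refine finsum_congr fun j => ?_
  simp only [nprodTerm, LinearMap.smul_apply, LinearMap.sub_apply, Module.End.mul_apply,
    map_zsmul, map_sub, hA _ _, hB _ _]

theorem normOrd (hA : Intertwines φ A A') (hB : Intertwines φ B B') :
    Intertwines φ (normOrd A B) (normOrd A' B') :=
  hA.nprod _ hB

end Intertwines

end Fields

end Urod

/-! ### Commutators with normally ordered products -/

namespace Urod

/-- Moving the cutoff of a normal ordering from 0 to p reorders the terms in between, each at the
cost of one commutator g i (with opposite sign if p < 0). F is the discrete antiderivative of g, so
all anomalies below reduce to guessing F. -/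
theorem finsum_cutoff {M : Type*} [AddCommGroup M] (g F : ℤ → M) (h0 : F 0 = 0)
    (hs : ∀ p, F (p + 1) = F p + g p) (p : ℤ) :
    (Function.support fun i : ℤ => (if i < p then g i else 0) - (if i < 0 then g i else 0)).Finite ∧
    ∑ᶠ i : ℤ, ((if i < p then g i else 0) - (if i < 0 then g i else 0)) = F p := by
  have hfin : ∀ p : ℤ, (Function.support fun i : ℤ =>
      (if i < p then g i else 0) - (if i < 0 then g i else 0)).Finite := fun p => by
    refine (Set.finite_Icc (min p 0) (max p 0)).subset fun i hi => ?_
    by_contra hlt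
    simp only [Set.mem_Icc, not_and_or, not_le] at hlt
    refine hi ?_
    dsimp only
    split_ifs <;> first | omega | simp
  refine ⟨hfin p, ?_⟩
  have step : ∀ p : ℤ,
      ∑ᶠ i : ℤ, ((if i < p + 1 then g i else 0) - (if i < 0 then g i else 0)) =
        ∑ᶠ i : ℤ, ((if i < p then g i else 0) - (if i < 0 then g i else 0)) + g p := by
    intro p
    have hsing : ∑ᶠ i : ℤ, (if i = p then g i else 0) = g p := by
      rw [finsum_eq_single _ p (fun i hi => if_neg hi), if_pos rfl]
    rw [← hsing, ← finsum_add_distrib (hfin p)]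
    · refine finsum_congr fun i => ?_
      rcases lt_trichotomy i p with h | h | h
      · simp [h, h.ne, show i < p + 1 by omega]
      · subst h; simp; abel
      · simp [h.ne', show ¬ i < p + 1 by omega, show ¬ i < p by omega]
    · exact (Set.finite_singleton p).subset fun i hi => by
        by_contra h; exact hi (if_neg h)
  induction p using Int.induction_on with
  | zero => simp [h0]
  | succ n ih => rw [step, ih, hs]
  | pred n ih =>
    have h1 := step (-n - 1)
    have h2 := hs (-n - 1)
    rw [sub_add_cancel] at h1 h2
    rw [ih, h2] at h1
    exact (add_right_cancel h1).symm

section Ordered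

variable {R V : Type*} [CommRing R] [AddCommGroup V] [Module R V]

theorem lie_apply_end (D E : Module.End R V) (x : V) : ⁅D, E⁆ x = D (E x) - E (D x) := rfl

theorem lie_swap_end (D E : Module.End R V) : ⁅D, E⁆ = -⁅E, D⁆ := by
  simp only [Ring.lie_def, neg_sub]

theorem smul_lie_end (r : R) (D E : Module.End R V) : ⁅r • D, E⁆ = r • ⁅D, E⁆ := by
  simp only [Ring.lie_def, smul_sub, smul_mul_assoc, mul_smul_comm]

theorem lie_smul_end (r : R) (D E : Module.End R V) : ⁅D, r • E⁆ = r • ⁅D, E⁆ := by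
  simp only [Ring.lie_def, smul_sub, smul_mul_assoc, mul_smul_comm]

theorem add_lie_end (D D' E : Module.End R V) : ⁅D + D', E⁆ = ⁅D, E⁆ + ⁅D', E⁆ := by
  simp only [Ring.lie_def, add_mul, mul_add]; abel

theorem lie_add_end (D E E' : Module.End R V) : ⁅D, E + E'⁆ = ⁅D, E⁆ + ⁅D, E'⁆ := by
  simp only [Ring.lie_def, add_mul, mul_add]; abel

theorem sub_lie_end (D D' E : Module.End R V) : ⁅D - D', E⁆ = ⁅D, E⁆ - ⁅D', E⁆ := by
  simp only [Ring.lie_def, sub_mul, mul_sub]; abel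

theorem lie_sub_end (D E E' : Module.End R V) : ⁅D, E - E'⁆ = ⁅D, E⁆ - ⁅D, E'⁆ := by
  simp only [Ring.lie_def, sub_mul, mul_sub]; abel

theorem lie_mul_end (D A B : Module.End R V) : ⁅D, A * B⁆ = ⁅D, A⁆ * B + A * ⁅D, B⁆ := by
  simp only [Ring.lie_def]; noncomm_ring

theorem lie_normOrd_apply (A B : VertexOperator R V) (D : Module.End R V) (k : ℤ) (x : V) :
    (Function.support fun i => ⁅D, ordTerm A B 0 (k - 1) i⁆ x).Finite ∧
    ⁅D, mode (normOrd A B) k⁆ x = ∑ᶠ i : ℤ, ⁅D, ordTerm A B 0 (k - 1) i⁆ x := by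
  have f1 : (Function.support fun i => D (ordTerm A B 0 (k - 1) i x)).Finite :=
    (ordTerm_finite A B 0 (k - 1) x).subset fun i hi h => hi (by simp [h])
  have f2 := ordTerm_finite A B 0 (k - 1) (D x)
  constructor
  · exact (f1.union f2).subset (Function.support_sub _ _)
  · have e := D.toAddMonoidHom.map_finsum (ordTerm_finite A B 0 (k - 1) x)
    simp only [LinearMap.toAddMonoidHom_coe] at e
    rw [lie_apply_end, mode_normOrd_apply, mode_normOrd_apply, e, ← finsum_sub_distrib f1 f2]
    rfl

theorem lie_ordTerm (A B : VertexOperator R V) (D : Module.End R V) (p s i : ℤ) :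
    ⁅D, ordTerm A B p s i⁆ = if i < p then ⁅D, mode A i⁆ * mode B (s - i) + mode A i * ⁅D, mode B (s - i)⁆
      else ⁅D, mode B (s - i)⁆ * mode A i + mode B (s - i) * ⁅D, mode A i⁆ := by
  unfold ordTerm
  split_ifs <;> rw [lie_mul_end]

theorem ordTerm_sub (A B : VertexOperator R V) (p s i : ℤ) :
    ordTerm A B p s i - ordTerm A B 0 s i =
      (if i < p then ⁅mode A i, mode B (s - i)⁆ else 0) -
      (if i < 0 then ⁅mode A i, mode B (s - i)⁆ else 0) := by
  simp only [ordTerm, Ring.lie_def]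
  split_ifs <;> abel

theorem finsum_ite_eq_apply {V : Type*} [AddCommGroup V] (c : V) (j : ℤ) :
    (Function.support fun i : ℤ => if i = j then c else 0).Finite ∧
    ∑ᶠ i : ℤ, (if i = j then c else 0) = c := by
  constructor
  · exact (Set.finite_singleton j).subset fun i hi => by by_contra h; exact hi (if_neg h)
  · rw [finsum_eq_single _ j (fun i hi => if_neg hi), if_pos rfl]

theorem finite_support_smul {ι V : Type*} [AddCommGroup V] [Module R V] {f : ι → V}
    (hf : (Function.support f).Finite) (c : ι → R) : (Function.support fun i => c i • f i).Finite :=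
  hf.subset fun i hi h => hi (by simp [h])

/-- The modes of `h` satisfy the Heisenberg relations `[hₘ, hₙ] = 2 m κ δ`. -/
def IsHeisenberg (h : VertexOperator R V) (κ : R) : Prop :=
  ∀ m n : ℤ, ⁅mode h m, mode h n⁆ = (if m + n = 0 then 2 * (m : R) * κ else 0) • (1 : Module.End R V)

/-- `[hₘ, Bₙ] = μ Bₘ₊ₙ`. -/
def HasCharge (h B : VertexOperator R V) (μ : R) : Prop :=
  ∀ m n : ℤ, ⁅mode h m, mode B n⁆ = μ • mode B (n + m)

variable {h B : VertexOperator R V} {κ μ : R}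

/-- Apply the derivation rule termwise: the charge of B shifts the mode, and the two central
contractions each occur for a single index, i = -m and i = k+m-1. Taking ν = 0 treats charged fields
and μ = 0 treats B = h. -/
theorem lie_heis_normOrd {ν : R} (hh : IsHeisenberg h κ)
    (hB : ∀ m n : ℤ, ⁅mode h m, mode B n⁆ = μ • mode B (n + m) +
      (if m + n = 0 then 2 * (m : R) * ν else 0) • (1 : Module.End R V)) (m k : ℤ) :
    ⁅mode h m, mode (normOrd h B) k⁆ = (2 * (m : R) * κ) • mode B (k + m - 1)
      + μ • mode (normOrd h B) (k + m) + (2 * (m : R) * ν) • mode h (k + m - 1) := by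
  ext x
  have key : ∀ i, ⁅mode h m, ordTerm h B 0 (k - 1) i⁆ x =
      (if i = -m then (2 * (m : R) * κ) • mode B (k + m - 1) x else 0) +
      μ • ordTerm h B 0 (k + m - 1) i x +
      (if i = k + m - 1 then (2 * (m : R) * ν) • mode h (k + m - 1) x else 0) := by
    intro i
    rw [lie_ordTerm, hh, hB, show k - 1 - i + m = k + m - 1 - i by ring]
    have e1 : (m + i = 0) ↔ (i = -m) := by omega
    have e2 : (m + (k - 1 - i) = 0) ↔ (i = k + m - 1) := by omega
    simp only [e1, e2, ordTerm]
    by_cases h1 : i = -m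
    · have e3 : k - 1 - i = k + m - 1 := by omega
      rw [if_pos h1, if_pos h1, e3]
      by_cases h2 : i = k + m - 1
      · rw [if_pos h2, if_pos h2, ← h2]
        split_ifs <;> simp <;> abel
      · rw [if_neg h2, if_neg h2]
        split_ifs <;> simp; abel
    · rw [if_neg h1, if_neg h1]
      by_cases h2 : i = k + m - 1
      · rw [if_pos h2, if_pos h2, ← h2]
        split_ifs <;> simp
      · rw [if_neg h2, if_neg h2]
        split_ifs <;> simp
  rw [(lie_normOrd_apply h B _ k x).2, finsum_congr key]
  have f1 := finsum_ite_eq_apply ((2 * (m : R) * κ) • mode B (k + m - 1) x) (-m)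
  have f2 := ordTerm_finite h B 0 (k + m - 1) x
  have f3 := finsum_ite_eq_apply ((2 * (m : R) * ν) • mode h (k + m - 1) x) (k + m - 1)
  have f2' := finite_support_smul f2 fun _ => μ
  rw [finsum_add_distrib ((f1.1.union f2').subset (Function.support_add _ _)) f3.1,
    finsum_add_distrib f1.1 f2', f1.2, f3.2, ← smul_finsum' _ f2]
  simp [mode_normOrd_apply]

theorem lie_heis_normOrd_charge (hh : IsHeisenberg h κ) (hB : HasCharge h B μ) (m k : ℤ) :
    ⁅mode h m, mode (normOrd h B) k⁆ = (2 * (m : R) * κ) • mode B (k + m - 1)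
      + μ • mode (normOrd h B) (k + m) := by
  have := lie_heis_normOrd (ν := 0) hh (μ := μ) (B := B) (fun m n => by simp [hB m n]) m k
  simpa using this

theorem lie_heis_normOrd_self (hh : IsHeisenberg h κ) (m k : ℤ) :
    ⁅mode h m, mode (normOrd h h) k⁆ = (4 * (m : R) * κ) • mode h (k + m - 1) := by
  have := lie_heis_normOrd (ν := κ) hh (μ := 0) (B := h) (fun m n => by simp [hh m n]) m k
  rw [this, zero_smul, add_zero, ← add_smul]
  ring_nf

theorem ordTerm_cutoff_charge (hB : HasCharge h B μ) (p s : ℤ) (x : V) :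
    ∑ᶠ i : ℤ, ordTerm h B p s i x = ∑ᶠ i : ℤ, ordTerm h B 0 s i x + (p : R) • μ • mode B s x := by
  rw [← sub_eq_iff_eq_add', ← finsum_sub_distrib (ordTerm_finite _ _ _ _ _)
    (ordTerm_finite _ _ _ _ _)]
  have := finsum_cutoff (fun _ => μ • mode B s x) (fun p => (p : R) • μ • mode B s x) (by simp)
    (fun p => by push_cast; rw [add_smul, one_smul]) p
  rw [← this.2]
  refine finsum_congr fun i => ?_
  rw [← LinearMap.sub_apply, ordTerm_sub, hB, sub_add_cancel]
  split_ifs <;> simp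

/-- Both factors of :hh: can be contracted with B. One contraction gives :hB: with the usual cutoff;
the other, after the reflection i ↦ k-1-i, gives it with cutoff k. Moving that cutoff back to 0
produces the correction kμ. -/
theorem lie_sugawara_charge (hB : HasCharge h B μ) (k n : ℤ) :
    ⁅mode (normOrd h h) k, mode B n⁆ =
      μ • ((2 : R) • mode (normOrd h B) (n + k) + ((k : R) * μ) • mode B (n + k - 1)) := by
  ext x
  have hB' : ∀ i j, ⁅mode B i, mode h j⁆ = -(μ • mode B (i + j)) := fun i j => by
    rw [lie_swap_end, hB]
  rw [lie_swap_end, LinearMap.neg_apply, (lie_normOrd_apply h h _ k x).2]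
  have key : ∀ i, ⁅mode B n, ordTerm h h 0 (k - 1) i⁆ x =
      (-μ) • ordTerm h B 0 (n + k - 1) i x + (-μ) • ordTerm h B k (n + k - 1) (k - 1 - i) x := by
    intro i
    rw [lie_ordTerm, hB', hB']
    simp only [ordTerm]
    rw [show n + k - 1 - (k - 1 - i) = n + i by ring, show n + (k - 1 - i) = n + k - 1 - i by ring]
    have e1 : (k - 1 - i < k) ↔ ¬ (i < 0) := by omega
    simp only [e1]
    by_cases hi : i < 0
    · simp [hi]; abel
    · simp [hi]
  have f1 := ordTerm_finite h B 0 (n + k - 1) x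
  have f2 : (Function.support fun i => ordTerm h B k (n + k - 1) (k - 1 - i) x).Finite :=
    (ordTerm_finite h B k (n + k - 1) x).preimage (f := fun i : ℤ => k - 1 - i)
      (fun a _ b _ hab => by simpa using hab)
  have e2 : ∑ᶠ i, ordTerm h B k (n + k - 1) (k - 1 - i) x = ∑ᶠ i, ordTerm h B k (n + k - 1) i x :=
    finsum_comp_equiv (Equiv.subLeft (k - 1)) (f := fun i => ordTerm h B k (n + k - 1) i x)
  have f1' := finite_support_smul f1 fun _ => -μ
  have f2' := finite_support_smul f2 fun _ => -μ
  rw [finsum_congr key, finsum_add_distrib f1' f2', ← smul_finsum' _ f1,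
    ← smul_finsum' _ f2, e2, ordTerm_cutoff_charge hB k, ← mode_normOrd_apply]
  simp only [LinearMap.smul_apply, LinearMap.add_apply]
  module

end Ordered

/-! ### The Virasoro algebra of a Heisenberg field -/

section Sugawara

variable {R V : Type*} [Field R] [CharZero R] [AddCommGroup V] [Module R V]
  {h : VertexOperator R V} {κ μ : R}

/-- The Sugawara operators of a Heisenberg field. -/
def sugawara (h : VertexOperator R V) (n : ℤ) : Module.End R V :=
  (1 / 4 : R) • mode (normOrd h h) (n + 1)

theorem lie_sugawara_heis (hh : IsHeisenberg h κ) (m n : ℤ) :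
    ⁅sugawara h m, mode h n⁆ = (-(n : R) * κ) • mode h (m + n) := by
  rw [sugawara, smul_lie_end, lie_swap_end, lie_heis_normOrd_self hh,
    show m + 1 + n - 1 = m + n by ring, ← neg_smul, smul_smul]
  congr 1
  ring

/-- The bracket of L_m with :hh: splits into two normally ordered sums, one of them with cutoff m
after a shift of the index. Its reordering produces the central term. The scale κ is kept general so
that the same computation serves the rescaled boson with κ = b⁻². -/
theorem lie_sugawara_sugawara (hh : IsHeisenberg h κ) (m n : ℤ) :
    ⁅sugawara h m, sugawara h n⁆ = (((m : R) - n) * κ) • sugawara h (m + n) +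
      (if m + n = 0 then κ ^ 2 * ((m : R) ^ 3 - m) / 12 else 0) • (1 : Module.End R V) := by
  ext x
  have key : ∀ i, ⁅sugawara h m, ordTerm h h 0 (n + 1 - 1) i⁆ x =
      -κ • (((i : R) • ordTerm h h m (m + n) (i + m) x) +
        ((n : R) - i) • ordTerm h h 0 (m + n) i x) := by
    intro i
    rw [lie_ordTerm, lie_sugawara_heis hh, lie_sugawara_heis hh]
    simp only [ordTerm]
    have e1 : i + m < m ↔ i < 0 := by omega
    rw [show m + n - (i + m) = n - i by ring, show m + (n + 1 - 1 - i) = m + n - i by ring,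
      show n + 1 - 1 - i = n - i by ring, add_comm m i]
    simp only [e1]
    by_cases hi : i < 0
    · simp only [hi, if_true]
      simp only [LinearMap.smul_apply, LinearMap.add_apply, smul_mul_assoc, mul_smul_comm,
        smul_add, smul_smul]
      push_cast
      congr 2 <;> ring
    · simp only [hi, if_false]
      simp only [LinearMap.smul_apply, LinearMap.add_apply, smul_mul_assoc, mul_smul_comm,
        smul_add, smul_smul]
      push_cast
      rw [add_comm]
      congr 2 <;> ring
  have f1 : (Function.support fun i : ℤ => ((i : R) - m) • ordTerm h h m (m + n) i x).Finite :=
    finite_support_smul (ordTerm_finite h h m (m + n) x) _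
  have f1s : (Function.support fun i : ℤ => (i : R) • ordTerm h h m (m + n) (i + m) x).Finite :=
    finite_support_smul ((ordTerm_finite h h m (m + n) x).preimage (f := fun i : ℤ => i + m)
      (fun a _ b _ hab => by simpa using hab)) _
  have f0 := ordTerm_finite h h 0 (m + n) x
  have f2 : (Function.support fun i : ℤ => ((n : R) - i) • ordTerm h h 0 (m + n) i x).Finite :=
    finite_support_smul f0 _
  have e2 : ∑ᶠ i : ℤ, (i : R) • ordTerm h h m (m + n) (i + m) x =
      ∑ᶠ i : ℤ, ((i : R) - m) • ordTerm h h m (m + n) i x := by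
    rw [← finsum_comp_equiv (Equiv.addRight m)
      (f := fun i : ℤ => ((i : R) - m) • ordTerm h h m (m + n) i x)]
    refine finsum_congr fun i => ?_
    simp
  -- This is the antiderivative of (i-m)·2iκ. At p = m it equals -κ(m³-m)/3, which the prefactors -κ
  -- and 1/4 turn into κ²(m³-m)/12.
  have hcut := finsum_cutoff
    (fun i : ℤ => (((i : R) - m) * (if m + n = 0 then 2 * (i : R) * κ else 0)) • x)
    (fun p : ℤ => (if m + n = 0 then
      ((p : R) * (p - 1) * (2 * p - 1) / 3 - m * (p * (p - 1))) * κ else 0) • x)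
    (by simp) (fun p => by
      rw [← add_smul]
      congr 1
      split_ifs
      · push_cast
        ring
      · simp) m
  have key2 : ∀ i : ℤ, ((i : R) - m) • ordTerm h h m (m + n) i x +
      ((n : R) - i) • ordTerm h h 0 (m + n) i x =
      ((n : R) - m) • ordTerm h h 0 (m + n) i x +
      ((if i < m then (((i : R) - m) * (if m + n = 0 then 2 * (i : R) * κ else 0)) • x else 0) -
        (if i < 0 then (((i : R) - m) * (if m + n = 0 then 2 * (i : R) * κ else 0)) • x else 0)) := by
    intro i
    have := congrArg (fun T => ((i : R) - m) • T x) (ordTerm_sub h h m (m + n) i)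
    simp only [hh _ _, add_sub_cancel, LinearMap.sub_apply, smul_sub] at this
    have e : ((if i < m then (((i : R) - m) * (if m + n = 0 then 2 * (i : R) * κ else 0)) • x else 0) -
        (if i < 0 then (((i : R) - m) * (if m + n = 0 then 2 * (i : R) * κ else 0)) • x else 0)) =
        ((i : R) - m) • ordTerm h h m (m + n) i x - ((i : R) - m) • ordTerm h h 0 (m + n) i x := by
      rw [this]
      split_ifs <;> simp [mul_smul]
    rw [e]
    module
  have hs : ⁅sugawara h m, sugawara h n⁆ x =
      (1 / 4 : R) • ∑ᶠ i, ⁅sugawara h m, ordTerm h h 0 (n + 1 - 1) i⁆ x := by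
    conv_lhs => rw [sugawara.eq_def h n, lie_smul_end, LinearMap.smul_apply]
    rw [(lie_normOrd_apply h h _ _ x).2]
  have f0' : (Function.support fun i : ℤ => ((n : R) - m) • ordTerm h h 0 (m + n) i x).Finite :=
    finite_support_smul f0 _
  rw [hs, finsum_congr key, ← smul_finsum' _ ((f1s.union f2).subset (Function.support_add _ _)),
    finsum_add_distrib f1s f2, e2, ← finsum_add_distrib f1 f2, finsum_congr key2,
    finsum_add_distrib f0' hcut.1, hcut.2, ← smul_finsum' _ f0]
  simp only [sugawara, LinearMap.add_apply, LinearMap.smul_apply, mode_normOrd_apply,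
    Module.End.one_apply, add_sub_cancel_right]
  split_ifs
  · module
  · module

end Sugawara

end Urod

namespace Urod

/-! ### Derivations of truncated exponential series -/

section PowerSeriesExp

variable {F A : Type*} [Field F] [CharZero F] [CommRing A] [Algebra F A]

/-- A derivation applied to the coefficients of power series. -/
def coeffDerivation (D : Derivation F A A) : Derivation F (PowerSeries A) (PowerSeries A) :=
  Derivation.mk'
    { toFun := fun f => PowerSeries.mk fun n => D (PowerSeries.coeff n f)
      map_add' := fun f g => by ext n; simp
      map_smul' := fun r f => by ext n; simp }
    (fun f g => by
      ext n
      simp only [LinearMap.coe_mk, AddHom.coe_mk, PowerSeries.coeff_mk, map_add, smul_eq_mul,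
        PowerSeries.coeff_mul, map_sum, Derivation.leibniz, Finset.sum_add_distrib]
      congr 1
      exact (Finset.Nat.sum_antidiagonal_swap (n := n)
        (f := fun p => PowerSeries.coeff p.1 g * D (PowerSeries.coeff p.2 f))))

@[simp]
theorem coeff_coeffDerivation (D : Derivation F A A) (f : PowerSeries A) (n : ℕ) :
    PowerSeries.coeff n (coeffDerivation D f) = D (PowerSeries.coeff n f) := by
  change PowerSeries.coeff n (PowerSeries.mk fun n => D (PowerSeries.coeff n f)) = _
  simp

/-- The truncated exponential series of `u`. -/
def expSum (F : Type*) [Field F] [Algebra F A] (u : PowerSeries A) (N : ℕ) : PowerSeries A :=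
  ∑ j ∈ Finset.range N, ((j.factorial : F)⁻¹) • u ^ j

/-- The chain rule for exp, with the loss of one term recorded so that no convergence is needed. It
is used for ∂/∂h₋ⱼ₋₁ acting on coefficients and for d/dz. -/
theorem derivation_expSum (δ : Derivation F (PowerSeries A) (PowerSeries A)) (u : PowerSeries A)
    (N : ℕ) : δ (expSum F u (N + 1)) = expSum F u N * δ u := by
  rw [expSum, map_sum, Finset.sum_range_succ', expSum, Finset.sum_mul]
  simp only [Derivation.map_smul, pow_zero, Derivation.map_one_eq_zero, smul_zero, add_zero,
    Derivation.leibniz_pow, Nat.add_sub_cancel]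
  refine Finset.sum_congr rfl fun j _ => ?_
  rw [← Nat.cast_smul_eq_nsmul F, smul_smul, smul_eq_mul, smul_mul_assoc, Nat.factorial_succ]
  congr 1
  have : (j.factorial : F) ≠ 0 := Nat.cast_ne_zero.2 (Nat.factorial_ne_zero j)
  have : ((j : F) + 1) ≠ 0 := by exact_mod_cast Nat.succ_ne_zero j
  push_cast
  field_simp

end PowerSeriesExp

/-! ### Vertex operators e^{m√2φ} and their Heisenberg charge -/

section Lattice

open MvPolynomial

variable (F : Type*) [Field F] [CharZero F]

/-- The coefficients of the creation part of `e^{m√2φ}(z)`. -/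
def creationCoeff (m : ℤ) (k : ℤ) : MvPolynomial ℕ F :=
  if k < 0 then 0 else PowerSeries.coeff k.toNat (creationExp F m)

variable {F}

/-- The exponent has no constant term, so its j-th power starts in degree j and any truncation
beyond k gives the same coefficient. -/
theorem coeff_creationExp_eq (m : ℤ) {k N : ℕ} (h : k < N) :
    PowerSeries.coeff k (creationExp F m) =
      PowerSeries.coeff k (expSum F (creationExponent F m) N) := by
  have hz : PowerSeries.constantCoeff (creationExponent F m) = 0 := by
    rw [← PowerSeries.coeff_zero_eq_constantCoeff_apply]
    simp [creationExponent]
  rw [creationExp, PowerSeries.coeff_mk, expSum, map_sum]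
  rw [← Finset.sum_subset (Finset.range_subset_range.2 (Nat.succ_le_of_lt h))]
  · refine Finset.sum_congr rfl fun j _ => ?_
    rw [PowerSeries.coeff_smul, MvPolynomial.smul_eq_C_mul]
  · intro j _ hj
    rw [Finset.mem_range, not_lt] at hj
    rw [PowerSeries.coeff_smul, PowerSeries.coeff_of_lt_order, smul_zero]
    exact lt_of_lt_of_le (by exact_mod_cast Nat.lt_of_succ_le hj)
      (PowerSeries.le_order_pow_of_constantCoeff_eq_zero j hz)

theorem creationCoeff_zero (m : ℤ) : creationCoeff F m 0 = 1 := by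
  simp [creationCoeff, creationExp]

theorem creationCoeff_neg (m : ℤ) {k : ℤ} (hk : k < 0) : creationCoeff F m k = 0 := by
  simp [creationCoeff, hk]

/-- Only the term of degree j+1 in the exponent involves the variable `X j`, so its derivative is a
monomial in z; the exponential is multiplied by it. -/
theorem pderiv_creationCoeff (m : ℤ) (j : ℕ) (k : ℤ) :
    pderiv j (creationCoeff F m k) = C ((m : F) / (j + 1)) * creationCoeff F m (k - j - 1) := by
  by_cases hk : k < 0
  · rw [creationCoeff_neg m hk, creationCoeff_neg m (by omega), map_zero, mul_zero]
  lift k to ℕ using by omega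
  have hδ : coeffDerivation (pderiv (R := F) j) (creationExponent F m) =
      PowerSeries.monomial (j + 1) (C ((m : F) / (j + 1))) := by
    ext1 n
    rw [coeff_coeffDerivation, creationExponent, PowerSeries.coeff_mk, PowerSeries.coeff_monomial]
    by_cases h0 : n = 0
    · rw [if_pos h0, if_neg (by omega), map_zero]
    rw [if_neg h0, pderiv_C_mul]
    by_cases h1 : n = j + 1
    · subst h1
      simp
    · rw [if_neg h1, pderiv_X_of_ne (by omega), mul_zero]
  have h := congrArg (PowerSeries.coeff k)
    (derivation_expSum (coeffDerivation (pderiv (R := F) j)) (creationExponent F m) (k + 1))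
  rw [coeff_coeffDerivation, ← coeff_creationExp_eq m (by omega), hδ] at h
  simp only [creationCoeff, hk, if_false, Int.toNat_natCast]
  rw [h]
  by_cases hjk : j + 1 ≤ k
  · obtain ⟨l, rfl⟩ := Nat.exists_eq_add_of_le' hjk
    rw [show (PowerSeries.monomial (j + 1)) (C ((m : F) / (j + 1))) =
        (C ((m : F) / (j + 1)) : MvPolynomial ℕ F) • PowerSeries.X ^ (j + 1) by
      rw [PowerSeries.X_pow_eq, ← map_smul, smul_eq_mul, mul_one], mul_smul_comm, PowerSeries.coeff_smul, PowerSeries.coeff_mul_X_pow,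
      ← coeff_creationExp_eq m (by omega), if_neg (by omega), smul_eq_mul]
    congr 3
    omega
  · rw [if_pos (by omega), mul_zero, PowerSeries.coeff_mul, Finset.sum_eq_zero]
    intro p hp
    have := Finset.HasAntidiagonal.mem_antidiagonal.1 hp
    rw [PowerSeries.coeff_monomial, if_neg (by omega), mul_zero]

/-- Comparing coefficients in d/dz exp u = (exp u)u'. This is the lattice identity m:h e^{m√2φ}: =
∂e^{m√2φ} on the vacuum. -/
theorem creationCoeff_rec (m : ℤ) (k : ℕ) :
    C (k : F) * creationCoeff F m k =
      C (m : F) * ∑ l ∈ Finset.range k, X l * creationCoeff F m (k - 1 - l) := by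
  cases k with
  | zero => simp
  | succ k =>
    have h := congrArg (PowerSeries.coeff k)
      (derivation_expSum ((PowerSeries.derivative (MvPolynomial ℕ F)).restrictScalars F)
        (creationExponent F m) (k + 1))
    simp only [Derivation.restrictScalars_apply] at h
    rw [PowerSeries.coeff_derivative, ← coeff_creationExp_eq m (by omega), PowerSeries.coeff_mul,
      Finset.Nat.sum_antidiagonal_eq_sum_range_succ_mk, ← Finset.sum_range_reflect] at h
    simp only [creationCoeff]
    rw [if_neg (by omega), Int.toNat_natCast, mul_comm]
    rw [show (C ((k + 1 : ℕ) : F) : MvPolynomial ℕ F) = (k : MvPolynomial ℕ F) + 1 by simp, h,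
      Finset.mul_sum]
    refine Finset.sum_congr rfl fun l hl => ?_
    have hl' := Finset.mem_range.1 hl
    rw [if_neg (by omega), ← coeff_creationExp_eq m (by omega), PowerSeries.coeff_derivative,
      creationExponent, PowerSeries.coeff_mk, if_neg (by omega)]
    have e1 : (((k + 1 : ℕ) : ℤ) - 1 - l).toNat = k + 1 - 1 - l := by omega
    have e2 : k - (k + 1 - 1 - l) + 1 = l + 1 := by omega
    have e3 : k - (k + 1 - 1 - l) = l := by omega
    rw [e1, e2, e3, Nat.add_sub_cancel]
    have e4 : (C ((m : F) / ((l + 1 : ℕ) : F)) : MvPolynomial ℕ F) * ((l : MvPolynomial ℕ F) + 1) = C (m : F) := by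
      rw [show (l : MvPolynomial ℕ F) + 1 = C ((l + 1 : ℕ) : F) by simp, ← C_mul,
        div_mul_cancel₀ _ (Nat.cast_ne_zero.2 (Nat.succ_ne_zero l))]
    linear_combination (PowerSeries.coeff (k + 1 - 1 - l)) (creationExp F m) * X l * e4

variable (F)

/-- The coefficient of `z^p` in `exp (∑ m h₋ₙ zⁿ/n) exp (-∑ m hₙ z⁻ⁿ/n) P`. -/
def expCoeff (m : ℤ) (p : ℤ) (P : MvPolynomial ℕ F) : MvPolynomial ℕ F :=
  (HahnSeries.ofPowerSeries ℤ _ (creationExp F m) * annihilationExp F m P).coeff p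

variable {F}

theorem mode_expField_single (m n m' : ℤ) (P : MvPolynomial ℕ F) :
    mode (expField F m) n (Finsupp.single m' P) =
      Finsupp.single (m + m') (expCoeff F m (-n - 1 - 2 * m * m') P) := by
  rw [mode, VertexOperator.ncoeff_apply, HVertexOperator.coeff_apply_apply, expField, Finsupp.lsum_single]
  change Finsupp.single (m + m') ((HahnSeries.single (2 * m * m') (1 : MvPolynomial ℕ F) *
    (HahnSeries.ofPowerSeries ℤ _ (creationExp F m) * annihilationExp F m P)).coeff (-n - 1)) = _
  rw [show -n - 1 = (-n - 1 - 2 * m * m') + 2 * m * m' by ring, HahnSeries.coeff_single_mul_add,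
    one_mul]
  simp [expCoeff]

theorem expCoeff_one (m p : ℤ) : expCoeff F m p 1 = creationCoeff F m p := by
  rw [expCoeff, map_one, mul_one, creationCoeff]
  split_ifs with h
  · rw [PowerSeries.coeff_coe, if_pos h]
  · rw [PowerSeries.coeff_coe, if_neg h]
    congr 2
    omega

theorem expCoeff_add (m p : ℤ) (P Q : MvPolynomial ℕ F) :
    expCoeff F m p (P + Q) = expCoeff F m p P + expCoeff F m p Q := by
  simp [expCoeff, mul_add]

theorem expCoeff_C_mul (m p : ℤ) (a : F) (P : MvPolynomial ℕ F) :
    expCoeff F m p (C a * P) = C a * expCoeff F m p P := by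
  rw [expCoeff, map_mul, mul_left_comm]
  rw [show annihilationExp F m (C a) = HahnSeries.C (C a) by simp [annihilationExp],
    HahnSeries.C_mul_eq_smul, HahnSeries.coeff_smul, smul_eq_mul, expCoeff]

/-- The annihilation part substitutes h₋ₙ ↦ h₋ₙ - 2mz⁻ⁿ. This is the commutator with creation modes,
and `pderiv_expCoeff` is the one with annihilation modes. -/
theorem expCoeff_X_mul (m p : ℤ) (j : ℕ) (P : MvPolynomial ℕ F) :
    expCoeff F m p (X j * P) =
      X j * expCoeff F m p P - C (2 * m : F) * expCoeff F m (p + j + 1) P := by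
  rw [expCoeff, map_mul, mul_left_comm]
  rw [show annihilationExp F m (X j) = HahnSeries.C (X j) - HahnSeries.single (-((j : ℤ) + 1))
    (C ((2 * m : ℤ) : F)) by simp [annihilationExp], sub_mul, HahnSeries.coeff_sub,
    HahnSeries.C_mul_eq_smul, HahnSeries.coeff_smul, smul_eq_mul]
  congr 1
  conv_lhs => rw [show p = (p + j + 1) + -((j : ℤ) + 1) by ring]
  rw [HahnSeries.coeff_single_mul_add, expCoeff]
  push_cast
  rfl

theorem pderiv_expCoeff (m p : ℤ) (j : ℕ) (P : MvPolynomial ℕ F) :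
    pderiv j (expCoeff F m p P) = expCoeff F m p (pderiv j P) +
      C ((m : F) / (j + 1)) * expCoeff F m (p - j - 1) P := by
  induction P using MvPolynomial.induction_on generalizing p with
  | C a =>
    rw [pderiv_C, ← mul_one (C a), expCoeff_C_mul, expCoeff_C_mul, expCoeff_one, expCoeff_one,
      pderiv_C_mul, pderiv_creationCoeff]
    have : expCoeff F m p 0 = 0 := by simp [expCoeff]
    rw [this]
    ring
  | add P Q hP hQ =>
    rw [expCoeff_add, map_add, hP, hQ, map_add, expCoeff_add, expCoeff_add]
    ring
  | mul_X P k hP =>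
    rw [mul_comm P, expCoeff_X_mul, map_sub, pderiv_mul, pderiv_C_mul, hP, hP, pderiv_mul,
      expCoeff_add, expCoeff_X_mul, expCoeff_X_mul]
    rw [show p + k + 1 - (j : ℤ) - 1 = p - j - 1 + k + 1 by ring]
    by_cases hjk : k = j
    · subst hjk
      rw [pderiv_X_self, one_mul, one_mul]
      ring
    · rw [pderiv_X_of_ne hjk, zero_mul, zero_mul]
      have : expCoeff F m p 0 = 0 := by simp [expCoeff]
      rw [this]
      ring

@[simp]
theorem mode_heisField (n : ℤ) : mode (heisField F) n = heisMode F n := by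
  simp [heisField]

theorem heisMode_neg_single (j : ℕ) (m : ℤ) (P : MvPolynomial ℕ F) :
    heisMode F (-j - 1) (Finsupp.single m P) = Finsupp.single m (X j * P) := by
  rw [heisMode_single, if_pos (by omega)]
  simp

theorem heisMode_zero_single (m : ℤ) (P : MvPolynomial ℕ F) :
    heisMode F 0 (Finsupp.single m P) = (2 * m : F) • Finsupp.single m P := by
  rw [heisMode_single, if_neg (by omega), if_pos rfl]
  simp

theorem heisMode_pos_single (j : ℕ) (m : ℤ) (P : MvPolynomial ℕ F) :
    heisMode F (j + 1) (Finsupp.single m P) =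
      Finsupp.single m (C (2 * (j + 1) : F) * pderiv j P) := by
  rw [heisMode_single, if_neg (by omega), if_neg (by omega), ← smul_eq_C_mul]
  simp

theorem int_trichotomy (i : ℤ) : (∃ j : ℕ, i = -j - 1) ∨ i = 0 ∨ ∃ j : ℕ, i = j + 1 := by
  rcases lt_trichotomy i 0 with h | h | h
  · exact Or.inl ⟨(-i - 1).toNat, by omega⟩
  · exact Or.inr (Or.inl h)
  · exact Or.inr (Or.inr ⟨(i - 1).toNat, by omega⟩)

theorem lat_end_ext {D E : Module.End F (LatVOA F)}
    (h : ∀ m P, D (Finsupp.single m P) = E (Finsupp.single m P)) : D = E := by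
  refine Finsupp.lhom_ext fun m P => h m P

theorem isHeisenberg_heisField : IsHeisenberg (heisField F) 1 := by
  intro i k
  refine lat_end_ext fun m P => ?_
  rw [mode_heisField, mode_heisField, lie_apply_end]
  rcases int_trichotomy i with ⟨a, rfl⟩ | rfl | ⟨a, rfl⟩ <;>
    rcases int_trichotomy k with ⟨c, rfl⟩ | rfl | ⟨c, rfl⟩
  · rw [if_neg (by omega)]
    simp only [heisMode_neg_single, mul_left_comm (X a)]
    simp
  · rw [if_neg (by omega)]
    simp only [heisMode_neg_single, heisMode_zero_single, map_smul, sub_self, zero_smul]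
    rfl
  · simp only [heisMode_neg_single, heisMode_pos_single, pderiv_mul]
    by_cases h : a = c
    · subst h
      rw [pderiv_X_self, if_pos (by ring), LinearMap.smul_apply, Module.End.one_apply,
        ← Finsupp.single_sub, Finsupp.smul_single, smul_eq_C_mul]
      congr 1
      push_cast
      simp only [map_mul, map_add, map_sub, map_neg, map_ofNat, map_one]
      ring
    · rw [pderiv_X_of_ne h, if_neg (by omega), zero_mul, zero_add, ← Finsupp.single_sub]
      simp [mul_left_comm]
  · rw [if_neg (by omega)]
    simp only [heisMode_neg_single, heisMode_zero_single, map_smul, sub_self, zero_smul]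
    rfl
  · simp
  · rw [if_neg (by omega)]
    simp only [heisMode_pos_single, heisMode_zero_single, map_smul, sub_self, zero_smul]
    rfl
  · simp only [heisMode_neg_single, heisMode_pos_single, pderiv_mul]
    by_cases h : a = c
    · subst h
      rw [pderiv_X_self, if_pos (by ring), LinearMap.smul_apply, Module.End.one_apply,
        ← Finsupp.single_sub, Finsupp.smul_single, smul_eq_C_mul]
      congr 1
      push_cast
      simp only [map_mul, map_add, map_ofNat, map_one]
      ring
    · rw [pderiv_X_of_ne (Ne.symm h), if_neg (by omega), zero_mul, zero_add, ← Finsupp.single_sub]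
      simp [mul_left_comm]
  · rw [if_neg (by omega)]
    simp only [heisMode_pos_single, heisMode_zero_single, map_smul, sub_self, zero_smul]
    rfl
  · rw [if_neg (by omega)]
    have hcomm : pderiv a (pderiv c P) = pderiv c (pderiv a P) := by
      have : ⁅(pderiv a : Derivation F (MvPolynomial ℕ F) (MvPolynomial ℕ F)),
          (pderiv c : Derivation F (MvPolynomial ℕ F) (MvPolynomial ℕ F))⁆ = 0 := by
        refine MvPolynomial.derivation_ext (R := F) (σ := ℕ) fun l => ?_
        rw [Derivation.commutator_apply]
        classical
        simp only [pderiv_X, Pi.single_apply]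
        split_ifs <;> simp
      have h2 := congrArg (fun d => d P) this
      simpa [Derivation.commutator_apply, sub_eq_zero] using h2
    simp only [heisMode_pos_single, pderiv_C_mul, hcomm]
    simp [mul_left_comm]

theorem hasCharge_expField (m : ℤ) : HasCharge (heisField F) (expField F m) (2 * m : F) := by
  intro i n
  refine lat_end_ext fun m' P => ?_
  rw [mode_heisField, lie_apply_end, LinearMap.smul_apply, mode_expField_single, mode_expField_single,
    Finsupp.smul_single, smul_eq_C_mul]
  rcases int_trichotomy i with ⟨j, rfl⟩ | rfl | ⟨j, rfl⟩
  · rw [heisMode_neg_single, heisMode_neg_single, mode_expField_single, expCoeff_X_mul,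
      ← Finsupp.single_sub]
    rw [sub_sub_cancel, show -n - 1 - 2 * m * m' + j + 1 = -(n + (-j - 1)) - 1 - 2 * m * m' by ring]
  · rw [heisMode_zero_single, heisMode_zero_single, map_smul, mode_expField_single, ← sub_smul,
      Finsupp.smul_single, smul_eq_C_mul, add_zero]
    congr 3
    push_cast
    ring
  · rw [heisMode_pos_single, heisMode_pos_single, mode_expField_single, pderiv_expCoeff,
      expCoeff_C_mul, ← Finsupp.single_sub, mul_add, add_sub_cancel_left, ← mul_assoc, ← C_mul,
      show -n - 1 - 2 * m * m' - j - 1 = -(n + (j + 1)) - 1 - 2 * m * m' by ring]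
    congr 3
    have : ((j : F) + 1) ≠ 0 := by exact_mod_cast Nat.succ_ne_zero j
    field_simp

end Lattice

end Urod

namespace Urod

/-! ### The derivative relation, conformal weights and the spectrum of L₀ -/

section Lattice

open MvPolynomial

variable {F : Type*} [Field F] [CharZero F]

theorem lat_submodule_eq_top (N : Submodule F (LatVOA F)) (h0 : ∀ m, Finsupp.single m 1 ∈ N)
    (hs : ∀ (j : ℕ), ∀ x ∈ N, heisMode F (-j - 1) x ∈ N) : N = ⊤ := by
  refine eq_top_iff.2 fun x _ => ?_
  induction x using Finsupp.induction_linear with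
  | zero => exact N.zero_mem
  | add x y hx hy => exact N.add_mem (hx trivial) (hy trivial)
  | single m P =>
    induction P using MvPolynomial.induction_on with
    | C a =>
      have := N.smul_mem a (h0 m)
      rwa [Finsupp.smul_single, smul_eq_C_mul, mul_one] at this
    | add P Q hP hQ =>
      rw [Finsupp.single_add]
      exact N.add_mem (hP trivial) (hQ trivial)
    | mul_X P k hP =>
      have := hs k _ (hP trivial)
      rwa [heisMode_neg_single, mul_comm] at this

theorem heisMode_vac_pos {i : ℤ} (hi : 0 < i) (m : ℤ) :
    heisMode F i (Finsupp.single m 1) = 0 := by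
  obtain ⟨j, rfl⟩ : ∃ j : ℕ, i = j + 1 := ⟨(i - 1).toNat, by omega⟩
  rw [heisMode_pos_single, pderiv_one, mul_zero, Finsupp.single_zero]

/-- The common kernel of S is stable under creation modes, since moving such a mode past an element
of S only adds elements of the span of S. It contains all e^{m√2φ}, and these generate the space.
Operator identities are thereby reduced to these vectors. -/
theorem eq_zero_of_heis_closed (S : Set (Module.End F (LatVOA F)))
    (hS : ∀ X ∈ S, ∀ i : ℤ, ⁅heisMode F i, X⁆ ∈ Submodule.span F S)
    (h0 : ∀ X ∈ S, ∀ m, X (Finsupp.single m 1) = 0) : ∀ X ∈ S, X = 0 := by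
  let N : Submodule F (LatVOA F) := ⨅ X ∈ S, LinearMap.ker X
  have memN : ∀ x, x ∈ N ↔ ∀ X ∈ S, X x = 0 := fun x => by simp [N]
  have hN : N = ⊤ := by
    refine lat_submodule_eq_top N (fun m => (memN _).2 fun X hX => h0 X hX m) fun j x hx => ?_
    refine (memN _).2 fun X hX => ?_
    have hspan : ∀ Y ∈ Submodule.span F S, Y x = 0 := fun Y hY => by
      induction hY using Submodule.span_induction with
      | mem Y hY => exact (memN x).1 hx Y hY
      | zero => rfl
      | add Y Z _ _ hY hZ => rw [LinearMap.add_apply, hY, hZ, add_zero]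
      | smul r Y _ hY => rw [LinearMap.smul_apply, hY, smul_zero]
    have h1 := hspan _ (hS X hX (-j - 1))
    rw [lie_apply_end, (memN x).1 hx X hX, map_zero, zero_sub, neg_eq_zero] at h1
    exact h1
  intro X hX
  refine LinearMap.ext fun x => ?_
  have hx : x ∈ N := hN ▸ Submodule.mem_top
  exact (memN x).1 hx X hX

theorem mode_expField_vac (m n m' : ℤ) :
    mode (expField F m) n (Finsupp.single m' 1) =
      Finsupp.single (m + m') (creationCoeff F m (-n - 1 - 2 * m * m')) := by
  rw [mode_expField_single, expCoeff_one]

/-- On e^{m'√2φ} only h₀ survives among the non-creation modes of h, with eigenvalue 2m'. The number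
q is the power of z left for the creation part after z^{2mm'} is removed. -/
theorem ordTerm_heis_exp_vac (m m' k q : ℤ) (hq : q = -k - 2 * m * m') (j : ℕ) :
    ordTerm (heisField F) (expField F m) 0 (k - 1) (-1 - j) (Finsupp.single m' 1) +
        ordTerm (heisField F) (expField F m) 0 (k - 1) j (Finsupp.single m' 1) =
      Finsupp.single (m + m') (X j * creationCoeff F m (q - 1 - j)) +
        if j = 0 then (2 * m' : F) • Finsupp.single (m + m') (creationCoeff F m q) else 0 := by
  have h1 : ordTerm (heisField F) (expField F m) 0 (k - 1) (-1 - j) (Finsupp.single m' 1) =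
      Finsupp.single (m + m') (X j * creationCoeff F m (q - 1 - j)) := by
    rw [ordTerm, if_pos (by omega), Module.End.mul_apply, mode_expField_vac, mode_heisField,
      show (-1 - j : ℤ) = -j - 1 by ring, heisMode_neg_single,
      show -(k - 1 - (-j - 1)) - 1 - 2 * m * m' = q - 1 - j by rw [hq]; ring]
  have h2 : ordTerm (heisField F) (expField F m) 0 (k - 1) j (Finsupp.single m' 1) =
      if j = 0 then (2 * m' : F) • Finsupp.single (m + m') (creationCoeff F m q) else 0 := by
    rw [ordTerm, if_neg (by omega), Module.End.mul_apply, mode_heisField]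
    split_ifs with hj
    · rw [hj, Nat.cast_zero, heisMode_zero_single, map_smul, mode_expField_vac,
        show -(k - 1 - 0) - 1 - 2 * m * m' = q by rw [hq]; ring]
    · rw [heisMode_vac_pos (by omega), map_zero]
  rw [h1, h2]

theorem mode_normOrd_heis_exp_vac (m m' k q : ℤ) (hq : q = -k - 2 * m * m') :
    mode (normOrd (heisField F) (expField F m)) k (Finsupp.single m' 1) =
      Finsupp.single (m + m') (∑ l ∈ Finset.range q.toNat, X l * creationCoeff F m (q - 1 - l)) +
        (2 * m' : F) • Finsupp.single (m + m') (creationCoeff F m q) := by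
  have hsupp : (Function.support fun j : ℕ =>
      (Finsupp.single (m + m') (X j * creationCoeff F m (q - 1 - j)) : LatVOA F)) ⊆
      ↑(Finset.range q.toNat) := by
    intro j hj
    by_contra h
    rw [Finset.coe_range, Set.mem_Iio, not_lt] at h
    refine hj ?_
    dsimp only
    rw [creationCoeff_neg m (by omega), mul_zero, Finsupp.single_zero]
  have hsupp0 : (Function.support fun j : ℕ => if j = 0 then
      (2 * m' : F) • (Finsupp.single (m + m') (creationCoeff F m q) : LatVOA F) else 0).Finite :=
    (Set.finite_singleton 0).subset fun i hi => by by_contra h; exact hi (if_neg h)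
  rw [mode_normOrd_apply, finsum_int_eq _ (ordTerm_finite _ _ _ _ _),
    finsum_congr (ordTerm_heis_exp_vac m m' k q hq),
    finsum_add_distrib ((Finset.finite_toSet _).subset hsupp) hsupp0,
    finsum_eq_sum_of_support_subset _ hsupp, finsum_eq_single _ 0 (fun i hi => if_neg hi),
    if_pos rfl, Finsupp.single_finsetSum]

theorem creationCoeff_rec' (m q : ℤ) : C (q : F) * creationCoeff F m q =
    C (m : F) * ∑ l ∈ Finset.range q.toNat, X l * creationCoeff F m (q - 1 - l) := by
  by_cases h : q < 0
  · rw [creationCoeff_neg m h, Int.toNat_of_nonpos h.le]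
    simp
  · lift q to ℕ using by omega
    rw [Int.toNat_natCast, ← creationCoeff_rec (F := F) m q]
    simp

/-- The failure of the relation `m :h e^{m√2φ}: = ∂ e^{m√2φ}`. -/
def heisExpDefect (F : Type*) [Field F] (m k : ℤ) : Module.End F (LatVOA F) :=
  (m : F) • mode (normOrd (heisField F) (expField F m)) k + (k : F) • mode (expField F m) (k - 1)

theorem lie_heisExpDefect (m i k : ℤ) :
    ⁅heisMode F i, heisExpDefect F m k⁆ = (2 * m : F) • heisExpDefect F m (k + i) := by
  simp only [heisExpDefect]
  rw [lie_add_end, lie_smul_end, lie_smul_end, ← mode_heisField,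
    lie_heis_normOrd_charge isHeisenberg_heisField (hasCharge_expField m), hasCharge_expField,
    show k - 1 + i = k + i - 1 by ring]
  push_cast
  module

theorem heisExpDefect_vac (m k m' : ℤ) : heisExpDefect F m k (Finsupp.single m' 1) = 0 := by
  rw [heisExpDefect, LinearMap.add_apply, LinearMap.smul_apply, LinearMap.smul_apply,
    mode_normOrd_heis_exp_vac m m' k _ rfl, mode_expField_vac,
    show -(k - 1) - 1 - 2 * m * m' = -k - 2 * m * m' by ring, smul_add, Finsupp.smul_single,
    smul_eq_C_mul, ← creationCoeff_rec']
  simp only [Finsupp.smul_single, smul_eq_C_mul, ← Finsupp.single_add]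
  rw [Finsupp.single_eq_zero]
  push_cast
  simp only [map_mul, map_sub, map_neg, map_ofNat]
  ring

/-- The defects of m:h e^{m√2φ}: = ∂e^{m√2φ} are permuted by Heisenberg brackets up to scalars, and
vanish on the generating vectors by the recursion for the creation coefficients. -/
theorem mode_normOrd_heis_exp (m k : ℤ) :
    (m : F) • mode (normOrd (heisField F) (expField F m)) k = -(k : F) • mode (expField F m) (k - 1) := by
  have h : heisExpDefect F m k = 0 := by
    refine eq_zero_of_heis_closed (Set.range (heisExpDefect F m)) ?_ ?_ _ ⟨k, rfl⟩
    · rintro _ ⟨k, rfl⟩ i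
      rw [lie_heisExpDefect]
      exact Submodule.smul_mem _ _ (Submodule.subset_span ⟨_, rfl⟩)
    · rintro _ ⟨k, rfl⟩ m'
      exact heisExpDefect_vac m k m'
  rw [← sub_eq_zero, ← h, heisExpDefect]
  module

theorem latL_eq_sugawara (n : ℤ) : latL F n = sugawara (heisField F) n := rfl

theorem lie_latL_latL (m n : ℤ) :
    ⁅latL F m, latL F n⁆ = ((m : F) - n) • latL F (m + n) +
      (if m + n = 0 then ((m : F) ^ 3 - m) / 12 else 0) • (1 : Module.End F (LatVOA F)) := by
  have := lie_sugawara_sugawara (isHeisenberg_heisField (F := F)) m n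
  simpa only [← latL_eq_sugawara, mul_one, one_pow, one_mul] using this

theorem lie_latL_heis (m n : ℤ) : ⁅latL F m, heisMode F n⁆ = -(n : F) • heisMode F (m + n) := by
  have := lie_sugawara_heis (isHeisenberg_heisField (F := F)) m n
  simpa only [mode_heisField, ← latL_eq_sugawara, mul_one] using this

/-- The bracket with :hh: leaves :h e^{c√2φ}:, which the derivative relation converts into modes of
the exponential itself. The conformal weight is c² = 1. -/
theorem lie_latL_exp (c : ℤ) (hc : c * c = 1) (m n : ℤ) :
    ⁅latL F m, mode (expField F c) n⁆ = -(n : F) • mode (expField F c) (m + n) := by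
  have hc' : (c : F) * c = 1 := by exact_mod_cast hc
  rw [latL, smul_lie_end, lie_sugawara_charge (hasCharge_expField c)]
  have h := mode_normOrd_heis_exp (F := F) c (n + (m + 1))
  have e : (1 / 4 : F) • (2 * (c : F)) • ((2 : F) • mode (normOrd (heisField F) (expField F c)) (n + (m + 1)) +
      (((m + 1 : ℤ) : F) * (2 * c)) • mode (expField F c) (n + (m + 1) - 1)) =
      (c : F) • mode (normOrd (heisField F) (expField F c)) (n + (m + 1)) +
        (((m + 1 : ℤ) : F) * (c * c)) • mode (expField F c) (n + (m + 1) - 1) := by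
    module
  rw [e, h, hc', show n + (m + 1) - 1 = m + n by ring]
  push_cast
  module

/-- If hᵢx = 0 for i > d, then the only terms of L_d that act on x have both indices between 0 and
d. For d ≤ 1 this leaves (1/4)h₀² or (1/2)h₀h₁. -/
theorem mode_normOrd_heis_vac (k : ℤ) {m : ℤ} {x : LatVOA F} {d : ℤ} (hd : 0 ≤ d)
    (h0 : heisMode F 0 x = (2 * m : F) • x) (hx : ∀ i, d < i → heisMode F i x = 0) :
    k = d + 1 → d ≤ 1 → latL F d x = if d = 0 then ((m : F) ^ 2) • x else (m : F) • heisMode F 1 x := by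
  intro hk hd1
  have hterm : ∀ j : ℕ, ordTerm (heisField F) (heisField F) 0 d (-1 - j) x +
      ordTerm (heisField F) (heisField F) 0 d j x =
      if j ≤ 1 ∧ (j : ℤ) ≤ d then heisMode F (d - j) (heisMode F j x) else 0 := by
    intro j
    rw [ordTerm, ordTerm, if_pos (by omega), if_neg (by omega), Module.End.mul_apply,
      Module.End.mul_apply]
    simp only [mode_heisField]
    rw [hx (d - (-1 - j)) (by omega), map_zero, zero_add]
    split_ifs with h
    · rfl
    · rw [hx j (by omega), map_zero]
  rw [latL, LinearMap.smul_apply, mode_normOrd_apply, finsum_int_eq _ (ordTerm_finite _ _ _ _ _),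
    add_sub_cancel_right, finsum_congr hterm,
    finsum_eq_sum_of_support_subset (s := Finset.range 2) _ (fun j hj => by
      by_contra h
      simp only [Finset.coe_range, Set.mem_Iio] at h
      exact hj (if_neg (by omega)))]
  rw [Finset.sum_range_succ, Finset.sum_range_one]
  obtain rfl | rfl : d = 0 ∨ d = 1 := by omega
  · simp [h0]
    module
  · have hc : heisMode F 0 (heisMode F 1 x) = heisMode F 1 (heisMode F 0 x) := by
      have := congrArg (fun D => D x) (isHeisenberg_heisField (F := F) 0 1)
      simp only [mode_heisField, lie_apply_end] at this
      simpa [sub_eq_zero] using this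
    simp [hc, h0]
    module

theorem latL_zero_apply {m : ℤ} {x : LatVOA F} (h0 : heisMode F 0 x = (2 * m : F) • x)
    (hx : ∀ i, 0 < i → heisMode F i x = 0) : latL F 0 x = ((m : F) ^ 2) • x :=
  mode_normOrd_heis_vac 1 le_rfl h0 hx rfl (by norm_num)

theorem latL_one_apply {m : ℤ} {x : LatVOA F} (h0 : heisMode F 0 x = (2 * m : F) • x)
    (hx : ∀ i, 1 < i → heisMode F i x = 0) : latL F 1 x = (m : F) • heisMode F 1 x :=
  mode_normOrd_heis_vac 2 (by norm_num) h0 hx rfl le_rfl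

/-- The weight of a monomial when `h₋ₖ₋₁` has weight `k + 1`. -/
def monomialWeight (μ : ℕ →₀ ℕ) : ℕ := μ.sum fun k e => e * (k + 1)

/-- The diagonal form holds on the vectors e^{m√2φ} and is preserved by creation modes, because [L₀,
h₋ₖ₋₁] = (k+1)h₋ₖ₋₁ and multiplication by `X k` raises the monomial weight by k+1. -/
theorem latL_zero_coeff (x : LatVOA F) (j : ℤ) (μ : ℕ →₀ ℕ) :
    coeff μ ((latL F 0 x) j) = ((j : F) ^ 2 + monomialWeight μ) * coeff μ (x j) := by
  let N : Submodule F (LatVOA F) :=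
    { carrier := {x | ∀ (j : ℤ) (μ : ℕ →₀ ℕ),
        coeff μ ((latL F 0 x) j) = ((j : F) ^ 2 + monomialWeight μ) * coeff μ (x j)}
      add_mem' := fun {x y} hx hy j μ => by
        rw [map_add, Finsupp.add_apply, coeff_add, hx, hy, Finsupp.add_apply, coeff_add, mul_add]
      zero_mem' := fun j μ => by simp
      smul_mem' := fun r x hx j μ => by
        rw [map_smul, Finsupp.smul_apply, coeff_smul, hx, Finsupp.smul_apply, coeff_smul,
          smul_eq_mul, smul_eq_mul, mul_left_comm] }
  have hN : N = ⊤ := by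
    refine lat_submodule_eq_top N ?_ ?_
    · intro m j μ
      rw [latL_zero_apply (heisMode_zero_single m 1) (fun i hi => heisMode_vac_pos hi m),
        Finsupp.smul_apply, coeff_smul, smul_eq_mul, Finsupp.single_apply]
      split_ifs with h
      · subst h
        classical
        rw [coeff_one]
        split_ifs with hμ
        · subst hμ; simp [monomialWeight]
        · simp
      · simp
    · intro k x hx j μ
      have hc := congrArg (fun D => D x) (lie_latL_heis (F := F) 0 (-k - 1))
      simp only [lie_apply_end, sub_eq_iff_eq_add, LinearMap.smul_apply, zero_add] at hc
      have hap : ∀ y : LatVOA F, (heisMode F (-k - 1) y) j = X k * y j := fun y => by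
        induction y using Finsupp.induction_linear with
        | zero => simp
        | add y z hy hz => rw [map_add, Finsupp.add_apply, hy, hz, Finsupp.add_apply, mul_add]
        | single m P =>
          rw [heisMode_neg_single, Finsupp.single_apply, Finsupp.single_apply]
          split_ifs <;> simp
      rw [hc, Finsupp.add_apply, Finsupp.smul_apply, coeff_add, coeff_smul, hap, hap]
      classical
      rw [coeff_X_mul', coeff_X_mul', hx]
      split_ifs with hk
      · have hμ : monomialWeight μ = monomialWeight (μ - Finsupp.single k 1) + (k + 1) := by
          have h1 : μ = (μ - Finsupp.single k 1) + Finsupp.single k 1 := by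
            rw [tsub_add_cancel_of_le]
            rw [Finsupp.single_le_iff]
            exact Nat.one_le_iff_ne_zero.2 (Finsupp.mem_support_iff.1 hk)
          conv_lhs => rw [h1]
          rw [monomialWeight, Finsupp.sum_add_index' (by simp) (fun a b c => by ring),
            Finsupp.sum_single_index (by simp), one_mul]
          rfl
        rw [hμ, smul_eq_mul]
        push_cast
        ring
      · simp
  have : x ∈ N := hN ▸ Submodule.mem_top
  exact this j μ

theorem heisMode_zero_coeff (x : LatVOA F) (j : ℤ) : (heisMode F 0 x) j = (2 * j : F) • x j := by
  induction x using Finsupp.induction_linear with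
  | zero => simp
  | add y z hy hz => rw [map_add, Finsupp.add_apply, hy, hz, Finsupp.add_apply, smul_add]
  | single m P =>
    rw [heisMode_zero_single, Finsupp.smul_apply, Finsupp.single_apply]
    split_ifs with h
    · rw [h]
    · simp

/-- In the sector of e^{m√2φ} the eigenvalues of L₀ are m² plus a nonnegative integer. -/
theorem eq_zero_of_low_weight {x : LatVOA F} {m d : ℤ} (h0 : heisMode F 0 x = (2 * m : F) • x)
    (hL : latL F 0 x = (d : F) • x) (hd : d < m ^ 2) : x = 0 := by
  ext j μ
  rw [Finsupp.zero_apply, coeff_zero]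
  by_cases hj : j = m
  · subst hj
    have h1 := latL_zero_coeff x j μ
    rw [hL, Finsupp.smul_apply, coeff_smul, smul_eq_mul] at h1
    have h2 : ((d - j ^ 2 - monomialWeight μ : ℤ) : F) * coeff μ (x j) = 0 := by
      push_cast
      linear_combination h1
    refine (mul_eq_zero.1 h2).resolve_left ?_
    exact Int.cast_ne_zero.2 (by omega)
  · have h1 := heisMode_zero_coeff x j
    rw [h0, Finsupp.smul_apply, ← sub_eq_zero, ← sub_smul] at h1
    have h2 : (2 * m - 2 * j : F) ≠ 0 := by
      have : ((2 * (m - j) : ℤ) : F) ≠ 0 := Int.cast_ne_zero.2 (by omega)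
      push_cast at this
      rwa [mul_sub] at this
    rw [(smul_eq_zero.1 h1).resolve_left h2, coeff_zero]

end Lattice

end Urod

namespace Urod

/-! ### The level-one sl₂ commutation relations -/

section Lattice

variable {F : Type*} [Field F] [CharZero F]

/-- A family of operators which transforms under the Heisenberg and Virasoro operators like the
commutators of the modes of two fields of charges `2σ`, `2τ` and conformal weight one. -/
structure IsBiprimary (X : ℤ → ℤ → Module.End F (LatVOA F)) (σ τ : ℤ) : Prop where
  heis : ∀ k m n, ⁅heisMode F k, X m n⁆ = (2 * σ : F) • X (m + k) n + (2 * τ : F) • X m (n + k)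
  vir : ∀ r m n, ⁅latL F r, X m n⁆ = -(m : F) • X (m + r) n - (n : F) • X m (n + r)

namespace IsBiprimary

variable {X : ℤ → ℤ → Module.End F (LatVOA F)} {σ τ : ℤ}

theorem heis_apply (hX : IsBiprimary X σ τ) (k m n : ℤ) (x : LatVOA F) :
    heisMode F k (X m n x) = X m n (heisMode F k x) + (2 * σ : F) • X (m + k) n x +
      (2 * τ : F) • X m (n + k) x := by
  have := congrArg (fun D => D x) (hX.heis k m n)
  simp only [lie_apply_end, sub_eq_iff_eq_add, LinearMap.add_apply, LinearMap.smul_apply] at this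
  rw [this]
  abel

theorem vir_apply (hX : IsBiprimary X σ τ) (r m n : ℤ) (x : LatVOA F) :
    latL F r (X m n x) = X m n (latL F r x) - (m : F) • X (m + r) n x - (n : F) • X m (n + r) x := by
  have := congrArg (fun D => D x) (hX.vir r m n)
  simp only [lie_apply_end, sub_eq_iff_eq_add, LinearMap.sub_apply, LinearMap.smul_apply] at this
  rw [this]
  module

theorem heis_zero_vac (hX : IsBiprimary X σ τ) (j m n : ℤ) :
    heisMode F 0 (X m n (Finsupp.single j 1)) =
      (2 * (j + σ + τ : ℤ) : F) • X m n (Finsupp.single j 1) := by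
  rw [hX.heis_apply, heisMode_zero_single, map_smul, add_zero, add_zero]
  push_cast
  module

theorem heis_pos_vac (hX : IsBiprimary X σ τ) {k : ℤ} (hk : 0 < k) (j m n : ℤ) :
    heisMode F k (X m n (Finsupp.single j 1)) = (2 * σ : F) • X (m + k) n (Finsupp.single j 1) +
      (2 * τ : F) • X m (n + k) (Finsupp.single j 1) := by
  rw [hX.heis_apply, heisMode_vac_pos hk, map_zero, zero_add]

theorem vir_zero_vac (hX : IsBiprimary X σ τ) (j m n : ℤ) :
    latL F 0 (X m n (Finsupp.single j 1)) =
      ((j ^ 2 - m - n : ℤ) : F) • X m n (Finsupp.single j 1) := by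
  rw [hX.vir_apply, latL_zero_apply (heisMode_zero_single j 1) (fun i hi => heisMode_vac_pos hi j),
    map_smul, add_zero, add_zero]
  push_cast
  module

/-- The vector has weight j²-m-n and lies in the sector of e^{(j+σ+τ)√2φ}, where the lowest weight
is (j+σ+τ)². -/
theorem vac_eq_zero_of_lt (hX : IsBiprimary X σ τ) {j m n : ℤ}
    (h : j ^ 2 - m - n < (j + σ + τ) ^ 2) : X m n (Finsupp.single j 1) = 0 :=
  eq_zero_of_low_weight (hX.heis_zero_vac j m n) (hX.vir_zero_vac j m n) h

/-- One step above the lowest weight, all hᵢ with i ≥ 2 kill the vector, so L₁ acts as (j+σ+τ)h₁.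
Comparing the two transformation laws relates neighbouring lowest-weight values. -/
theorem vac_rec (hX : IsBiprimary X σ τ) {j m n : ℤ} (h : j ^ 2 - m - n = (j + σ + τ) ^ 2 + 1) :
    (-(m : F) - 2 * σ * (j + σ + τ : ℤ)) • X (m + 1) n (Finsupp.single j 1) =
      ((n : F) + 2 * τ * (j + σ + τ : ℤ)) • X m (n + 1) (Finsupp.single j 1) := by
  have h1 := latL_one_apply (hX.heis_zero_vac j m n) (fun i hi => by
    rw [hX.heis_pos_vac (by omega), hX.vac_eq_zero_of_lt (by omega),
      hX.vac_eq_zero_of_lt (by omega), smul_zero, smul_zero, add_zero])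
  rw [hX.vir_apply, latL_one_apply (heisMode_zero_single j 1) (fun i hi => heisMode_vac_pos (by omega) j),
    heisMode_vac_pos one_pos, smul_zero, map_zero, hX.heis_pos_vac one_pos] at h1
  rw [← sub_eq_zero] at h1 ⊢
  rw [← h1]
  module

/-- Induction on the distance to the lowest weight. Positive Heisenberg modes send the vector to
combinations of vectors already known to vanish, so L₀ must act by the lowest weight; if the actual
weight is larger, the vector is 0. -/
theorem vac_eq_zero (hX : IsBiprimary X σ τ)
    (h0 : ∀ j m n, j ^ 2 - m - n = (j + σ + τ) ^ 2 → X m n (Finsupp.single j 1) = 0) (j m n : ℤ) :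
    X m n (Finsupp.single j 1) = 0 := by
  obtain ⟨d, hd⟩ : ∃ d : ℕ, j ^ 2 - m - n - (j + σ + τ) ^ 2 ≤ d := ⟨_, Int.self_le_toNat _⟩
  induction d using Nat.strong_induction_on generalizing m n with
  | _ d ih =>
    rcases lt_trichotomy (j ^ 2 - m - n) ((j + σ + τ) ^ 2) with h | h | h
    · exact hX.vac_eq_zero_of_lt h
    · exact h0 j m n h
    · have h1 := latL_zero_apply (hX.heis_zero_vac j m n) (fun i hi => by
        rw [hX.heis_pos_vac hi, ih (d - 1) (by omega) _ _ (by omega),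
          ih (d - 1) (by omega) _ _ (by omega), smul_zero, smul_zero, add_zero])
      rw [hX.vir_zero_vac, ← sub_eq_zero, ← sub_smul] at h1
      refine (smul_eq_zero.1 h1).resolve_left ?_
      have : ((j ^ 2 - m - n - (j + σ + τ) ^ 2 : ℤ) : F) ≠ 0 := Int.cast_ne_zero.2 (by omega)
      push_cast at this ⊢
      exact this

theorem eq_zero (hX : IsBiprimary X σ τ)
    (h0 : ∀ j m n, j ^ 2 - m - n = (j + σ + τ) ^ 2 → X m n (Finsupp.single j 1) = 0) (m n : ℤ) :
    X m n = 0 := by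
  refine eq_zero_of_heis_closed {Y | ∃ m n, Y = X m n} ?_ ?_ _ ⟨m, n, rfl⟩
  · rintro _ ⟨m, n, rfl⟩ i
    rw [hX.heis]
    exact Submodule.add_mem _ (Submodule.smul_mem _ _ (Submodule.subset_span ⟨_, _, rfl⟩))
      (Submodule.smul_mem _ _ (Submodule.subset_span ⟨_, _, rfl⟩))
  · rintro _ ⟨m, n, rfl⟩ j
    exact hX.vac_eq_zero h0 j m n

end IsBiprimary

theorem jacobi_end {R V : Type*} [CommRing R] [AddCommGroup V] [Module R V] (D A B : Module.End R V) :
    ⁅D, ⁅A, B⁆⁆ = ⁅⁅D, A⁆, B⁆ + ⁅A, ⁅D, B⁆⁆ := by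
  simp only [Ring.lie_def]; noncomm_ring

theorem isBiprimary_lie_exp {σ τ : ℤ} (hσ : σ * σ = 1) (hτ : τ * τ = 1) :
    IsBiprimary (fun m n => ⁅mode (expField F σ) m, mode (expField F τ) n⁆) σ τ where
  heis k m n := by
    rw [jacobi_end, ← mode_heisField, hasCharge_expField, hasCharge_expField, smul_lie_end,
      lie_smul_end]
  vir r m n := by
    rw [jacobi_end, lie_latL_exp σ hσ, lie_latL_exp τ hτ, smul_lie_end, lie_smul_end, add_comm r m,
      add_comm r n]
    module

theorem lie_one_end {R V : Type*} [CommRing R] [AddCommGroup V] [Module R V] (D : Module.End R V) :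
    ⁅D, (1 : Module.End R V)⁆ = 0 := by
  simp only [Ring.lie_def, mul_one, one_mul, sub_self]

/-- The failure of the relation `[eₘ, fₙ] = hₘ₊ₙ + m δ`. -/
def efDefect (F : Type*) [Field F] (m n : ℤ) : Module.End F (LatVOA F) :=
  ⁅mode (expField F 1) m, mode (expField F (-1)) n⁆ -
    (heisMode F (m + n) + (if m + n = 0 then (m : F) else 0) • (1 : Module.End F (LatVOA F)))

theorem isBiprimary_efDefect : IsBiprimary (efDefect F) 1 (-1) where
  heis k m n := by
    simp only [efDefect]
    have h1 := (isBiprimary_lie_exp (F := F) (σ := 1) (τ := -1) (by norm_num) (by norm_num)).heis k m n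
    have h2 := isHeisenberg_heisField (F := F) k (m + n)
    rw [mode_heisField, mode_heisField] at h2
    rw [lie_sub_end, lie_add_end, h1, h2, lie_smul_end, lie_one_end, smul_zero, show m + k + n = m + n + k by ring,
      show m + (n + k) = m + n + k by ring, show k + (m + n) = m + n + k by ring]
    split_ifs
    · push_cast
      module
    · push_cast
      module
  vir r m n := by
    simp only [efDefect]
    have h1 := (isBiprimary_lie_exp (F := F) (σ := 1) (τ := -1) (by norm_num) (by norm_num)).vir r m n
    rw [lie_sub_end, lie_add_end, h1, lie_latL_heis, lie_smul_end, lie_one_end, smul_zero, show m + r + n = m + n + r by ring,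
      show m + (n + r) = m + n + r by ring, show r + (m + n) = m + n + r by ring]
    split_ifs with h
    · have hr : (r : F) = -m - n := by
        have : ((m + n + r : ℤ) : F) = 0 := by rw [h, Int.cast_zero]
        push_cast at this
        linear_combination this
      push_cast
      rw [hr]
      module
    · push_cast
      module

/-- The difference of the two sides transforms like a commutator of fields of charges ±2 and weight
one. Only lowest-weight values on e^{j√2φ} remain, a sequence in one integer t satisfying t·c(t+1) =
(t+1)·c(t). -/
theorem lie_exp_neg_exp (m n : ℤ) : ⁅mode (expField F 1) m, mode (expField F (-1)) n⁆ =
    heisMode F (m + n) + (if m + n = 0 then (m : F) else 0) • (1 : Module.End F (LatVOA F)) := by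
  suffices h : efDefect F m n = 0 by
    rw [← sub_eq_zero, ← h, efDefect]
  have hX := isBiprimary_efDefect (F := F)
  refine hX.eq_zero (fun j m n hmn => ?_) m n
  obtain rfl : n = -m := by ring_nf at hmn; omega
  -- The shift m = t - 2j puts the singular points of the recursion at t = 0 and t = -1
  -- independently of j.
  have hrec : ∀ t : ℤ, (t : F) • efDefect F (t + 1 - 2 * j) (-(t + 1 - 2 * j)) (Finsupp.single j 1) =
      ((t : F) + 1) • efDefect F (t - 2 * j) (-(t - 2 * j)) (Finsupp.single j 1) := by
    intro t
    have h := hX.vac_rec (j := j) (m := t - 2 * j) (n := -(t - 2 * j) - 1) (by ring)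
    rw [sub_add_cancel, show t - 2 * j + 1 = t + 1 - 2 * j by ring,
      show -(t - 2 * j) - 1 = -(t + 1 - 2 * j) by ring] at h
    rw [← sub_eq_zero] at h ⊢
    rw [← neg_eq_zero, ← h]
    push_cast
    module
  have hval : ∀ t : ℤ, efDefect F (t - 2 * j) (-(t - 2 * j)) (Finsupp.single j 1) =
      Finsupp.single j (expCoeff F 1 (-t - 1 + 2) (creationCoeff F (-1) (t - 1))) -
      Finsupp.single j (expCoeff F (-1) (t - 1 + 2) (creationCoeff F 1 (-t - 1))) -
      Finsupp.single j (MvPolynomial.C (t : F)) := by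
    intro t
    simp only [efDefect, LinearMap.sub_apply, LinearMap.add_apply, lie_apply_end, mode_expField_single, expCoeff_one,
      LinearMap.smul_apply, Module.End.one_apply, add_neg_cancel, if_true, heisMode_zero_single]
    rw [← add_smul, Finsupp.smul_single, MvPolynomial.smul_eq_C_mul, mul_one]
    congr 2
    · congr 2 <;> ring_nf
    · congr 2 <;> ring_nf
    · push_cast; ring_nf
  have hone : ∀ m : ℤ, expCoeff F m 0 1 = 1 := fun m => by rw [expCoeff_one, creationCoeff_zero]
  have hz : ∀ m p : ℤ, expCoeff F m p 0 = 0 := fun m p => by simp [expCoeff]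
  -- The recursion does not pass from t = 0 to t = 1 or from t = 0 to t = -1, so both values t = ±1
  -- are computed directly. In each case one of the two products vanishes and the other is the
  -- leading coefficient 1.
  have hc1 : efDefect F (1 - 2 * j) (-(1 - 2 * j)) (Finsupp.single j 1) = 0 := by
    rw [hval, show (1 : ℤ) - 1 = 0 by rfl, creationCoeff_zero, creationCoeff_neg 1 (by norm_num), hz,
      show (-1 - 1 + 2 : ℤ) = 0 by rfl, hone]
    simp
  have hcm1 : efDefect F (-1 - 2 * j) (-(-1 - 2 * j)) (Finsupp.single j 1) = 0 := by
    rw [hval, show (-(-1) : ℤ) - 1 = 0 by rfl, creationCoeff_zero, creationCoeff_neg (-1) (by norm_num),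
      hz, show (-1 - 1 + 2 : ℤ) = 0 by rfl, hone]
    simp
  have hc0 : efDefect F (0 - 2 * j) (-(0 - 2 * j)) (Finsupp.single j 1) = 0 := by
    have := hrec 0
    -- At t = 0 the left side of the recursion vanishes, which forces c(0) = 0.
    simpa using this.symm
  have hall : ∀ t : ℤ, efDefect F (t - 2 * j) (-(t - 2 * j)) (Finsupp.single j 1) = 0 := by
    intro t
    have hup : ∀ t : ℕ, efDefect F ((t : ℤ) + 1 - 2 * j) (-((t : ℤ) + 1 - 2 * j)) (Finsupp.single j 1) = 0 := by
      intro t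
      induction t with
      | zero => simpa using hc1
      | succ t ih =>
        have h := hrec (t + 1)
        rw [ih, smul_zero] at h
        push_cast at h ⊢
        refine (smul_eq_zero.1 h).resolve_left ?_
        exact_mod_cast Nat.succ_ne_zero t
    have hdown : ∀ t : ℕ, efDefect F (-(t : ℤ) - 1 - 2 * j) (-(-(t : ℤ) - 1 - 2 * j)) (Finsupp.single j 1) = 0 := by
      intro t
      induction t with
      | zero => simpa using hcm1
      | succ t ih =>
        have h := hrec (-(t + 1 : ℕ) - 1)
        rw [show -((t + 1 : ℕ) : ℤ) - 1 + 1 = -t - 1 by push_cast; ring, ih, smul_zero] at h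
        refine (smul_eq_zero.1 h.symm).resolve_left ?_
        have : ((-(t : ℤ) - 1 : ℤ) : F) ≠ 0 := Int.cast_ne_zero.2 (by omega)
        push_cast at this ⊢
        ring_nf at this ⊢
        exact this
    rcases int_trichotomy t with ⟨a, rfl⟩ | rfl | ⟨a, rfl⟩
    · exact hdown a
    · exact hc0
    · exact hup a
  have := hall (m + 2 * j)
  rwa [add_sub_cancel_right] at this

/-- Here the lowest-weight values c(t) are antisymmetric in t, so c(0) = 0; the recursion
(t+2)c(t+1) = (t-1)c(t) propagates this to t > 0 and antisymmetry gives t < 0. No coefficient has to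
be computed. -/
theorem lie_exp_exp_self {σ : ℤ} (hσ : σ * σ = 1) (m n : ℤ) :
    ⁅mode (expField F σ) m, mode (expField F σ) n⁆ = 0 := by
  have hX := isBiprimary_lie_exp (F := F) hσ hσ
  set X : ℤ → ℤ → Module.End F (LatVOA F) := fun m n =>
    ⁅mode (expField F σ) m, mode (expField F σ) n⁆ with hXdef
  refine hX.eq_zero (fun j m n hmn => ?_) m n
  have hN : ∀ m n : ℤ, j ^ 2 - m - n = (j + σ + σ) ^ 2 ↔ n = -4 * σ * j - 4 - m := by
    intro m n
    constructor
    · intro h; linear_combination -h - 4 * hσ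
    · rintro rfl; linear_combination -4 * hσ
  -- The parameter t measures the offset from the point where both mode indices are -2σj-2, so
  -- exchanging the operators is t ↦ -t.
  let c : ℤ → LatVOA F := fun t => X (t - 2 * σ * j - 2) (-t - 2 * σ * j - 2) (Finsupp.single j 1)
  have hanti : ∀ t, c (-t) = -c t := fun t => by
    simp only [c, hXdef, neg_neg]
    rw [lie_swap_end, LinearMap.neg_apply]
  have hrec : ∀ t : ℤ, ((t : F) + 2) • c (t + 1) = ((t : F) - 1) • c t := by
    intro t
    have h := hX.vac_rec (j := j) (m := t - 2 * σ * j - 2) (n := -(t + 1) - 2 * σ * j - 2)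
      (by linear_combination -4 * hσ)
    rw [show t - 2 * σ * j - 2 + 1 = t + 1 - 2 * σ * j - 2 by ring,
      show -(t + 1) - 2 * σ * j - 2 + 1 = -t - 2 * σ * j - 2 by ring] at h
    have hσ' : (σ : F) * σ = 1 := by exact_mod_cast hσ
    have e1 : (-((t - 2 * σ * j - 2 : ℤ) : F) - 2 * σ * (j + σ + σ : ℤ)) = -((t : F) + 2) := by
      push_cast
      linear_combination -4 * hσ'
    have e2 : (((-(t + 1) - 2 * σ * j - 2 : ℤ) : F) + 2 * σ * (j + σ + σ : ℤ)) = -((t : F) - 1) := by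
      push_cast
      linear_combination 4 * hσ'
    rw [e1, e2, neg_smul, neg_smul, neg_inj] at h
    exact h
  have hc0 : c 0 = 0 := by
    have h := hanti 0
    rw [neg_zero, eq_neg_iff_add_eq_zero, ← two_smul F] at h
    exact (smul_eq_zero.1 h).resolve_left two_ne_zero
  have hnat : ∀ t : ℕ, c t = 0 := by
    intro t
    induction t with
    | zero => exact hc0
    | succ t ih =>
      have h := hrec t
      rw [ih, smul_zero] at h
      push_cast at h ⊢
      refine (smul_eq_zero.1 h).resolve_left ?_
      exact_mod_cast Nat.succ_ne_zero (t + 1)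
  have hall : ∀ t : ℤ, c t = 0 := by
    intro t
    obtain ⟨a, rfl | rfl⟩ := t.eq_nat_or_neg
    · exact hnat a
    · rw [hanti, hnat, neg_zero]
  have := hall (m + 2 * σ * j + 2)
  simp only [c] at this
  rw [(hN m n).1 hmn]
  rw [← this]
  congr 2 <;> ring

theorem hasCharge_eField : HasCharge (heisField F) (eField F) 2 := by
  simpa [eField] using hasCharge_expField (F := F) 1

theorem hasCharge_fField : HasCharge (heisField F) (fField F) (-2) := by
  simpa [fField] using hasCharge_expField (F := F) (-1)

end Lattice

end Urod

namespace Urod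

/-! ### The local ring O at b = ∞ and its residue field ℂ -/

section IntegralRing

theorem b_ne_zero : b ≠ 0 := RatFunc.X_ne_zero

theorem coe_constHom (c : ℂ) : (constHom c : K) = RatFunc.C c := rfl

open Classical in
theorem mem_O_iff (x : K) : x ∈ O ↔ RatFunc.inftyValuation ℂ x ≤ 1 := Iff.rfl

open Classical in
theorem valuation_b : RatFunc.inftyValuation ℂ b = WithZero.exp 1 :=
  RatFunc.inftyValuation.X ℂ

open Classical in
theorem mul_b_mem_O {x : K} (hx : RatFunc.inftyValuation ℂ x < 1) : x * b ∈ O := by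
  rw [mem_O_iff, map_mul, valuation_b]
  by_cases h0 : x = 0
  · simp [h0]
  rw [RatFunc.inftyValuation_apply, RatFunc.inftyValuation_of_nonzero ℂ h0] at hx ⊢
  rw [← WithZero.exp_zero, WithZero.exp_lt_exp] at hx
  rw [← WithZero.exp_add, ← WithZero.exp_zero, WithZero.exp_le_exp]
  omega

open Classical in
-- If the valuation is 1, numerator and denominator have equal degree; subtracting the quotient of
-- leading coefficients lowers the degree of the numerator.
theorem exists_const_sub_lt {x : K} (hx : x ∈ O) :
    ∃ c : ℂ, RatFunc.inftyValuation ℂ (x - RatFunc.C c) < 1 := by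
  by_cases h1 : RatFunc.inftyValuation ℂ x < 1
  · exact ⟨0, by simpa using h1⟩
  have hv : RatFunc.inftyValuation ℂ x = 1 := le_antisymm ((mem_O_iff x).1 hx) (not_lt.1 h1)
  have hx0 : x ≠ 0 := by rintro rfl; simp at hv
  have hp := RatFunc.num_ne_zero hx0
  have hq := RatFunc.denom_ne_zero x
  have hdiv : x = algebraMap _ K x.num / algebraMap _ K x.denom := (RatFunc.num_div_denom x).symm
  have hqv : RatFunc.inftyValuation ℂ (algebraMap _ K x.denom) ≠ 0 := by
    rw [Valuation.ne_zero_iff]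
    simpa using hq
  have hdeg : x.num.natDegree = x.denom.natDegree := by
    rw [hdiv, map_div₀, div_eq_one_iff_eq hqv, RatFunc.inftyValuation_apply,
      RatFunc.inftyValuation_apply, RatFunc.inftyValuation.polynomial _ hp,
      RatFunc.inftyValuation.polynomial _ hq, WithZero.exp_inj] at hv
    exact_mod_cast hv
  set c : ℂ := x.num.leadingCoeff / x.denom.leadingCoeff with hc
  have hlq : x.denom.leadingCoeff ≠ 0 := Polynomial.leadingCoeff_ne_zero.2 hq
  have hlp : x.num.leadingCoeff ≠ 0 := Polynomial.leadingCoeff_ne_zero.2 hp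
  have hc0 : c ≠ 0 := div_ne_zero hlp hlq
  have hlt : (x.num - Polynomial.C c * x.denom).degree < x.num.degree := by
    refine Polynomial.degree_sub_lt_left ?_ hp ?_
    · rw [Polynomial.degree_C_mul hc0, Polynomial.degree_eq_natDegree hp,
        Polynomial.degree_eq_natDegree hq, hdeg]
    · rw [Polynomial.leadingCoeff_mul, Polynomial.leadingCoeff_C, hc, div_mul_cancel₀ _ hlq]
  refine ⟨c, ?_⟩
  have hsub : x - RatFunc.C c =
      algebraMap _ K (x.num - Polynomial.C c * x.denom) / algebraMap _ K x.denom := by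
    have : algebraMap _ K x.denom ≠ 0 := by simpa using hq
    rw [map_sub, map_mul, RatFunc.algebraMap_C, sub_div, mul_div_cancel_right₀ _ this, ← hdiv]
  rw [hsub]
  by_cases hr : x.num - Polynomial.C c * x.denom = 0
  · simp [hr]
  rw [map_div₀, div_lt_one₀ (zero_lt_iff.2 hqv), RatFunc.inftyValuation_apply,
    RatFunc.inftyValuation_apply, RatFunc.inftyValuation.polynomial _ hr,
    RatFunc.inftyValuation.polynomial _ hq, WithZero.exp_lt_exp]
  have := Polynomial.natDegree_lt_natDegree hr hlt
  omega

theorem exists_eq_const_add (r : O) : ∃ (c : ℂ) (s : O), r = constHom c + bInv * s := by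
  obtain ⟨c, hc⟩ := exists_const_sub_lt r.2
  refine ⟨c, ⟨_, mul_b_mem_O hc⟩, Subtype.ext ?_⟩
  change (r : K) = RatFunc.C c + b⁻¹ * (((r : K) - RatFunc.C c) * b)
  have := b_ne_zero
  field_simp
  ring

theorem bInv_mul_ne_one (s : O) : bInv * s ≠ 1 := by
  classical
  intro h
  have h1 : RatFunc.inftyValuation ℂ ((bInv * s : O) : K) = 1 := by rw [h]; exact map_one _
  have h2 : ((bInv * s : O) : K) = b⁻¹ * s := rfl
  rw [h2, map_mul, map_inv₀, valuation_b] at h1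
  have h3 : (WithZero.exp (1 : ℤ))⁻¹ * RatFunc.inftyValuation ℂ (s : K) ≤ (WithZero.exp (1 : ℤ))⁻¹ * 1 :=
    mul_le_mul_right ((mem_O_iff _).1 s.2) _
  rw [h1, mul_one, ← WithZero.exp_neg, ← WithZero.exp_zero, WithZero.exp_le_exp] at h3
  omega

/-- The reduction of the constants modulo `b⁻¹`. -/
def constMod : ℂ →+* O ⧸ Ideal.span {bInv} := (Ideal.Quotient.mk _).comp constHom

theorem constMod_bijective : Function.Bijective constMod := by
  have : Nontrivial (O ⧸ Ideal.span {bInv}) := by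
    rw [Ideal.Quotient.nontrivial_iff, Ne, Ideal.eq_top_iff_one, Ideal.mem_span_singleton]
    rintro ⟨s, hs⟩
    exact bInv_mul_ne_one s hs.symm
  refine ⟨constMod.injective, fun y => ?_⟩
  obtain ⟨r, rfl⟩ := Ideal.Quotient.mk_surjective y
  obtain ⟨c, s, rfl⟩ := exists_eq_const_add r
  refine ⟨c, ?_⟩
  rw [map_add, constMod, RingHom.comp_apply, left_eq_add, Ideal.Quotient.eq_zero_iff_mem]
  exact Ideal.mul_mem_right _ _ (Ideal.mem_span_singleton_self _)

/-- The value at `b = ∞` of a rational function that is regular there. -/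
def red : O →+* ℂ :=
  (RingEquiv.ofBijective constMod constMod_bijective).symm.toRingHom.comp (Ideal.Quotient.mk _)

@[simp]
theorem red_constHom (c : ℂ) : red (constHom c) = c :=
  (RingEquiv.ofBijective constMod constMod_bijective).symm_apply_apply c

@[simp]
theorem red_bInv : red bInv = 0 := by
  have : (Ideal.Quotient.mk (Ideal.span {bInv})) bInv = 0 :=
    Ideal.Quotient.eq_zero_iff_mem.2 (Ideal.mem_span_singleton_self _)
  rw [red, RingHom.comp_apply, this, map_zero]

theorem exists_eq_red_add (r : O) : ∃ s : O, r = constHom (red r) + bInv * s := by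
  obtain ⟨c, s, rfl⟩ := exists_eq_const_add r
  exact ⟨s, by simp⟩

/-- A nonzero constant plus a multiple of b⁻¹ has valuation 1, so its inverse is also regular at
infinity. -/
theorem isUnit_of_red_ne_zero {r : O} (h : red r ≠ 0) : IsUnit r := by
  classical
  obtain ⟨s, hs⟩ := exists_eq_red_add r
  set c := red r
  have hlt : RatFunc.inftyValuation ℂ ((bInv * s : O) : K) < RatFunc.inftyValuation ℂ ((constHom c : O) : K) := by
    rw [coe_constHom, RatFunc.inftyValuation.C _ h]
    refine lt_of_le_of_ne ((mem_O_iff _).1 (bInv * s).2) fun h1 => ?_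
    have h2 : ((bInv * s : O) : K) = b⁻¹ * s := rfl
    rw [h2, map_mul, map_inv₀, valuation_b] at h1
    have h3 : (WithZero.exp (1 : ℤ))⁻¹ * RatFunc.inftyValuation ℂ (s : K) ≤ (WithZero.exp (1 : ℤ))⁻¹ * 1 :=
      mul_le_mul_right ((mem_O_iff _).1 s.2) _
    rw [h1, mul_one, ← WithZero.exp_neg, ← WithZero.exp_zero, WithZero.exp_le_exp] at h3
    omega
  have hv : RatFunc.inftyValuation ℂ (r : K) = 1 := by
    rw [hs, Subring.coe_add, Valuation.map_add_eq_of_lt_left _ hlt, coe_constHom,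
      RatFunc.inftyValuation.C _ h]
  have hr0 : (r : K) ≠ 0 := by intro h0; simp [h0] at hv
  refine IsUnit.of_mul_eq_one ⟨(r : K)⁻¹, by rw [mem_O_iff, map_inv₀, hv, inv_one]⟩ (Subtype.ext ?_)
  exact mul_inv_cancel₀ hr0

theorem exists_inv_of_red_ne_zero {r : O} (h : red r ≠ 0) :
    ∃ s : O, (s : K) = (r : K)⁻¹ ∧ red s = (red r)⁻¹ := by
  obtain ⟨s, hs⟩ := (isUnit_of_red_ne_zero h).exists_right_inv
  refine ⟨s, ?_, ?_⟩
  · have : (r : K) * s = 1 := congrArg Subtype.val hs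
    exact eq_inv_of_mul_eq_one_right this
  · have := congrArg red hs
    rw [map_mul, map_one] at this
    exact eq_inv_of_mul_eq_one_right this

end IntegralRing

/-! ### Limits of operators, fields and states -/

section Limits

instance instModuleIntegralForm : Module O integralForm := Submodule.module integralForm

instance instSMulIntegralForm : SMul O integralForm := instModuleIntegralForm.toSMul

/-- O acts on the limit through its residue field, since multiples of b⁻¹ are killed. This links the
O-structure with the ℂ-structure given by constants. -/
theorem toLimit_smul (r : O) (x : integralForm) : toLimit (r • x) = red r • toLimit x := by
  obtain ⟨s, hs⟩ := exists_eq_red_add r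
  have h1 : red r • toLimit x = toLimit (constHom (red r) • x) := (map_smul toLimit _ x).symm
  have h2 : toLimit ((bInv * s) • x) = 0 := by
    rw [mul_smul]
    exact (Submodule.Quotient.mk_eq_zero _).2 (Submodule.smul_mem_pointwise_smul _ _ _ trivial)
  conv_lhs => rw [hs]
  rw [h1, add_smul, map_add, h2, add_zero]

theorem toLimit_surjective : Function.Surjective toLimit := Submodule.mkQ_surjective _

open scoped Pointwise in
theorem exists_of_toLimit_eq_zero {x : integralForm} (h : toLimit x = 0) :
    ∃ y : integralForm, x = bInv • y := by
  have h' : x ∈ bInv • (⊤ : Submodule O integralForm) :=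
    (Submodule.Quotient.mk_eq_zero (R := O) (M := integralForm) _).1 h
  obtain ⟨y, -, rfl⟩ := (Submodule.mem_smul_pointwise_iff_exists _ _ _).1 h'
  exact ⟨y, rfl⟩

/-- The operator `D` preserves the integral form and has the limit `D'`. -/
def HasLim (D : Module.End K Fam) (D' : Module.End ℂ Limit) : Prop :=
  Preserves D ∧ limitOp D = D'

theorem hasLim_iff {D : Module.End K Fam} {D' : Module.End ℂ Limit} :
    HasLim D D' ↔ ∃ h : Preserves D, ∀ x : integralForm, D' (toLimit x) = toLimit ⟨D x, h x x.2⟩ := by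
  constructor
  · rintro ⟨h, rfl⟩
    exact ⟨h, limitOp_toLimit h⟩
  · rintro ⟨h, h'⟩
    refine ⟨h, LinearMap.ext fun y => ?_⟩
    obtain ⟨x, rfl⟩ := toLimit_surjective y
    rw [limitOp_toLimit h, h']

theorem Preserves.hasLim {D : Module.End K Fam} (h : Preserves D) : HasLim D (limitOp D) := ⟨h, rfl⟩

namespace HasLim

variable {D E : Module.End K Fam} {D' E' : Module.End ℂ Limit}

theorem zero : HasLim 0 0 := hasLim_iff.2 ⟨fun _ _ => integralForm.zero_mem, fun _ =>
  (map_zero toLimit).symm⟩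

theorem one : HasLim 1 1 := hasLim_iff.2 ⟨fun _ h => h, fun _ => rfl⟩

theorem add (hD : HasLim D D') (hE : HasLim E E') : HasLim (D + E) (D' + E') := by
  obtain ⟨h, h'⟩ := hasLim_iff.1 hD
  obtain ⟨k, k'⟩ := hasLim_iff.1 hE
  refine hasLim_iff.2 ⟨fun x hx => integralForm.add_mem (h x hx) (k x hx), fun x => ?_⟩
  rw [LinearMap.add_apply, h', k', ← map_add]
  rfl

theorem mul (hD : HasLim D D') (hE : HasLim E E') : HasLim (D * E) (D' * E') := by
  obtain ⟨h, h'⟩ := hasLim_iff.1 hD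
  obtain ⟨k, k'⟩ := hasLim_iff.1 hE
  refine hasLim_iff.2 ⟨fun x hx => h _ (k x hx), fun x => ?_⟩
  rw [Module.End.mul_apply, k', h']
  rfl

theorem smul (r : O) (hD : HasLim D D') : HasLim ((r : K) • D) (red r • D') := by
  obtain ⟨h, h'⟩ := hasLim_iff.1 hD
  refine hasLim_iff.2 ⟨fun x hx => integralForm.smul_mem r (h x hx), fun x => ?_⟩
  rw [LinearMap.smul_apply, h', ← toLimit_smul]
  rfl

theorem smul' {a : K} {c : ℂ} (hr : ∃ r : O, (r : K) = a ∧ red r = c) (hD : HasLim D D') :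
    HasLim (a • D) (c • D') := by
  obtain ⟨r, rfl, rfl⟩ := hr
  exact hD.smul r

theorem congr (hD : HasLim D D') (h : D = E) (h' : D' = E') : HasLim E E' := h ▸ h' ▸ hD

theorem neg (hD : HasLim D D') : HasLim (-D) (-D') := by
  have := hD.smul (-1)
  rw [map_neg, map_one, neg_smul, one_smul, Subring.coe_neg, Subring.coe_one] at this
  exact HasLim.congr this (neg_one_smul K D) rfl

theorem sub (hD : HasLim D D') (hE : HasLim E E') : HasLim (D - E) (D' - E') := by
  have := hD.add hE.neg
  rwa [← sub_eq_add_neg, ← sub_eq_add_neg] at this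

theorem lie (hD : HasLim D D') (hE : HasLim E E') : HasLim ⁅D, E⁆ ⁅D', E'⁆ := by
  rw [Ring.lie_def, Ring.lie_def]
  exact (hD.mul hE).sub (hE.mul hD)

theorem zsmul (n : ℤ) (hD : HasLim D D') : HasLim (n • D) (n • D') := by
  have := hD.smul (n : O)
  rw [map_intCast, Int.cast_smul_eq_zsmul] at this
  rw [← Int.cast_smul_eq_zsmul K]
  exact this

end HasLim

/-- All modes of the field `A` preserve the integral form, and their limits are those of `A'`. -/
def HasLimField (A : VertexOperator K Fam) (A' : VertexOperator ℂ Limit) : Prop :=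
  ∀ n, HasLim (mode A n) (mode A' n)

theorem HasLimField.limitField_eq {A : VertexOperator K Fam} {A' : VertexOperator ℂ Limit}
    (h : HasLimField A A') : limitField A = A' := by
  ext n x
  rw [limitField, mode_ofModes, (h n).2]

theorem hasLimField_limitField {A : VertexOperator K Fam} (h : ∀ n, Preserves (mode A n)) :
    HasLimField A (limitField A) := fun n => by
  rw [limitField, mode_ofModes]
  exact (h n).hasLim

/-- `finsum` equals 0 on infinite support, so finiteness must be known before reduction; the support
can only shrink afterwards. -/
theorem coe_finsum_integralForm {ι : Type*} (f : ι → Fam) (hf : ∀ i, f i ∈ integralForm)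
    (hfin : (Function.support f).Finite) : ∃ h : ∑ᶠ i, f i ∈ integralForm,
      toLimit ⟨∑ᶠ i, f i, h⟩ = ∑ᶠ i, toLimit ⟨f i, hf i⟩ := by
  let g : ι → integralForm := fun i => ⟨f i, hf i⟩
  have hg : (Function.support g).Finite := hfin.subset fun i hi h => hi (Subtype.ext h)
  have h1 : ((∑ᶠ i, g i : integralForm) : Fam) = ∑ᶠ i, f i :=
    integralForm.subtype.toAddMonoidHom.map_finsum hg
  refine ⟨h1 ▸ (∑ᶠ i, g i : integralForm).2, ?_⟩
  have h2 := toLimit.toAddMonoidHom.map_finsum hg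
  refine Eq.trans (congrArg toLimit (Subtype.ext h1.symm)) h2

namespace HasLimField

variable {A B : VertexOperator K Fam} {A' B' : VertexOperator ℂ Limit}

theorem idField : HasLimField Urod.idField Urod.idField := fun n => by
  rw [mode_idField, mode_idField]
  split_ifs
  · exact HasLim.one
  · exact HasLim.zero

theorem add (hA : HasLimField A A') (hB : HasLimField B B') : HasLimField (A + B) (A' + B') :=
  fun n => by
  rw [mode_add, mode_add]
  exact (hA n).add (hB n)

theorem sub (hA : HasLimField A A') (hB : HasLimField B B') : HasLimField (A - B) (A' - B') :=
  fun n => by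
  rw [mode_sub, mode_sub]
  exact (hA n).sub (hB n)

theorem smul' {a : K} {c : ℂ} (hr : ∃ r : O, (r : K) = a ∧ red r = c) (hA : HasLimField A A') :
    HasLimField (a • A) (c • A') := fun n => by
  rw [mode_smul, mode_smul]
  exact (hA n).smul' hr

theorem derivField (hA : HasLimField A A') : HasLimField (derivField A) (derivField A') := fun n => by
  rw [mode_derivField, mode_derivField]
  exact (hA _).zsmul _

theorem nprod (hA : HasLimField A A') (n : ℤ) (hB : HasLimField B B') :
    HasLimField (nprod A n B) (nprod A' n B') := fun k => by
  have hterm : ∀ j, HasLim (nprodTerm A B n k j) (nprodTerm A' B' n k j) := fun j =>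
    (((hA _).mul (hB _)).sub (((hB _).mul (hA _)).zsmul _)).zsmul _
  have hsum := fun x : integralForm => coe_finsum_integralForm (fun j => nprodTerm A B n k j x)
    (fun j => (hterm j).1 x x.2) ((nprodTerm_trunc A B n x).2 k)
  refine hasLim_iff.2 ⟨fun x hx => ?_, fun x => ?_⟩
  · rw [mode_nprod_apply]
    exact (hsum ⟨x, hx⟩).1
  · obtain ⟨h1, h2⟩ := hsum x
    rw [mode_nprod_apply]
    simp only [mode_nprod_apply]
    rw [h2]
    refine finsum_congr fun j => ?_
    obtain ⟨_, h'⟩ := hasLim_iff.1 (hterm j)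
    exact h' x

theorem normOrd (hA : HasLimField A A') (hB : HasLimField B B') :
    HasLimField (normOrd A B) (normOrd A' B') := hA.nprod _ hB

end HasLimField

/-- The generating fields of the integral form. -/
def integralGens : Set (VertexOperator K Fam) := {b⁻¹ ^ 2 • Tb, famE, famH, famF}

theorem famVacuum_mem : famVacuum ∈ integralForm := Submodule.mem_sInf.2 fun _ hN => hN.1

theorem preserves_gen {A : VertexOperator K Fam} (hA : A ∈ integralGens) (n : ℤ) :
    Preserves (mode A n) := fun _ hx =>
  Submodule.mem_sInf.2 fun _ hN => hN.2 A hA n _ (Submodule.mem_sInf.1 hx _ hN)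

/-- The induction principle for the integral form. Intersecting with the integral form itself makes
membership of x available in the induction step. -/
theorem integralForm_le {N : Submodule O Fam} (h0 : famVacuum ∈ N)
    (hs : ∀ A ∈ integralGens, ∀ n : ℤ, ∀ x ∈ integralForm, x ∈ N → mode A n x ∈ N) :
    integralForm ≤ N := by
  have : integralForm ≤ integralForm ⊓ N := sInf_le ⟨⟨famVacuum_mem, h0⟩, fun A hA n x hx =>
    ⟨preserves_gen hA n x hx.1, hs A hA n x hx.1 hx.2⟩⟩
  exact this.trans inf_le_right

theorem hasLimField_gen {A : VertexOperator K Fam} (hA : A ∈ integralGens) :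
    HasLimField A (limitField A) := hasLimField_limitField (preserves_gen hA)

theorem limitField_gen_mem {A : VertexOperator K Fam} (hA : A ∈ integralGens) :
    limitField A ∈ limitGens := by
  rcases hA with rfl | rfl | rfl | rfl
  · exact Or.inl rfl
  · exact Or.inr (Or.inl rfl)
  · exact Or.inr (Or.inr (Or.inl rfl))
  · exact Or.inr (Or.inr (Or.inr rfl))

theorem stateField_gen {A : VertexOperator K Fam} (hA : A ∈ integralGens) :
    StateField famVacuum famGens (mode A (-1) famVacuum) A := by
  rcases hA with rfl | rfl | rfl | rfl
  · rw [mode_smul]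
    exact StateField.smul _ _ _ (StateField.gen Tb (Or.inl rfl))
  · exact StateField.gen famE (Or.inr (Or.inl rfl))
  · exact StateField.gen famH (Or.inr (Or.inr (Or.inl rfl)))
  · exact StateField.gen famF (Or.inr (Or.inr (Or.inr rfl)))

/-- `A(z)` is the field of the state `a`, before and after taking the limit. -/
def HasState (a : Fam) (A : VertexOperator K Fam) : Prop :=
  StateField famVacuum famGens a A ∧ ∃ (h : a ∈ integralForm) (A' : VertexOperator ℂ Limit),
    HasLimField A A' ∧ StateField limitVacuum limitGens (toLimit ⟨a, h⟩) A'

theorem hasState_gen {A : VertexOperator K Fam} (hA : A ∈ integralGens) :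
    HasState (mode A (-1) famVacuum) A := by
  refine ⟨stateField_gen hA, preserves_gen hA _ _ famVacuum_mem, _, hasLimField_gen hA, ?_⟩
  have := StateField.gen (vac := limitVacuum) _ (limitField_gen_mem hA)
  rw [((hasLimField_gen hA) (-1)).2.symm, limitVacuum, limitOp_toLimit (preserves_gen hA _)] at this
  exact this

/-- The states with compatible fields before and after the limit form an O-submodule stable under
the generators: the state A_(n)x has the field A_(n)B, and limits commute with this product. -/
theorem exists_hasState (a : integralForm) : ∃ A, HasState (a : Fam) A := by
  let N : Submodule O Fam :=
    { carrier := {a | ∃ A, HasState a A}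
      add_mem' := by
        rintro x y ⟨A, hA, h, A', hA', hA''⟩ ⟨B, hB, k, B', hB', hB''⟩
        exact ⟨A + B, hA.add _ _ _ _ hB, integralForm.add_mem h k, A' + B', hA'.add hB',
          hA''.add _ _ _ _ hB''⟩
      zero_mem' := by
        -- `StateField` has no constructor for zero, so the zero state is taken as 0 times the
        -- vacuum.
        refine ⟨(0 : K) • idField, ?_, integralForm.zero_mem, (0 : ℂ) • idField,
          HasLimField.idField.smul' ⟨0, rfl, map_zero _⟩, ?_⟩
        · have := (StateField.vacuum (vac := famVacuum) (G := famGens)).smul 0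
          rwa [zero_smul] at this
        · have := (StateField.vacuum (vac := limitVacuum) (G := limitGens)).smul 0
          rw [zero_smul] at this
          exact this
      smul_mem' := by
        rintro r x ⟨A, hA, h, A', hA', hA''⟩
        refine ⟨(r : K) • A, hA.smul _, integralForm.smul_mem r h, red r • A',
          hA'.smul' ⟨r, rfl, rfl⟩, ?_⟩
        have := hA''.smul (red r)
        rwa [← toLimit_smul] at this }
  have hN : integralForm ≤ N := by
    refine integralForm_le ⟨idField, StateField.vacuum, famVacuum_mem, idField, HasLimField.idField,
      StateField.vacuum⟩ ?_
    rintro A hA n x - ⟨B, hB, k, B', hB', hB''⟩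
    obtain ⟨h1, h, A', hA', hA''⟩ := hasState_gen hA
    refine ⟨nprod A n B, h1.nprod n _ _ _ _ hB, preserves_gen hA n x k, nprod A' n B',
      hA'.nprod n hB', ?_⟩
    have := hA''.nprod n _ _ _ _ hB''
    rwa [(hasLim_iff.1 (hA' n)).2] at this
  exact hN a.2

theorem exists_stateField (a : integralForm) : ∃ A : VertexOperator K Fam,
    StateField famVacuum famGens (a : Fam) A ∧ (∀ n, Preserves (mode A n)) ∧
      StateField limitVacuum limitGens (toLimit a) (limitField A) := by
  obtain ⟨A, hA, h, A', hA', hA''⟩ := exists_hasState a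
  exact ⟨A, hA, fun n => (hA' n).1, hA'.limitField_eq ▸ hA''⟩

end Limits

end Urod

namespace Urod

/-! ### Extension of scalars from ℂ to ℂ(b) -/

section BaseChange

variable {F F' : Type*} [Field F] [CharZero F] [Field F'] [CharZero F'] (φ : F →+* F')

/-- Extension of scalars on the lattice vertex algebra. -/
def mapLat : LatVOA F →+ LatVOA F' :=
  Finsupp.mapRange.addMonoidHom (MvPolynomial.map φ).toAddMonoidHom

@[simp]
theorem mapLat_single (m : ℤ) (P : MvPolynomial ℕ F) :
    mapLat φ (Finsupp.single m P) = Finsupp.single m (MvPolynomial.map φ P) := by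
  simp [mapLat]

theorem mapLat_smul (r : F) (v : LatVOA F) : mapLat φ (r • v) = φ r • mapLat φ v := by
  induction v using Finsupp.induction_linear with
  | zero => simp
  | add x y hx hy => rw [smul_add, map_add, hx, hy, map_add, smul_add]
  | single m P =>
    rw [Finsupp.smul_single, mapLat_single, mapLat_single, Finsupp.smul_single,
      MvPolynomial.smul_eq_C_mul, MvPolynomial.smul_eq_C_mul, map_mul, MvPolynomial.map_C]

theorem addHom_lat_ext {M : Type*} [AddCommMonoid M] {f g : LatVOA F →+ M}
    (h : ∀ m P, f (Finsupp.single m P) = g (Finsupp.single m P)) (x : LatVOA F) : f x = g x :=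
  DFunLike.congr_fun (Finsupp.addHom_ext h) x

theorem intertwines_mapLat_heis : Intertwines (mapLat φ) (heisField F) (heisField F') := by
  intro n x
  have h2 : φ 2 = 2 := map_ofNat φ 2
  simp only [mode_heisField]
  refine addHom_lat_ext (f := (mapLat φ).comp (heisMode F n).toAddMonoidHom)
    (g := (heisMode F' n).toAddMonoidHom.comp (mapLat φ)) (fun m P => ?_) x
  simp only [AddMonoidHom.comp_apply, LinearMap.toAddMonoidHom_coe, mapLat_single]
  rcases int_trichotomy n with ⟨j, rfl⟩ | rfl | ⟨j, rfl⟩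
  · rw [heisMode_neg_single, heisMode_neg_single, mapLat_single, map_mul, MvPolynomial.map_X]
  · rw [heisMode_zero_single, heisMode_zero_single, mapLat_smul, mapLat_single]
    simp [h2]
  · rw [heisMode_pos_single, heisMode_pos_single, mapLat_single, map_mul, MvPolynomial.map_C,
      MvPolynomial.pderiv_map]
    simp [h2]

theorem map_creationCoeff (m k : ℤ) :
    MvPolynomial.map φ (creationCoeff F m k) = creationCoeff F' m k := by
  have hu : PowerSeries.map (MvPolynomial.map φ) (creationExponent F m) = creationExponent F' m := by
    ext1 n
    rw [PowerSeries.coeff_map, creationExponent, creationExponent, PowerSeries.coeff_mk,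
      PowerSeries.coeff_mk]
    split_ifs <;> simp
  rw [creationCoeff, creationCoeff]
  split_ifs
  · exact map_zero _
  · simp only [creationExp, PowerSeries.coeff_mk, map_sum, map_mul, MvPolynomial.map_C, map_inv₀,
      map_natCast, ← hu, ← map_pow, PowerSeries.coeff_map]

/-- The relations `expCoeff_X_mul` and `expCoeff_one` determine the coefficients by induction on P,
and they have constants in the prime field. -/
theorem map_expCoeff (m p : ℤ) (P : MvPolynomial ℕ F) :
    MvPolynomial.map φ (expCoeff F m p P) = expCoeff F' m p (MvPolynomial.map φ P) := by
  induction P using MvPolynomial.induction_on generalizing p with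
  | C a =>
    rw [← mul_one (MvPolynomial.C a), expCoeff_C_mul, map_mul, map_mul, MvPolynomial.map_C,
      expCoeff_C_mul, map_one, expCoeff_one, expCoeff_one, map_creationCoeff]
  | add P Q hP hQ => rw [expCoeff_add, map_add, hP, hQ, map_add, expCoeff_add]
  | mul_X P k hP =>
    have h2 : φ 2 = 2 := map_ofNat φ 2
    rw [mul_comm P, expCoeff_X_mul, map_sub, map_mul, map_mul, hP, hP,
      map_mul (MvPolynomial.map φ) (MvPolynomial.X k) P, MvPolynomial.map_X,
      expCoeff_X_mul, MvPolynomial.map_C]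
    simp [h2]

theorem intertwines_mapLat_exp (m : ℤ) : Intertwines (mapLat φ) (expField F m) (expField F' m) := by
  intro n x
  refine addHom_lat_ext (f := (mapLat φ).comp (mode (expField F m) n).toAddMonoidHom)
    (g := (mode (expField F' m) n).toAddMonoidHom.comp (mapLat φ)) (fun m P => ?_) x
  simp only [AddMonoidHom.comp_apply, LinearMap.toAddMonoidHom_coe, mapLat_single,
    mode_expField_single, map_expCoeff]

end BaseChange

/-! ### The lattice factor inside the integral form -/

section Family

@[simp]
theorem mode_leftField {R V W : Type*} [CommRing R] [AddCommGroup V] [Module R V] [AddCommGroup W]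
    [Module R W] (A : VertexOperator R V) (n : ℤ) :
    mode (leftField (W := W) A) n = (mode A n).rTensor W := by
  simp [leftField]

@[simp]
theorem mode_rightField {R V W : Type*} [CommRing R] [AddCommGroup V] [Module R V] [AddCommGroup W]
    [Module R W] (A : VertexOperator R W) (n : ℤ) :
    mode (rightField (V := V) A) n = (mode A n).lTensor V := by
  simp [rightField]

/-- The operator `A` on `V_{√2ℤ}` over `ℂ(b)` is the extension of an operator over `ℂ`. -/
def IsExtension (A : Module.End K (LatVOA K)) (A' : Module.End ℂ (LatVOA ℂ)) : Prop :=
  ∀ v, A (mapLat RatFunc.C v) = mapLat RatFunc.C (A' v)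

theorem isExtension_mul {A B : Module.End K (LatVOA K)} {A' B' : Module.End ℂ (LatVOA ℂ)}
    (hA : IsExtension A A') (hB : IsExtension B B') : IsExtension (A * B) (A' * B') := fun v => by
  rw [Module.End.mul_apply, hB, hA]
  rfl

theorem isExtension_exp (m n : ℤ) : IsExtension (mode (expField K m) n) (mode (expField ℂ m) n) :=
  fun v => (intertwines_mapLat_exp RatFunc.C m n v).symm

theorem isExtension_heis (n : ℤ) : IsExtension (mode (heisField K) n) (mode (heisField ℂ) n) :=
  fun v => (intertwines_mapLat_heis RatFunc.C n v).symm

/-- The embedding of `V_{√2ℤ}` over `ℂ` into `Vir^b ⊗ V_{√2ℤ}`. -/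
def latEmbed (v : LatVOA ℂ) : Fam := virVacuum K centralCharge ⊗ₜ[K] mapLat RatFunc.C v

theorem latEmbed_vacuum : latEmbed (latVacuum ℂ) = famVacuum := by
  rw [latEmbed, latVacuum, mapLat_single, map_one]
  rfl

theorem lTensor_latEmbed {A : Module.End K (LatVOA K)} {A' : Module.End ℂ (LatVOA ℂ)}
    (hA : IsExtension A A') (v : LatVOA ℂ) : A.lTensor _ (latEmbed v) = latEmbed (A' v) := by
  rw [latEmbed, LinearMap.lTensor_tmul, hA, latEmbed]

theorem latEmbed_add (v w : LatVOA ℂ) : latEmbed (v + w) = latEmbed v + latEmbed w := by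
  rw [latEmbed, map_add, TensorProduct.tmul_add]
  rfl

theorem latEmbed_smul (c : ℂ) (v : LatVOA ℂ) : latEmbed (c • v) = constHom c • latEmbed v := by
  rw [latEmbed, mapLat_smul, TensorProduct.tmul_smul]
  rfl

theorem famE_mem : famE ∈ integralGens := Or.inr (Or.inl rfl)
theorem famH_mem : famH ∈ integralGens := Or.inr (Or.inr (Or.inl rfl))
theorem famF_mem : famF ∈ integralGens := Or.inr (Or.inr (Or.inr rfl))
theorem famT_mem : b⁻¹ ^ 2 • Tb ∈ integralGens := Or.inl rfl

theorem latEmbed_single_mem (m : ℤ) : latEmbed (Finsupp.single m 1) ∈ integralForm := by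
  induction m using Int.induction_on with
  | zero => exact latEmbed_vacuum ▸ famVacuum_mem
  | succ m ih =>
    -- This mode extracts the leading power z^{2m} of e(z)e^{m√2φ}, whose coefficient is exactly
    -- e^{(m+1)√2φ}; no division is needed.
    have h := preserves_gen famE_mem (-2 * m - 1) _ ih
    rw [famE, mode_rightField, eField, lTensor_latEmbed (isExtension_exp _ _), mode_expField_vac] at h
    rw [show -(-2 * (m : ℤ) - 1) - 1 - 2 * 1 * m = 0 by ring, creationCoeff_zero, add_comm] at h
    exact h
  | pred m ih =>
    have h := preserves_gen famF_mem (2 * (-m) - 1) _ ih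
    rw [famF, mode_rightField, fField, lTensor_latEmbed (isExtension_exp _ _), mode_expField_vac] at h
    rw [show -(2 * (-(m : ℤ)) - 1) - 1 - 2 * -1 * -m = 0 by ring, creationCoeff_zero, add_comm] at h
    exact h

theorem latEmbed_mem (v : LatVOA ℂ) : latEmbed v ∈ integralForm := by
  let N : Submodule ℂ (LatVOA ℂ) :=
    { carrier := {v | latEmbed v ∈ integralForm}
      add_mem' := fun {v w} hv hw => by
        rw [Set.mem_ofPred_eq, latEmbed_add]
        exact integralForm.add_mem hv hw
      zero_mem' := by
        rw [Set.mem_ofPred_eq, latEmbed, map_zero, TensorProduct.tmul_zero]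
        exact integralForm.zero_mem
      smul_mem' := fun c v hv => by
        rw [Set.mem_ofPred_eq, latEmbed_smul]
        exact integralForm.smul_mem _ hv }
  have hN : N = ⊤ := by
    refine lat_submodule_eq_top N latEmbed_single_mem fun j v hv => ?_
    have h := preserves_gen famH_mem (-j - 1) _ hv
    rwa [famH, mode_rightField, lTensor_latEmbed (isExtension_heis _), mode_heisField] at h
  have : v ∈ N := hN ▸ Submodule.mem_top
  exact this

theorem commute_rTensor_lTensor {R V W : Type*} [CommRing R] [AddCommGroup V] [Module R V]
    [AddCommGroup W] [Module R W] (A : Module.End R V) (B : Module.End R W) (x : V ⊗[R] W) :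
    A.rTensor W (B.lTensor V x) = B.lTensor V (A.rTensor W x) := by
  rw [← LinearMap.comp_apply, ← LinearMap.comp_apply, LinearMap.rTensor_comp_lTensor,
    LinearMap.lTensor_comp_rTensor]

/-- Any operator defined over ℂ on the lattice factor preserves the integral form. The induction
works because the condition is imposed for all such operators at once: lattice generators can be
absorbed into A, and T^b commutes with it. -/
theorem preserves_lTensor {A : Module.End K (LatVOA K)} {A' : Module.End ℂ (LatVOA ℂ)}
    (hA : IsExtension A A') : Preserves (A.lTensor (VirVac K centralCharge)) := by
  let N : Submodule O Fam :=
    { carrier := {x | ∀ A A', IsExtension A A' → A.lTensor (VirVac K centralCharge) x ∈ integralForm}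
      add_mem' := fun {x y} hx hy A A' hA => by
        rw [map_add]
        exact integralForm.add_mem (hx A A' hA) (hy A A' hA)
      zero_mem' := fun A A' hA => by
        rw [map_zero]
        exact integralForm.zero_mem
      smul_mem' := fun r x hx A A' hA => by
        have : A.lTensor (VirVac K centralCharge) (r • x) =
          r • A.lTensor (VirVac K centralCharge) x := map_smul _ (r : K) x
        rw [this]
        exact integralForm.smul_mem r (hx A A' hA) }
  have hN : integralForm ≤ N := by
    refine integralForm_le (fun A A' hA => ?_) fun G hG n x hx hxN A A' hA => ?_
    · rw [← latEmbed_vacuum, lTensor_latEmbed hA]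
      exact latEmbed_mem _
    · have hext : ∀ (B : Module.End K (LatVOA K)) (B' : Module.End ℂ (LatVOA ℂ)), IsExtension B B' →
          A.lTensor (VirVac K centralCharge) (B.lTensor (VirVac K centralCharge) x) ∈ integralForm :=
        fun B B' hB => by
        rw [← LinearMap.lTensor_comp_apply]
        exact hxN _ _ (isExtension_mul hA hB)
      rcases hG with rfl | rfl | rfl | rfl
      · have h := preserves_gen famT_mem n _ (hxN A A' hA)
        rw [mode_smul, LinearMap.smul_apply, Tb, mode_leftField] at h ⊢
        rw [map_smul, ← commute_rTensor_lTensor]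
        exact h
      · rw [famE, mode_rightField]
        exact hext _ _ (isExtension_exp _ _)
      · rw [famH, mode_rightField]
        exact hext _ _ (isExtension_heis _)
      · rw [famF, mode_rightField]
        exact hext _ _ (isExtension_exp _ _)
  exact fun x hx => hN hx A A' hA

theorem vir_submodule_eq_top {F : Type*} [Field F] {c : F} (N : Submodule F (VirVac F c))
    (h0 : virVacuum F c ∈ N) (hs : ∀ n, ∀ x ∈ N, virL F c n x ∈ N) : N = ⊤ := by
  refine eq_top_iff.2 fun x _ => ?_
  have key : ∀ a : FreeAlgebra F ℤ, ∀ y ∈ N, RingQuot.mkAlgHom F (VirRel F c) a • y ∈ N := by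
    intro a
    induction a using FreeAlgebra.induction with
    | grade0 r =>
      intro y hy
      rw [AlgHom.commutes, algebraMap_smul]
      exact N.smul_mem r hy
    | grade1 k => exact fun y hy => hs k y hy
    | mul a b ha hb =>
      intro y hy
      rw [map_mul, mul_smul]
      exact ha _ (hb y hy)
    | add a b ha hb =>
      intro y hy
      rw [map_add, add_smul]
      exact N.add_mem (ha y hy) (hb y hy)
  obtain ⟨u, rfl⟩ := virVacuum_generates c x
  obtain ⟨a, rfl⟩ := RingQuot.mkAlgHom_surjective F (VirRel F c) u
  exact key a _ h0

theorem mode_mem_span_integralForm {A : VertexOperator K Fam} (hA : A ∈ integralGens) (n : ℤ) {x : Fam}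
    (hx : x ∈ Submodule.span K (integralForm : Set Fam)) :
    mode A n x ∈ Submodule.span K (integralForm : Set Fam) := by
  induction hx using Submodule.span_induction with
  | mem x hx => exact Submodule.subset_span (preserves_gen hA n x hx)
  | zero => rw [map_zero]; exact Submodule.zero_mem _
  | add x y _ _ hx hy => rw [map_add]; exact Submodule.add_mem _ hx hy
  | smul r x _ hx => rw [map_smul]; exact Submodule.smul_mem _ _ hx

/-- Over ℂ(b) the factor b⁻² is invertible, so the span is stable under T^b itself as well as under
the lattice modes. -/
theorem span_integralForm : Submodule.span K (integralForm : Set Fam) = ⊤ := by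
  set N := Submodule.span K (integralForm : Set Fam) with hNdef
  have h1 : ∀ w : LatVOA K, virVacuum K centralCharge ⊗ₜ[K] w ∈ N := by
    intro w
    have hN : N.comap (TensorProduct.mk K _ _ (virVacuum K centralCharge)) = ⊤ := by
      refine lat_submodule_eq_top _ (fun m => ?_) fun j w hw => ?_
      · have := latEmbed_single_mem m
        rw [latEmbed, mapLat_single, map_one] at this
        exact Submodule.subset_span this
      · have := mode_mem_span_integralForm famH_mem (-j - 1) hw
        rwa [famH, mode_rightField, mode_heisField] at this
    have : w ∈ N.comap (TensorProduct.mk K _ _ (virVacuum K centralCharge)) := hN ▸ Submodule.mem_top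
    exact this
  have h2 : ∀ (u : VirVac K centralCharge) (w : LatVOA K), u ⊗ₜ[K] w ∈ N := by
    intro u w
    have hN : N.comap ((TensorProduct.mk K (VirVac K centralCharge) (LatVOA K)).flip w) = ⊤ := by
      refine vir_submodule_eq_top _ (h1 w) fun n x hx => ?_
      have := N.smul_mem (b ^ 2) (mode_mem_span_integralForm famT_mem (n + 1) hx)
      rw [mode_smul, LinearMap.smul_apply, smul_smul, ← mul_pow, mul_inv_cancel₀ b_ne_zero, one_pow,
        one_smul, Tb, mode_leftField, virField, mode_ofModes, add_sub_cancel_right] at this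
      exact this
    have : u ∈ N.comap ((TensorProduct.mk K (VirVac K centralCharge) (LatVOA K)).flip w) :=
      hN ▸ Submodule.mem_top
    exact this
  refine eq_top_iff.2 fun x _ => ?_
  induction x using TensorProduct.induction_on with
  | zero => exact N.zero_mem
  | tmul u w => exact h2 u w
  | add x y hx hy => exact N.add_mem (hx trivial) (hy trivial)

end Family

end Urod

namespace Urod

section Coefficients

/-- The rational function `a` is regular at `b = ∞` with value `c`. -/
def HasRed (a : K) (c : ℂ) : Prop := ∃ r : O, (r : K) = a ∧ red r = c

namespace HasRed

variable {a a' : K} {c c' : ℂ}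

theorem bInv : HasRed b⁻¹ 0 := ⟨_, rfl, red_bInv⟩

theorem const (c : ℂ) : HasRed (RatFunc.C c) c := ⟨_, rfl, red_constHom c⟩

theorem one : HasRed 1 1 := ⟨1, rfl, map_one _⟩

theorem intCast (n : ℤ) : HasRed n n := ⟨n, by simp, by simp⟩

theorem ofNat (n : ℕ) [n.AtLeastTwo] : HasRed (OfNat.ofNat n) (OfNat.ofNat n) := by
  have := intCast (OfNat.ofNat n)
  simpa using this

theorem add (h : HasRed a c) (h' : HasRed a' c') : HasRed (a + a') (c + c') := by
  obtain ⟨r, rfl, rfl⟩ := h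
  obtain ⟨r', rfl, rfl⟩ := h'
  exact ⟨r + r', rfl, map_add _ _ _⟩

theorem neg (h : HasRed a c) : HasRed (-a) (-c) := by
  obtain ⟨r, rfl, rfl⟩ := h
  exact ⟨-r, rfl, map_neg _ _⟩

theorem sub (h : HasRed a c) (h' : HasRed a' c') : HasRed (a - a') (c - c') := by
  obtain ⟨r, rfl, rfl⟩ := h
  obtain ⟨r', rfl, rfl⟩ := h'
  exact ⟨r - r', rfl, map_sub _ _ _⟩

theorem mul (h : HasRed a c) (h' : HasRed a' c') : HasRed (a * a') (c * c') := by
  obtain ⟨r, rfl, rfl⟩ := h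
  obtain ⟨r', rfl, rfl⟩ := h'
  exact ⟨r * r', rfl, map_mul _ _ _⟩

theorem pow (h : HasRed a c) (n : ℕ) : HasRed (a ^ n) (c ^ n) := by
  obtain ⟨r, rfl, rfl⟩ := h
  exact ⟨r ^ n, rfl, map_pow _ _ _⟩

theorem inv (h : HasRed a c) (hc : c ≠ 0) : HasRed a⁻¹ c⁻¹ := by
  obtain ⟨r, rfl, rfl⟩ := h
  exact exists_inv_of_red_ne_zero hc

theorem div (h : HasRed a c) (h' : HasRed a' c') (hc : c' ≠ 0) : HasRed (a / a') (c / c') := by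
  rw [div_eq_mul_inv, div_eq_mul_inv]
  exact h.mul (h'.inv hc)

theorem congr (h : HasRed a c) (ha : a = a') (hc : c = c') : HasRed a' c' := ha ▸ hc ▸ h

end HasRed

end Coefficients

/-! ### The commuting operators ℓₙ and the spanning map from V-valued functions -/

section CentralOperators

theorem HasLim.unique {D : Module.End K Fam} {D' D'' : Module.End ℂ Limit} (h : HasLim D D')
    (h' : HasLim D D'') : D' = D'' := h.2.symm.trans h'.2

theorem virGen_lie {F : Type*} [Field F] (c : F) (m n : ℤ) : ⁅virL F c m, virL F c n⁆ =
    ((m - n : ℤ) : F) • virL F c (m + n) +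
      (if m + n = 0 then c / 12 * ((m : F) ^ 3 - (m : F)) else 0) • (1 : Module.End F (VirVac F c)) := by
  rw [virL, virL, Ring.lie_def, ← map_mul, ← map_mul, virGen_comm, map_add, map_add, map_smul, virL]
  rw [AlgHom.commutes, Algebra.algebraMap_eq_smul_one]
  abel

theorem Lb_eq (n : ℤ) : Lb n = (virL K centralCharge n).rTensor (LatVOA K) := by
  rw [Lb, Tb, mode_leftField, virField, mode_ofModes, add_sub_cancel_right]

theorem lie_Lb (m n : ℤ) : ⁅Lb m, Lb n⁆ = ((m - n : ℤ) : K) • Lb (m + n) +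
    (if m + n = 0 then centralCharge / 12 * ((m : K) ^ 3 - (m : K)) else 0) •
      (1 : Module.End K Fam) := by
  rw [Lb_eq, Lb_eq, Lb_eq, Ring.lie_def, ← LinearMap.rTensor_mul, ← LinearMap.rTensor_mul,
    ← LinearMap.rTensor_sub, ← Ring.lie_def, virGen_lie, LinearMap.rTensor_add, LinearMap.rTensor_smul,
    LinearMap.rTensor_smul, Module.End.one_eq_id, LinearMap.rTensor_id]
  rfl

theorem lie_rTensor_lTensor {R V W : Type*} [CommRing R] [AddCommGroup V] [Module R V]
    [AddCommGroup W] [Module R W] (A : Module.End R V) (B : Module.End R W) :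
    ⁅A.rTensor W, B.lTensor V⁆ = 0 := by
  refine LinearMap.ext fun x => ?_
  rw [lie_apply_end, commute_rTensor_lTensor, sub_self]
  rfl

/-- The limit of `b⁻² Lₙ^(b)`. -/
def el (n : ℤ) : Module.End ℂ Limit := limitOp (b⁻¹ ^ 2 • Lb n)

theorem hasLim_el (n : ℤ) : HasLim (b⁻¹ ^ 2 • Lb n) (el n) := by
  have := preserves_gen famT_mem (n + 1)
  rw [mode_smul] at this
  exact this.hasLim

/-- The limit of `b⁻² T^b(z)`. -/
def elField : VertexOperator ℂ Limit := limitField (b⁻¹ ^ 2 • Tb)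

theorem mode_elField (n : ℤ) : mode elField n = el (n - 1) := by
  rw [elField, limitField, mode_ofModes, mode_smul, el, Lb, sub_add_cancel]

/-- In b⁻⁴[Lₘ, Lₙ] the linear term is b⁻²(m-n) times b⁻²Lₘ₊ₙ, and the central term is b⁻⁴c/12 times
a constant. Both vanish at infinity, as c is of order b². -/
theorem lie_el_el (m n : ℤ) : ⁅el m, el n⁆ = 0 := by
  have h1 := (hasLim_el m).lie (hasLim_el n)
  have hc : HasRed (b⁻¹ ^ 4 * centralCharge / 12) 0 := by
    have e : b⁻¹ ^ 4 * centralCharge / 12 = (b⁻¹ ^ 4 + 6 * b⁻¹ ^ 2 * (b⁻¹ ^ 2 + 1) ^ 2) / 12 := by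
      rw [centralCharge]
      have := b_ne_zero
      field_simp
    rw [e]
    exact (((HasRed.bInv.pow 4).add (((HasRed.ofNat 6).mul (HasRed.bInv.pow 2)).mul
      (((HasRed.bInv.pow 2).add HasRed.one).pow 2))).div (HasRed.ofNat 12) (by norm_num)).congr rfl
      (by norm_num)
  have h2 : HasLim ⁅b⁻¹ ^ 2 • Lb m, b⁻¹ ^ 2 • Lb n⁆ 0 := by
    have h3 := (HasLim.smul' ((HasRed.bInv.pow 2).mul (HasRed.intCast (m - n))) (hasLim_el (m + n))).add
      (HasLim.smul' (hc.mul (HasRed.intCast (if m + n = 0 then m ^ 3 - m else 0))) HasLim.one)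
    refine HasLim.congr h3 ?_ ?_
    · rw [smul_lie_end, lie_smul_end, lie_Lb]
      rw [smul_add, smul_add, smul_smul, smul_smul, smul_smul, smul_smul, smul_smul]
      congr 2
      · ring
      · split_ifs
        · push_cast; ring
        · push_cast; ring
    · rw [zero_pow two_ne_zero, zero_mul, zero_smul, zero_mul, zero_smul, add_zero]
  exact h1.unique h2

/-- The limit of an operator on the second factor. -/
def latLim (A : Module.End K (LatVOA K)) : Module.End ℂ Limit :=
  limitOp (A.lTensor (VirVac K centralCharge))

theorem hasLim_latLim {A : Module.End K (LatVOA K)} {A' : Module.End ℂ (LatVOA ℂ)}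
    (hA : IsExtension A A') : HasLim (A.lTensor (VirVac K centralCharge)) (latLim A) :=
  (preserves_lTensor hA).hasLim

theorem lie_el_latLim {A : Module.End K (LatVOA K)} {A' : Module.End ℂ (LatVOA ℂ)}
    (hA : IsExtension A A') (n : ℤ) : ⁅el n, latLim A⁆ = 0 := by
  have h1 := (hasLim_el n).lie (hasLim_latLim hA)
  refine h1.unique (HasLim.zero.congr ?_ rfl)
  rw [smul_lie_end, Lb_eq, lie_rTensor_lTensor, smul_zero]

/-- The embedding of `V_{√2ℤ}` into the limit. -/
def latSection : LatVOA ℂ →ₗ[ℂ] Limit where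
  toFun v := toLimit ⟨latEmbed v, latEmbed_mem v⟩
  map_add' v w := by
    rw [← map_add]
    exact congrArg toLimit (Subtype.ext (latEmbed_add v w))
  map_smul' c v := by
    have h := toLimit_smul (constHom c) ⟨latEmbed v, latEmbed_mem v⟩
    rw [red_constHom] at h
    refine Eq.trans ?_ h
    exact congrArg toLimit (Subtype.ext (latEmbed_smul c v))

theorem latSection_vacuum : latSection (latVacuum ℂ) = limitVacuum :=
  congrArg toLimit (Subtype.ext latEmbed_vacuum)

theorem latLim_latSection {A : Module.End K (LatVOA K)} {A' : Module.End ℂ (LatVOA ℂ)}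
    (hA : IsExtension A A') (v : LatVOA ℂ) : latLim A (latSection v) = latSection (A' v) := by
  obtain ⟨h, h'⟩ := hasLim_iff.1 (hasLim_latLim hA)
  exact (h' _).trans (congrArg toLimit (Subtype.ext (lTensor_latEmbed hA v)))

/-- The limit is generated from its vacuum by the ℓₙ and the lattice operators. The proof pulls N
back to the integral form and uses the induction principle there. -/
theorem limit_submodule_eq_top (N : Submodule ℂ Limit) (h0 : limitVacuum ∈ N)
    (hl : ∀ n, ∀ x ∈ N, el n x ∈ N)
    (hA : ∀ A A', IsExtension A A' → ∀ x ∈ N, latLim A x ∈ N) : N = ⊤ := by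
  let N' : Submodule O Fam :=
    { carrier := {x | ∃ h : x ∈ integralForm, toLimit ⟨x, h⟩ ∈ N}
      add_mem' := by
        rintro x y ⟨h, hx⟩ ⟨h', hy⟩
        exact ⟨integralForm.add_mem h h', N.add_mem hx hy⟩
      zero_mem' := ⟨integralForm.zero_mem, N.zero_mem⟩
      smul_mem' := by
        rintro r x ⟨h, hx⟩
        refine ⟨integralForm.smul_mem r h, ?_⟩
        have := N.smul_mem (red r) hx
        rw [← toLimit_smul] at this
        exact this }
  have hstep : ∀ {D : Module.End K Fam} {D' : Module.End ℂ Limit}, HasLim D D' →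
      (∀ x ∈ N, D' x ∈ N) → ∀ x ∈ N', D x ∈ N' := by
    rintro D D' hD hN x ⟨h, hx⟩
    obtain ⟨k, k'⟩ := hasLim_iff.1 hD
    refine ⟨k x h, ?_⟩
    have := hN _ hx
    rw [k'] at this
    exact this
  have hle : integralForm ≤ N' := by
    refine integralForm_le ⟨famVacuum_mem, h0⟩ fun G hG n x _ hx => ?_
    rcases hG with rfl | rfl | rfl | rfl
    · have := hstep (hasLim_el (n - 1)) (hl _) x hx
      rwa [Lb, sub_add_cancel, ← mode_smul] at this
    · rw [famE, mode_rightField]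
      exact hstep (hasLim_latLim (isExtension_exp _ _)) (hA _ _ (isExtension_exp _ _)) x hx
    · rw [famH, mode_rightField]
      exact hstep (hasLim_latLim (isExtension_heis _)) (hA _ _ (isExtension_heis _)) x hx
    · rw [famF, mode_rightField]
      exact hstep (hasLim_latLim (isExtension_exp _ _)) (hA _ _ (isExtension_exp _ _)) x hx
  refine eq_top_iff.2 fun y _ => ?_
  obtain ⟨x, rfl⟩ := toLimit_surjective y
  exact (hle x.2).2

theorem el_apply_comm (m n : ℤ) (x : Limit) : el m (el n x) = el n (el m x) := by
  have := congrArg (fun D => D x) (lie_el_el m n)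
  simpa [lie_apply_end, sub_eq_zero] using this

theorem el_latLim_comm {A : Module.End K (LatVOA K)} {A' : Module.End ℂ (LatVOA ℂ)}
    (hA : IsExtension A A') (n : ℤ) (x : Limit) : el n (latLim A x) = latLim A (el n x) := by
  have := congrArg (fun D => D x) (lie_el_latLim hA n)
  simpa [lie_apply_end, sub_eq_zero] using this

/-- The kernel contains the vacuum and is stable under everything that generates the limit, because
`el n` commutes with all of it. -/
theorem el_eq_zero {n : ℤ} (hn : -1 ≤ n) : el n = 0 := by
  have hN : LinearMap.ker (el n) = ⊤ := by
    refine limit_submodule_eq_top _ ?_ (fun m x hx => ?_) (fun A A' hA x hx => ?_)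
    · obtain ⟨h, h'⟩ := hasLim_iff.1 (hasLim_el n)
      rw [LinearMap.mem_ker, limitVacuum, h', ← map_zero toLimit]
      refine congrArg toLimit (Subtype.ext ?_)
      change (b⁻¹ ^ 2 • Lb n) famVacuum = 0
      rw [LinearMap.smul_apply, Lb_eq, famVacuum, LinearMap.rTensor_tmul, virL_apply,
        virGen_smul_vacuum _ _ hn, TensorProduct.zero_tmul, smul_zero]
    · rw [LinearMap.mem_ker] at hx ⊢
      rw [el_apply_comm, hx, map_zero]
    · rw [LinearMap.mem_ker] at hx ⊢
      rw [el_latLim_comm hA, hx, map_zero]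
  exact LinearMap.ker_eq_top.1 hN

/-- The coordinate operators `ℓ₋ₖ₋₂` generate a commutative algebra. -/
abbrev elAlgebra : Subalgebra ℂ (Module.End ℂ Limit) :=
  Algebra.adjoin ℂ (Set.range fun k : ℕ => el (-k - 2))

theorem elAlgebra_comm : ∀ x ∈ Set.range (fun k : ℕ => el (-k - 2)),
    ∀ y ∈ Set.range (fun k : ℕ => el (-k - 2)), x * y = y * x := by
  rintro _ ⟨k, rfl⟩ _ ⟨l, rfl⟩
  exact LinearMap.ext fun x => el_apply_comm _ _ x

/-- The action of the functions on the space of Sturm-Liouville operators on the limit. -/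
def polyAct : MvPolynomial ℕ ℂ →ₐ[ℂ] Module.End ℂ Limit :=
  -- Evaluation of polynomials needs a commutative target, so it is performed in the subalgebra
  -- generated by the commuting ℓ₋ₖ₋₂ and then included into all endomorphisms.
  letI : CommRing elAlgebra :=
    { (inferInstance : Ring elAlgebra) with
      mul_comm := (Algebra.isMulCommutative_adjoin ℂ elAlgebra_comm).is_comm.comm }
  elAlgebra.val.comp (MvPolynomial.aeval fun k : ℕ =>
    (⟨el (-k - 2), Algebra.subset_adjoin ⟨k, rfl⟩⟩ : elAlgebra))

theorem polyAct_X (k : ℕ) : polyAct (MvPolynomial.X k) = el (-k - 2) := by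
  simp [polyAct]

theorem polyAct_induction {p : Module.End ℂ Limit → Prop} (hC : ∀ c : ℂ, p (c • 1))
    (hadd : ∀ D E, p D → p E → p (D + E)) (hmul : ∀ D n, p D → p (D * el n)) (P : MvPolynomial ℕ ℂ) :
    p (polyAct P) := by
  induction P using MvPolynomial.induction_on with
  | C a =>
    rw [← mul_one (MvPolynomial.C a), ← MvPolynomial.smul_eq_C_mul, map_smul, map_one]
    exact hC a
  | add P Q hP hQ => rw [map_add]; exact hadd _ _ hP hQ
  | mul_X P k hP => rw [map_mul, polyAct_X]; exact hmul _ _ hP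

theorem commute_polyAct {D : Module.End ℂ Limit} (hD : ∀ n x, el n (D x) = D (el n x))
    (P : MvPolynomial ℕ ℂ) : ∀ x, polyAct P (D x) = D (polyAct P x) := by
  refine polyAct_induction (p := fun E => ∀ x, E (D x) = D (E x)) ?_ ?_ ?_ P
  · intro c x
    simp
  · intro E E' hE hE' x
    simp [hE, hE']
  · intro E n hE x
    rw [Module.End.mul_apply, Module.End.mul_apply, hD, hE]

/-- The map `p ⊗ v ↦ p(ℓ) v`. -/
def limitSection : MvPolynomial ℕ ℂ ⊗[ℂ] LatVOA ℂ →ₗ[ℂ] Limit :=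
  TensorProduct.lift ((LinearMap.lcomp ℂ Limit latSection).comp polyAct.toLinearMap)

@[simp]
theorem limitSection_tmul (P : MvPolynomial ℕ ℂ) (v : LatVOA ℂ) :
    limitSection (P ⊗ₜ[ℂ] v) = polyAct P (latSection v) := by
  simp [limitSection]

theorem limitSection_latLim {A : Module.End K (LatVOA K)} {A' : Module.End ℂ (LatVOA ℂ)}
    (hA : IsExtension A A') (y : MvPolynomial ℕ ℂ ⊗[ℂ] LatVOA ℂ) :
    limitSection (A'.lTensor _ y) = latLim A (limitSection y) := by
  induction y using TensorProduct.induction_on with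
  | zero => simp
  | tmul P v =>
    rw [LinearMap.lTensor_tmul, limitSection_tmul, limitSection_tmul, ← latLim_latSection hA,
      commute_polyAct (el_latLim_comm hA)]
  | add x y hx hy => rw [map_add, map_add, hx, hy, map_add, map_add]

theorem limitSection_el (n : ℤ) (y : MvPolynomial ℕ ℂ ⊗[ℂ] LatVOA ℂ) :
    limitSection ((LinearMap.mulLeft ℂ (coord n)).rTensor (LatVOA ℂ) y) = el n (limitSection y) := by
  induction y using TensorProduct.induction_on with
  | zero => simp
  | tmul P v =>
    rw [LinearMap.rTensor_tmul, limitSection_tmul, limitSection_tmul, LinearMap.mulLeft_apply, map_mul,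
      coord]
    split_ifs with h
    · rw [polyAct_X, Module.End.mul_apply]
      congr 2
      omega
    · rw [map_zero, zero_mul, el_eq_zero (by omega)]
      rfl
  | add x y hx hy => rw [map_add, map_add, hx, hy, map_add, map_add]

theorem limitSection_vacuum : limitSection (1 ⊗ₜ[ℂ] latVacuum ℂ) = limitVacuum := by
  rw [limitSection_tmul, map_one, latSection_vacuum]
  rfl

theorem limitSection_surjective : Function.Surjective limitSection := by
  rw [← LinearMap.range_eq_top]
  refine limit_submodule_eq_top _ ⟨_, limitSection_vacuum⟩ ?_ ?_
  · rintro n _ ⟨y, rfl⟩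
    exact ⟨_, limitSection_el n y⟩
  · rintro A A' hA _ ⟨y, rfl⟩
    exact ⟨_, limitSection_latLim hA y⟩

end CentralOperators

end Urod

namespace Urod

/-! ### The rescaled free boson and the universal property of the vacuum module -/

section Fock

open MvPolynomial

variable {R S : Type*} [CommRing R] [CommRing S]

/-- The modes of the free boson with `[gₘ, gₙ] = 2 m κ δₘ,₋ₙ`. -/
def fockMode (κ : R) (n : ℤ) : Module.End R (MvPolynomial ℕ R) :=
  if n < 0 then LinearMap.mulLeft R (X (-n - 1).toNat)
  else (2 * (n : R) * κ) • (pderiv (n - 1).toNat).toLinearMap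

theorem fockMode_neg (κ : R) (j : ℕ) (P : MvPolynomial ℕ R) : fockMode κ (-j - 1) P = X j * P := by
  rw [fockMode, if_pos (by omega), LinearMap.mulLeft_apply]
  congr 2
  omega

theorem fockMode_zero (κ : R) : fockMode κ 0 = 0 := by
  rw [fockMode, if_neg (by omega), Int.cast_zero, mul_zero, zero_mul, zero_smul]

theorem fockMode_pos (κ : R) (j : ℕ) (P : MvPolynomial ℕ R) :
    fockMode κ (j + 1) P = C (2 * (j + 1) * κ) * pderiv j P := by
  rw [fockMode, if_neg (by omega), LinearMap.smul_apply, MvPolynomial.smul_eq_C_mul]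
  have : ((j : ℤ) + 1 - 1).toNat = j := by omega
  rw [this]
  push_cast
  rfl

/-- The field of the free boson. -/
def fockField (κ : R) : VertexOperator R (MvPolynomial ℕ R) :=
  ofModes (fockMode κ) (fun P => by
    refine ⟨P.vars.sup id + 2, fun n hn => ?_⟩
    have hv : (n - 1).toNat ∉ P.vars := fun hmem => by
      have h1 : (n - 1).toNat ≤ P.vars.sup id := Finset.le_sup (f := id) hmem
      omega
    rw [fockMode, if_neg (by omega), LinearMap.smul_apply]
    change _ • pderiv _ P = 0
    rw [pderiv_eq_zero_of_notMem_vars hv, smul_zero])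

@[simp]
theorem mode_fockField (κ : R) (n : ℤ) : mode (fockField κ) n = fockMode κ n := mode_ofModes _ _ n

theorem isHeisenberg_fockField (κ : R) : IsHeisenberg (fockField κ) κ := by
  intro m n
  rw [mode_fockField, mode_fockField]
  refine LinearMap.ext fun P => ?_
  rw [lie_apply_end]
  rcases int_trichotomy m with ⟨i, rfl⟩ | rfl | ⟨i, rfl⟩ <;>
  rcases int_trichotomy n with ⟨j, rfl⟩ | rfl | ⟨j, rfl⟩
  · rw [if_neg (by omega), zero_smul]
    simp only [fockMode_neg, LinearMap.zero_apply]
    ring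
  · simp only [fockMode_zero, LinearMap.zero_apply, map_zero, sub_self]
    split_ifs with h
    · omega
    · rw [zero_smul]; rfl
  · simp only [fockMode_neg, fockMode_pos, Derivation.leibniz, pderiv_X, smul_eq_mul]
    by_cases h : i = j
    · subst h
      rw [if_pos (by omega)]
      simp [MvPolynomial.smul_eq_C_mul]
      ring
    · rw [if_neg (by omega)]
      simp [h]
      ring
  · simp only [fockMode_zero, LinearMap.zero_apply, map_zero, sub_self]
    split_ifs with h
    · omega
    · rw [zero_smul]; rfl
  · simp only [fockMode_zero, LinearMap.zero_apply, map_zero, sub_self]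
    split_ifs with h
    · simp
    · rw [zero_smul]; rfl
  · simp only [fockMode_zero, LinearMap.zero_apply, map_zero, sub_self]
    split_ifs with h
    · omega
    · rw [zero_smul]; rfl
  · simp only [fockMode_neg, fockMode_pos, Derivation.leibniz, pderiv_X, smul_eq_mul]
    by_cases h : i = j
    · subst h
      rw [if_pos (by omega)]
      simp [MvPolynomial.smul_eq_C_mul]
      ring
    · rw [if_neg (by omega)]
      simp [Ne.symm h]
      ring
  · simp only [fockMode_zero, LinearMap.zero_apply, map_zero, sub_self]
    split_ifs with h
    · omega
    · rw [zero_smul]; rfl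
  · rw [if_neg (by omega), zero_smul]
    simp only [fockMode_pos, LinearMap.zero_apply, Derivation.leibniz, pderiv_C, smul_eq_mul]
    have hcomm : ⁅(pderiv i : Derivation R (MvPolynomial ℕ R) (MvPolynomial ℕ R)),
        (pderiv j : Derivation R (MvPolynomial ℕ R) (MvPolynomial ℕ R))⁆ = 0 := by
      refine MvPolynomial.derivation_ext (R := R) (σ := ℕ) fun l => ?_
      rw [Derivation.commutator_apply]
      classical
      simp only [pderiv_X, Pi.single_apply]
      split_ifs <;> simp
    have h2 := congrArg (fun d => d P) hcomm
    simp only [Derivation.commutator_apply, Derivation.zero_apply, sub_eq_zero] at h2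
    rw [h2]
    ring

/-- The operators `(1/4) :g g: + γ ∂g`, in modes. -/
def fockL (q κ γ : R) (n : ℤ) : Module.End R (MvPolynomial ℕ R) :=
  q • mode (normOrd (fockField κ) (fockField κ)) (n + 1) + (γ * (n + 1)) • fockMode κ n

variable (f : R →+* S)

theorem intertwines_map_fock (κ : R) :
    Intertwines (MvPolynomial.map f : MvPolynomial ℕ R →+* MvPolynomial ℕ S).toAddMonoidHom
      (fockField κ) (fockField (f κ)) := by
  intro n P
  rw [mode_fockField, mode_fockField]
  change MvPolynomial.map f (fockMode κ n P) = fockMode (f κ) n (MvPolynomial.map f P)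
  have h2 : f 2 = 2 := map_ofNat f 2
  rcases int_trichotomy n with ⟨j, rfl⟩ | rfl | ⟨j, rfl⟩
  · rw [fockMode_neg, fockMode_neg, map_mul, map_X]
  · simp [fockMode_zero]
  · rw [fockMode_pos, fockMode_pos, map_mul, map_C, pderiv_map]
    simp [h2]

theorem map_fockL (q κ γ : R) (n : ℤ) (P : MvPolynomial ℕ R) :
    MvPolynomial.map f (fockL q κ γ n P) = fockL (f q) (f κ) (f γ) n (MvPolynomial.map f P) := by
  have h1 := (intertwines_map_fock f κ).normOrd (intertwines_map_fock f κ) (n + 1) P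
  have h2 := intertwines_map_fock f κ n P
  rw [mode_fockField, mode_fockField] at h2
  simp only [RingHom.toAddMonoidHom_eq_coe, AddMonoidHom.coe_coe] at h1 h2
  simp only [fockL, LinearMap.add_apply, LinearMap.smul_apply, MvPolynomial.smul_eq_C_mul, map_add,
    map_mul, map_C, h1, h2, map_intCast, map_one]

/-- For n ≥ -1 at least one index in each quadratic term is nonnegative, so these terms kill the
constant 1. -/
theorem fockL_one (q κ γ : R) {n : ℤ} (hn : -1 ≤ n) : fockL q κ γ n 1 = 0 := by
  have hpos : ∀ i : ℤ, 0 ≤ i → fockMode κ i 1 = 0 := fun i hi => by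
    rw [fockMode, if_neg (by omega), LinearMap.smul_apply]
    change _ • pderiv _ 1 = 0
    rw [pderiv_one, smul_zero]
  have h1 : mode (normOrd (fockField κ) (fockField κ)) (n + 1) 1 = 0 := by
    rw [mode_normOrd_apply]
    refine finsum_eq_zero_of_forall_eq_zero fun i => ?_
    rw [ordTerm, mode_fockField, mode_fockField]
    split_ifs with h
    · rw [Module.End.mul_apply, hpos _ (by omega), map_zero]
    · rw [Module.End.mul_apply, hpos _ (by omega), map_zero]
  rw [fockL, LinearMap.add_apply, LinearMap.smul_apply, LinearMap.smul_apply, h1, smul_zero, zero_add]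
  -- The linear term at n = -1 contains the creation mode, but its coefficient n+1 vanishes.
  rcases hn.eq_or_lt with rfl | h
  · simp
  · rw [hpos n (by omega), smul_zero]

/-- At κ = 0 the boson is classical: all modes with nonnegative index vanish, and the operator is
multiplication by a quadratic polynomial with a linear correction. For suitable q and γ this is the
Miura polynomial. -/
theorem fockL_zero_neg (q γ : R) (k : ℕ) (P : MvPolynomial ℕ R) :
    fockL q 0 γ (-k - 2) P = (C q * (∑ a ∈ Finset.range (k + 1), X a * X (k - a)) -
      C (γ * (k + 1)) * X (k + 1)) * P := by
  have hpos : ∀ i : ℤ, 0 ≤ i → fockMode (0 : R) i = 0 := fun i hi => by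
    rw [fockMode, if_neg (by omega), mul_zero, zero_smul]
  have h1 : mode (normOrd (fockField (0 : R)) (fockField 0)) (-k - 2 + 1) P =
      (∑ a ∈ Finset.range (k + 1), X a * X (k - a)) * P := by
    rw [mode_normOrd_apply, finsum_eq_sum_of_support_subset
      (s := (Finset.range (k + 1)).image fun a : ℕ => (-a - 1 : ℤ))]
    · rw [Finset.sum_image (fun a _ b _ h => by simpa using h), Finset.sum_mul]
      refine Finset.sum_congr rfl fun a ha => ?_
      have ha' := Finset.mem_range.1 ha
      rw [ordTerm, if_pos (by omega), Module.End.mul_apply, mode_fockField, mode_fockField,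
        fockMode_neg, show (-k - 2 + 1 - 1 - (-a - 1) : ℤ) = -((k - a : ℕ) : ℤ) - 1 by omega,
        fockMode_neg, mul_assoc]
    · intro i hi
      rw [Function.mem_support, ordTerm, mode_fockField, mode_fockField] at hi
      split_ifs at hi with h
      · by_cases h' : 0 ≤ -k - 2 + 1 - 1 - i
        · rw [hpos _ h', mul_zero] at hi
          exact absurd rfl hi
        · simp only [Finset.coe_image, Set.mem_image, Finset.coe_range, Set.mem_Iio]
          exact ⟨(-i - 1).toNat, by omega, by omega⟩
      · rw [hpos i (by omega), mul_zero] at hi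
        exact absurd rfl hi
  rw [fockL, LinearMap.add_apply, LinearMap.smul_apply, LinearMap.smul_apply, h1]
  have := fockMode_neg (0 : R) (k + 1) P
  rw [show -((k + 1 : ℕ) : ℤ) - 1 = -k - 2 by push_cast; ring] at this
  rw [this, MvPolynomial.smul_eq_C_mul, MvPolynomial.smul_eq_C_mul]
  push_cast
  rw [show γ * (-(k : R) - 2 + 1) = -(γ * (k + 1)) by ring, map_neg]
  ring

/-- The background charge is a linear modification of the Sugawara operators. It changes the central
term by -2κγ²(m³-m) and keeps the form of the bracket. -/
theorem lie_fockL {F : Type*} [Field F] [CharZero F] (κ γ : F) (m n : ℤ) :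
    ⁅fockL (1 / 4) κ γ m, fockL (1 / 4) κ γ n⁆ = (((m : F) - n) * κ) • fockL (1 / 4) κ γ (m + n) +
      (if m + n = 0 then (κ ^ 2 / 12 - 2 * κ * γ ^ 2) * ((m : F) ^ 3 - m) else 0) •
        (1 : Module.End F (MvPolynomial ℕ F)) := by
  have hh := isHeisenberg_fockField κ
  have e : ∀ k : ℤ, fockL (1 / 4) κ γ k = sugawara (fockField κ) k + (γ * (k + 1)) •
      mode (fockField κ) k := fun k => by rw [mode_fockField]; rfl
  have hs := lie_sugawara_heis hh n m
  rw [e, e, e, add_lie_end, lie_add_end, lie_add_end, lie_sugawara_sugawara hh, lie_smul_end,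
    lie_sugawara_heis hh, smul_lie_end, lie_swap_end, hs, smul_lie_end, lie_smul_end, hh, add_comm n m]
  split_ifs with h
  · obtain rfl : n = -m := by omega
    push_cast
    module
  · push_cast
    module

end Fock

section VacuumModule

variable {F M : Type*} [Field F] [AddCommGroup M] [Module F M]

/-- The universal property of the vacuum module: a Virasoro action lifts to the enveloping algebra,
and acting on v kills the left ideal generated by Lₙ, n ≥ -1. -/
theorem exists_virVac_hom (c : F) (L : ℤ → Module.End F M)
    (hL : ∀ m n, ⁅L m, L n⁆ = ((m - n : ℤ) : F) • L (m + n) +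
      (if m + n = 0 then c / 12 * ((m : F) ^ 3 - (m : F)) else 0) • (1 : Module.End F M))
    (v : M) (hv : ∀ n, -1 ≤ n → L n v = 0) :
    ∃ ρ : VirVac F c →ₗ[F] M, ρ (virVacuum F c) = v ∧ ∀ n x, ρ (virL F c n x) = L n (ρ x) := by
  let Λ : VirAlg F c →ₐ[F] Module.End F M :=
    RingQuot.liftAlgHom F ⟨FreeAlgebra.lift F L, by
      rintro _ _ ⟨m, n⟩
      have := hL m n
      rw [Ring.lie_def, sub_eq_iff_eq_add'] at this
      simp only [map_mul, map_add, map_smul, AlgHom.commutes, FreeAlgebra.lift_ι_apply]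
      rw [this, Algebra.algebraMap_eq_smul_one, add_assoc]⟩
  have hΛ : ∀ n, Λ (virGen F c n) = L n := fun n => by
    rw [virGen, RingQuot.liftAlgHom_mkAlgHom_apply, FreeAlgebra.lift_ι_apply]
  let ρ₀ : VirAlg F c →ₗ[F] M := (LinearMap.applyₗ v).comp Λ.toLinearMap
  have hρ₀ : ∀ u, ρ₀ u = Λ u v := fun u => rfl
  let I : Ideal (VirAlg F c) := Ideal.span {x | ∃ n : ℤ, -1 ≤ n ∧ x = virGen F c n}
  have hI : ∀ u ∈ I, ρ₀ u = 0 := by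
    intro u hu
    induction hu using Submodule.span_induction with
    | mem u hu =>
      obtain ⟨n, hn, rfl⟩ := hu
      rw [hρ₀, hΛ, hv n hn]
    | zero => exact map_zero _
    | add x y _ _ hx hy => rw [map_add, hx, hy, add_zero]
    | smul a x _ hx =>
      rw [hρ₀] at hx ⊢
      rw [smul_eq_mul, map_mul, Module.End.mul_apply, hx, map_zero]
  let ρ : (VirAlg F c ⧸ I.restrictScalars F) →ₗ[F] M := (I.restrictScalars F).liftQ ρ₀ hI
  let ρ' : VirVac F c →ₗ[F] M :=
    { toFun := ρ
      map_add' := fun x y => map_add ρ x y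
      map_smul' := fun r x => by
        obtain ⟨x, rfl⟩ := Submodule.Quotient.mk_surjective _ x
        exact map_smul ρ₀ r x }
  have hmk : ∀ u : VirAlg F c, ρ' (u • virVacuum F c) = ρ₀ u := fun u => by
    change ρ (Submodule.Quotient.mk (u * 1)) = _
    rw [mul_one]
    rfl
  refine ⟨ρ', ?_, fun n x => ?_⟩
  · have := hmk 1
    rwa [one_smul, hρ₀, map_one] at this
  · obtain ⟨u, rfl⟩ := virVacuum_generates c x
    rw [virL_apply, ← mul_smul, hmk, hmk, hρ₀, hρ₀, map_mul, hΛ, Module.End.mul_apply]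

end VacuumModule

end Urod

namespace Urod

/-! ### The Miura transformation and the Riccati equation -/

section Miura

open MvPolynomial

/-- The coefficient of `zᵏ` in the Sturm-Liouville potential `(1/4) g² - (i/2) ∂g`, where
`g(z) = ∑ₐ Xₐ zᵃ`. -/
def miuraCoeff (k : ℕ) : MvPolynomial ℕ ℂ :=
  C (1 / 4) * (∑ a ∈ Finset.range (k + 1), X a * X (k - a)) -
    C (Complex.I / 2 * (k + 1)) * X (k + 1)

/-- The Miura transformation `g ↦ (1/4) g² - (i/2) ∂g`. -/
def miura : MvPolynomial ℕ ℂ →ₐ[ℂ] MvPolynomial ℕ ℂ := aeval miuraCoeff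

/-- The coefficients of the solution `g` with `g(0) = 0` of the Riccati equation
`(1/4) g² - (i/2) ∂g = x`. -/
def riccatiCoeff : ℕ → MvPolynomial ℕ ℂ
  | 0 => 0
  | k + 1 => C (2 * Complex.I / (k + 1)) *
      (X k - C (1 / 4) * ∑ a : Fin (k + 1), riccatiCoeff a * riccatiCoeff (k - a))
  decreasing_by all_goals omega

/-- The solution of the Riccati equation is inverse to the Miura transformation. -/
theorem riccati_miura (p : MvPolynomial ℕ ℂ) : aeval riccatiCoeff (miura p) = p := by
  have h : (aeval (R := ℂ) riccatiCoeff).comp miura = AlgHom.id ℂ _ := by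
    refine MvPolynomial.algHom_ext fun k => ?_
    rw [AlgHom.comp_apply, miura, aeval_X, miuraCoeff]
    have hk : ((k : ℂ) + 1) ≠ 0 := by exact_mod_cast Nat.succ_ne_zero k
    have hC : (C (Complex.I / 2 * (k + 1)) * C (2 * Complex.I / (k + 1)) : MvPolynomial ℕ ℂ) = -1 := by
      rw [← C_mul, show Complex.I / 2 * (k + 1) * (2 * Complex.I / (k + 1)) = Complex.I * Complex.I by
        field_simp, Complex.I_mul_I, C_neg, C_1]
    have hr : riccatiCoeff (k + 1) = C (2 * Complex.I / (k + 1)) * (X k - C (1 / 4) *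
        ∑ a ∈ Finset.range (k + 1), riccatiCoeff a * riccatiCoeff (k - a)) := by
      rw [riccatiCoeff, Finset.sum_range]
    simp only [map_sub, map_mul, map_sum, aeval_X, algHom_C, MvPolynomial.algebraMap_eq]
    rw [hr, ← C_mul, ← mul_assoc, hC, AlgHom.id_apply]
    ring
  exact DFunLike.congr_fun h p

/-- Substituting the recursive Riccati solution is a left inverse. Thus the coefficients of (1/4)g²
- (i/2)∂g are algebraically independent. -/
theorem miura_injective : Function.Injective miura := fun p p' h => by
  rw [← riccati_miura p, h, riccati_miura]

end Miura

/-! ### Free field realization over O and independence of the ℓₙ -/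

section Realization

open MvPolynomial

/-- The background charge of the free field realization of `Vir^b`. -/
def bgCharge : K := RatFunc.C (Complex.I / 2) * (1 + b⁻¹ ^ 2)

/-- The background charge as an element of `O`. -/
def bgChargeO : O := constHom (Complex.I / 2) * (1 + bInv ^ 2)

/-- The boson is scaled by b⁻¹ relative to the usual normalization, so that b⁻²Lₙ^(b) acts by
formulas with coefficients regular at infinity. -/
theorem exists_freeField : ∃ ρ : VirVac K centralCharge →ₗ[K] MvPolynomial ℕ K,
    ρ (virVacuum K centralCharge) = 1 ∧
      ∀ n x, b⁻¹ ^ 2 • ρ (virL K centralCharge n x) = fockL (1 / 4) (b⁻¹ ^ 2) bgCharge n (ρ x) := by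
  have hb := b_ne_zero
  have hI : (RatFunc.C (Complex.I / 2) : K) ^ 2 = -(1 / 4) := by
    rw [← map_pow, div_pow, Complex.I_sq, show (-1 / 2 ^ 2 : ℂ) = -(1 / 4) by norm_num]
    simp only [map_neg, map_div₀, map_one, map_ofNat]
  -- Since (i/2)² = -1/4, the background charge contributes +(κ/2)(1+b⁻²)², which gives the part
  -- 6(b+b⁻¹)² of the central charge.
  have hcc : (b⁻¹ ^ 2) ^ 2 / 12 - 2 * b⁻¹ ^ 2 * bgCharge ^ 2 = b⁻¹ ^ 4 * (centralCharge / 12) := by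
    rw [bgCharge, mul_pow, hI, centralCharge]
    field_simp
    ring
  -- The bracket of the `fockL` carries the factor κ = b⁻²; multiplying by b² removes it and gives
  -- the Virasoro relations.
  obtain ⟨ρ, h1, h2⟩ := exists_virVac_hom centralCharge
    (fun n => b ^ 2 • fockL (1 / 4) (b⁻¹ ^ 2) bgCharge n) (fun m n => by
      rw [smul_lie_end, lie_smul_end, lie_fockL, hcc, smul_add, smul_add, smul_smul, smul_smul,
        smul_smul, smul_smul, smul_smul]
      congr 2
      · push_cast
        field_simp
      · split_ifs
        · field_simp
        · ring) 1 (fun n hn => by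
      rw [LinearMap.smul_apply, fockL_one _ _ _ hn, smul_zero])
  refine ⟨ρ, h1, fun n x => ?_⟩
  rw [h2, LinearMap.smul_apply, smul_smul, ← mul_pow, inv_mul_cancel₀ hb, one_pow, one_smul]

/-- The free field realization of `Vir^b`. -/
def freeField : VirVac K centralCharge →ₗ[K] MvPolynomial ℕ K := exists_freeField.choose

theorem freeField_vacuum : freeField (virVacuum K centralCharge) = 1 := exists_freeField.choose_spec.1

theorem freeField_virL (n : ℤ) (x : VirVac K centralCharge) :
    b⁻¹ ^ 2 • freeField (virL K centralCharge n x) =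
      fockL (1 / 4) (b⁻¹ ^ 2) bgCharge n (freeField x) := exists_freeField.choose_spec.2 n x

/-- The free field realization of the first factor, paired with a functional on the second. -/
def fockPairing (ψ : LatVOA K →ₗ[K] K) : Fam →ₗ[K] MvPolynomial ℕ K :=
  TensorProduct.lift ((LinearMap.lsmul K (MvPolynomial ℕ K)).flip.compl₁₂ freeField ψ)

@[simp]
theorem fockPairing_tmul (ψ : LatVOA K →ₗ[K] K) (u : VirVac K centralCharge) (w : LatVOA K) :
    fockPairing ψ (u ⊗ₜ[K] w) = ψ w • freeField u := by
  simp [fockPairing]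

theorem fockPairing_Lb (ψ : LatVOA K →ₗ[K] K) (n : ℤ) (x : Fam) :
    fockPairing ψ ((b⁻¹ ^ 2 • Lb n) x) = fockL (1 / 4) (b⁻¹ ^ 2) bgCharge n (fockPairing ψ x) := by
  rw [Lb_eq, LinearMap.smul_apply]
  induction x using TensorProduct.induction_on with
  | zero => simp
  | tmul u w =>
    rw [LinearMap.rTensor_tmul, map_smul, fockPairing_tmul, fockPairing_tmul, map_smul,
      ← freeField_virL, smul_comm]
  | add x y hx hy => rw [map_add, smul_add, map_add, hx, hy, map_add, map_add]

theorem fockPairing_lTensor (ψ : LatVOA K →ₗ[K] K) (A : Module.End K (LatVOA K)) (x : Fam) :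
    fockPairing ψ (A.lTensor _ x) = fockPairing (ψ.comp A) x := by
  induction x using TensorProduct.induction_on with
  | zero => simp
  | tmul u w => simp
  | add x y hx hy => rw [map_add, map_add, hx, hy, map_add]

theorem fockL_O (n : ℤ) (P : MvPolynomial ℕ O) :
    MvPolynomial.map O.subtype (fockL (constHom (1 / 4)) (bInv ^ 2) bgChargeO n P) =
      fockL (1 / 4) (b⁻¹ ^ 2) bgCharge n (MvPolynomial.map O.subtype P) := by
  have h : O.subtype (constHom (1 / 4)) = 1 / 4 := by
    change RatFunc.C (1 / 4) = _
    rw [map_div₀, map_one, map_ofNat]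
  rw [map_fockL, h]
  rfl

theorem red_fockL (k : ℕ) (P : MvPolynomial ℕ O) :
    MvPolynomial.map red (fockL (constHom (1 / 4)) (bInv ^ 2) bgChargeO (-k - 2) P) =
      miuraCoeff k * MvPolynomial.map red P := by
  rw [map_fockL, map_pow, red_bInv, red_constHom, bgChargeO, map_mul, red_constHom, map_add, map_one,
    map_pow, red_bInv, zero_pow two_ne_zero, add_zero, mul_one, fockL_zero_neg, miuraCoeff]

/-- The generators act with coefficients in O: b⁻²T^b through the Fock operators, the lattice modes
by composing them with ψ. The functional ψ is therefore varied in the induction. -/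
theorem exists_integral_fockPairing {x : Fam} (hx : x ∈ integralForm) (ψ : LatVOA K →ₗ[K] K)
    (hψ : ∀ v, ψ (mapLat RatFunc.C v) ∈ O) :
    ∃ P : MvPolynomial ℕ O, MvPolynomial.map O.subtype P = fockPairing ψ x := by
  let N : Submodule O Fam :=
    { carrier := {x | ∀ ψ : LatVOA K →ₗ[K] K, (∀ v, ψ (mapLat RatFunc.C v) ∈ O) →
        ∃ P : MvPolynomial ℕ O, MvPolynomial.map O.subtype P = fockPairing ψ x}
      add_mem' := fun {x y} hx hy ψ hψ => by
        obtain ⟨P, hP⟩ := hx ψ hψ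
        obtain ⟨Q, hQ⟩ := hy ψ hψ
        exact ⟨P + Q, by rw [map_add, hP, hQ, map_add]⟩
      zero_mem' := fun ψ hψ => ⟨0, by rw [map_zero, map_zero]⟩
      smul_mem' := fun r x hx ψ hψ => by
        obtain ⟨P, hP⟩ := hx ψ hψ
        refine ⟨C r * P, ?_⟩
        have : fockPairing ψ (r • x) = (r : K) • fockPairing ψ x := map_smul _ (r : K) x
        rw [map_mul, map_C, hP, this, MvPolynomial.smul_eq_C_mul]
        rfl }
  have hN : integralForm ≤ N := by
    refine integralForm_le (fun ψ hψ => ?_) fun G hG n x hx hxN ψ hψ => ?_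
    · refine ⟨C ⟨_, hψ (latVacuum ℂ)⟩, ?_⟩
      rw [← latEmbed_vacuum, latEmbed, fockPairing_tmul, freeField_vacuum, map_C,
        MvPolynomial.smul_eq_C_mul, mul_one]
      rfl
    · have hext : ∀ (B : Module.End K (LatVOA K)) (B' : Module.End ℂ (LatVOA ℂ)), IsExtension B B' →
          ∃ P : MvPolynomial ℕ O, MvPolynomial.map O.subtype P =
            fockPairing ψ (B.lTensor (VirVac K centralCharge) x) := fun B B' hB => by
        rw [fockPairing_lTensor]
        refine hxN _ fun v => ?_
        rw [LinearMap.comp_apply, hB]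
        exact hψ _
      rcases hG with rfl | rfl | rfl | rfl
      · obtain ⟨P, hP⟩ := hxN ψ hψ
        refine ⟨_, (fockL_O (n - 1) P).trans ?_⟩
        rw [hP, ← fockPairing_Lb, mode_smul, Lb, sub_add_cancel]
      · rw [famE, mode_rightField]
        exact hext _ _ (isExtension_exp _ _)
      · rw [famH, mode_rightField]
        exact hext _ _ (isExtension_heis _)
      · rw [famF, mode_rightField]
        exact hext _ _ (isExtension_exp _ _)
  exact hN hx ψ hψ

/-- The functional that takes the coefficient of a basis vector. -/
def latCoeff (F : Type*) [Field F] (m : ℤ) (d : ℕ →₀ ℕ) : LatVOA F →ₗ[F] F :=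
  (MvPolynomial.lcoeff F d).comp (Finsupp.lapply m)

theorem latCoeff_mapLat (m : ℤ) (d : ℕ →₀ ℕ) (v : LatVOA ℂ) :
    latCoeff K m d (mapLat RatFunc.C v) = RatFunc.C (latCoeff ℂ m d v) := by
  simp [latCoeff, mapLat, MvPolynomial.coeff_map]

/-- The partial evaluation of the second factor on `latCoeff`. -/
def latSlice (m : ℤ) (d : ℕ →₀ ℕ) : MvPolynomial ℕ ℂ ⊗[ℂ] LatVOA ℂ →ₗ[ℂ] MvPolynomial ℕ ℂ :=
  TensorProduct.lift ((LinearMap.lsmul ℂ (MvPolynomial ℕ ℂ)).flip.compl₁₂ LinearMap.id (latCoeff ℂ m d))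

@[simp]
theorem latSlice_tmul (m : ℤ) (d : ℕ →₀ ℕ) (p : MvPolynomial ℕ ℂ) (v : LatVOA ℂ) :
    latSlice m d (p ⊗ₜ[ℂ] v) = latCoeff ℂ m d v • p := by
  simp [latSlice]

theorem eq_zero_of_latSlice {y : MvPolynomial ℕ ℂ ⊗[ℂ] LatVOA ℂ} (h : ∀ m d, latSlice m d y = 0) :
    y = 0 := by
  let B := Finsupp.basis (R := ℂ) fun _ : ℤ => MvPolynomial.basisMonomials ℕ ℂ
  refine (TensorProduct.equivFinsuppOfBasisRight (M := MvPolynomial ℕ ℂ) B).map_eq_zero_iff.1 ?_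
  ext1 ⟨m, d⟩
  refine Eq.trans ?_ (h m d)
  clear h
  induction y using TensorProduct.induction_on with
  | zero => simp
  | tmul p v =>
    rw [TensorProduct.equivFinsuppOfBasisRight_apply_tmul_apply, latSlice_tmul]
    rfl
  | add x y hx hy => rw [map_add, map_add, Finsupp.add_apply, hx, hy]

/-- Each element p(ℓ)v has a lift whose Fock image can be followed explicitly. Multiplying p by a
variable applies b⁻²Lₙ^(b) to the lift, and its Fock image reduces to multiplication by a Miura
coefficient. -/
theorem exists_limitSection (m : ℤ) (d : ℕ →₀ ℕ) (y : MvPolynomial ℕ ℂ ⊗[ℂ] LatVOA ℂ) :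
    ∃ x : integralForm, toLimit x = limitSection y ∧ ∃ P : MvPolynomial ℕ O,
      MvPolynomial.map O.subtype P = fockPairing (latCoeff K m d) x ∧
        MvPolynomial.map red P = miura (latSlice m d y) := by
  -- Additivity is needed twice, for sums of tensors and for sums of polynomials in the first
  -- factor.
  have hadd : ∀ y y' : MvPolynomial ℕ ℂ ⊗[ℂ] LatVOA ℂ,
      (∃ x : integralForm, toLimit x = limitSection y ∧ ∃ P : MvPolynomial ℕ O,
        MvPolynomial.map O.subtype P = fockPairing (latCoeff K m d) x ∧
          MvPolynomial.map red P = miura (latSlice m d y)) →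
      (∃ x : integralForm, toLimit x = limitSection y' ∧ ∃ P : MvPolynomial ℕ O,
        MvPolynomial.map O.subtype P = fockPairing (latCoeff K m d) x ∧
          MvPolynomial.map red P = miura (latSlice m d y')) →
      ∃ x : integralForm, toLimit x = limitSection (y + y') ∧ ∃ P : MvPolynomial ℕ O,
        MvPolynomial.map O.subtype P = fockPairing (latCoeff K m d) x ∧
          MvPolynomial.map red P = miura (latSlice m d (y + y')) := by
    rintro y y' ⟨x, hx, P, hP, hP'⟩ ⟨x', hx', P', hQ, hQ'⟩
    refine ⟨x + x', by rw [map_add, hx, hx', map_add], P + P', ?_, ?_⟩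
    · rw [map_add, hP, hQ, Submodule.coe_add, map_add]
    · rw [map_add, hP', hQ', map_add, map_add]
  induction y using TensorProduct.induction_on with
  | zero => exact ⟨0, by rw [map_zero, map_zero], 0, by simp, by simp⟩
  | add y y' hy hy' => exact hadd y y' hy hy'
  | tmul p v =>
    induction p using MvPolynomial.induction_on with
    | C c =>
      refine ⟨⟨latEmbed (c • v), latEmbed_mem _⟩, ?_, C (constHom (latCoeff ℂ m d (c • v))), ?_, ?_⟩
      · rw [← mul_one (C c), ← MvPolynomial.smul_eq_C_mul, TensorProduct.smul_tmul, limitSection_tmul,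
          map_one]
        rfl
      · change _ = fockPairing (latCoeff K m d) (virVacuum K centralCharge ⊗ₜ[K] mapLat RatFunc.C (c • v))
        rw [map_C, fockPairing_tmul, freeField_vacuum, latCoeff_mapLat,
          MvPolynomial.smul_eq_C_mul, mul_one]
        rfl
      · rw [map_C, red_constHom, ← mul_one (C c), ← MvPolynomial.smul_eq_C_mul,
          TensorProduct.smul_tmul, latSlice_tmul, map_smul miura, map_one miura, MvPolynomial.smul_eq_C_mul,
          mul_one]
    | add p p' hp hp' =>
      rw [TensorProduct.add_tmul]
      exact hadd _ _ hp hp'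
    | mul_X p k hp =>
      obtain ⟨x, hx, P, hP, hP'⟩ := hp
      obtain ⟨h, h'⟩ := hasLim_iff.1 (hasLim_el (-k - 2))
      refine ⟨⟨_, h x x.2⟩, ?_, _, ((fockL_O (-k - 2) P).trans ?_), (red_fockL k P).trans ?_⟩
      · rw [← h', hx, limitSection_tmul, limitSection_tmul, mul_comm, map_mul, polyAct_X]
        rfl
      · rw [hP, fockPairing_Lb]
      · rw [hP', latSlice_tmul, latSlice_tmul, map_smul, map_smul, map_mul, miura, aeval_X]
        rw [mul_smul_comm, mul_comm]

/-- If y goes to 0, its lift is b⁻¹ times an integral element, hence its Fock image is divisible by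
b⁻¹ over O and reduces to 0. That reduction is the Miura image of the slices of y, and the Miura map
is injective. -/
theorem limitSection_injective : Function.Injective limitSection := by
  rw [← LinearMap.ker_eq_bot, LinearMap.ker_eq_bot']
  refine fun y hy => eq_zero_of_latSlice fun m d => miura_injective ?_
  obtain ⟨x, hx, P, hP, hP'⟩ := exists_limitSection m d y
  obtain ⟨x', rfl⟩ := exists_of_toLimit_eq_zero (hx.trans hy)
  obtain ⟨P', hQ⟩ := exists_integral_fockPairing x'.2 (latCoeff K m d) fun v => by
    rw [latCoeff_mapLat]
    exact (constHom _).2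
  -- The equality is checked over ℂ(b), which is enough because O[X] embeds in K[X].
  have : P = C bInv * P' := by
    refine MvPolynomial.map_injective O.subtype Subtype.val_injective ?_
    have h2 : fockPairing (latCoeff K m d) ((bInv • x' : integralForm) : Fam) =
      (b⁻¹ : K) • fockPairing (latCoeff K m d) x' := map_smul _ b⁻¹ _
    rw [hP, map_mul, map_C, hQ, h2, MvPolynomial.smul_eq_C_mul]
    rfl
  rw [← hP', this, map_mul, map_C, red_bInv, C_0, zero_mul, map_zero]

/-- The limit is the space of `V_{√2ℤ}`-valued functions on the regular Sturm-Liouville operators. -/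
def trivialization : Limit ≃ₗ[ℂ] MvPolynomial ℕ ℂ ⊗[ℂ] LatVOA ℂ :=
  (LinearEquiv.ofBijective limitSection ⟨limitSection_injective, limitSection_surjective⟩).symm

theorem trivialization_symm_apply (y : MvPolynomial ℕ ℂ ⊗[ℂ] LatVOA ℂ) :
    trivialization.symm y = limitSection y := rfl

theorem trivialization_vacuum : trivialization limitVacuum = 1 ⊗ₜ[ℂ] latVacuum ℂ := by
  rw [← limitSection_vacuum, ← trivialization_symm_apply, LinearEquiv.apply_symm_apply]

theorem trivialization_el (n : ℤ) (x : Limit) : trivialization (el n x) =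
    (LinearMap.mulLeft ℂ (coord n)).rTensor (LatVOA ℂ) (trivialization x) := by
  rw [← LinearEquiv.eq_symm_apply, trivialization_symm_apply, limitSection_el,
    ← trivialization_symm_apply, LinearEquiv.symm_apply_apply]

theorem trivialization_latLim {A : Module.End K (LatVOA K)} {A' : Module.End ℂ (LatVOA ℂ)}
    (hA : IsExtension A A') (x : Limit) :
    trivialization (latLim A x) = A'.lTensor (MvPolynomial ℕ ℂ) (trivialization x) := by
  rw [← LinearEquiv.eq_symm_apply, trivialization_symm_apply, limitSection_latLim hA,
    ← trivialization_symm_apply, LinearEquiv.symm_apply_apply]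

end Realization

end Urod

namespace Urod

/-! ### Products and derivatives on a tensor factor; the Leibniz rule -/

section FieldCalculus

variable {R V W : Type*} [CommRing R] [AddCommGroup V] [Module R V] [AddCommGroup W] [Module R W]

theorem intertwines_rightField (A : VertexOperator R W) (v : V) :
    Intertwines (TensorProduct.mk R V W v).toAddMonoidHom A (rightField A) := fun n w => by
  simp

theorem nprod_rightField (A B : VertexOperator R W) (p : ℤ) :
    nprod (rightField (V := V) A) p (rightField B) = rightField (nprod A p B) := by
  refine field_ext fun n x => ?_
  induction x using TensorProduct.induction_on with
  | zero => rw [map_zero, map_zero]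
  | add x y hx hy => rw [map_add, map_add, hx, hy]
  | tmul v w =>
    have h := (intertwines_rightField A v).nprod p (intertwines_rightField B v) n w
    rw [mode_rightField, LinearMap.lTensor_tmul]
    exact h.symm

theorem normOrd_rightField (A B : VertexOperator R W) :
    normOrd (rightField (V := V) A) (rightField B) = rightField (normOrd A B) :=
  nprod_rightField A B (-1)

theorem derivField_rightField (A : VertexOperator R W) :
    derivField (rightField (V := V) A) = rightField (derivField A) := by
  refine field_ext fun n x => ?_
  rw [mode_derivField, mode_rightField, mode_rightField, mode_derivField, ← Int.cast_smul_eq_zsmul R,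
    ← Int.cast_smul_eq_zsmul R, LinearMap.lTensor_smul]

theorem nprod_smul_left (r : R) (A B : VertexOperator R V) (n : ℤ) :
    nprod (r • A) n B = r • nprod A n B := by
  ext k x
  rw [mode_nprod_apply, mode_smul, LinearMap.smul_apply, mode_nprod_apply,
    smul_finsum' _ ((nprodTerm_trunc A B n x).2 k)]
  refine finsum_congr fun j => ?_
  simp only [nprodTerm, mode_smul, LinearMap.smul_apply, LinearMap.sub_apply, Module.End.mul_apply,
    map_smul]
  rw [← smul_comm r (n.negOnePow : ℤ), ← smul_sub, smul_comm r]

theorem normOrd_smul_left (r : R) (A B : VertexOperator R V) :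
    normOrd (r • A) B = r • normOrd A B := nprod_smul_left r A B _

/-- The terms match after shifting the index of the sum for :(∂A)B: by one, since (∂A)ᵢ₊₁ =
-(i+1)Aᵢ. -/
theorem derivField_normOrd (A B : VertexOperator R V) :
    derivField (normOrd A B) = normOrd (derivField A) B + normOrd A (derivField B) := by
  ext k x
  have f0 := ordTerm_finite A B 0 (k - 2) x
  have f1 := ordTerm_finite (derivField A) B 0 (k - 1) x
  have f2 := ordTerm_finite A (derivField B) 0 (k - 1) x
  have f1' : (Function.support fun i => ordTerm (derivField A) B 0 (k - 1) (i + 1) x).Finite :=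
    f1.preimage (f := fun i : ℤ => i + 1) (fun a _ b _ hab => by simpa using hab)
  have e1 : ∑ᶠ i, ordTerm (derivField A) B 0 (k - 1) (i + 1) x =
      ∑ᶠ i, ordTerm (derivField A) B 0 (k - 1) i x :=
    finsum_comp_equiv (Equiv.addRight (1 : ℤ)) (f := fun i => ordTerm (derivField A) B 0 (k - 1) i x)
  rw [mode_derivField, mode_add, LinearMap.add_apply, mode_normOrd_apply, mode_normOrd_apply,
    LinearMap.smul_apply, mode_normOrd_apply, ← e1, ← finsum_add_distrib f1' f2,
    show k - 1 - 1 = k - 2 by ring, smul_finsum' _ f0]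
  refine finsum_congr fun i => ?_
  simp only [ordTerm, mode_derivField]
  rw [show k - 1 - (i + 1) = k - 2 - i by ring, show k - 1 - i - 1 = k - 2 - i by ring,
    add_sub_cancel_right]
  rcases lt_trichotomy i (-1) with h | rfl | h
  · rw [if_pos (by omega), if_pos (by omega), if_pos (by omega)]
    simp only [Module.End.mul_apply, LinearMap.smul_apply, map_zsmul]
    module
  -- At i = -1 the shifted term falls on the other side of the cutoff, but it vanishes because (∂A)₀
  -- = 0.
  · rw [if_pos (show (-1 : ℤ) < 0 by norm_num), if_neg (show ¬ (-1 : ℤ) + 1 < 0 by norm_num),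
      if_pos (show (-1 : ℤ) < 0 by norm_num)]
    simp only [Module.End.mul_apply, LinearMap.smul_apply, map_zsmul]
    module
  · rw [if_neg (by omega), if_neg (by omega), if_neg (by omega)]
    simp only [Module.End.mul_apply, LinearMap.smul_apply, map_zsmul]
    module

end FieldCalculus

/-! ### Lattice fields and :ℓe: on the limit -/

section LatticeOperators

/-- The extension of an operator on `V_{√2ℤ}` to the limit. -/
def latExt : Module.End ℂ (LatVOA ℂ) →ₐ[ℂ] Module.End ℂ Limit :=
  (LinearEquiv.conjAlgEquiv ℂ trivialization.symm).toAlgHom.comp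
    (Module.End.lTensorAlgHom ℂ (LatVOA ℂ) (MvPolynomial ℕ ℂ))

theorem trivialization_latExt (A : Module.End ℂ (LatVOA ℂ)) (x : Limit) :
    trivialization (latExt A x) = A.lTensor (MvPolynomial ℕ ℂ) (trivialization x) := by
  change trivialization (trivialization.symm _) = _
  rw [LinearEquiv.apply_symm_apply]
  rfl

theorem eq_latExt {D : Module.End ℂ Limit} {A : Module.End ℂ (LatVOA ℂ)}
    (h : ∀ x, trivialization (D x) = A.lTensor (MvPolynomial ℕ ℂ) (trivialization x)) :
    D = latExt A :=
  LinearMap.ext fun x => trivialization.injective ((h x).trans (trivialization_latExt A x).symm)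

theorem latLim_eq {A : Module.End K (LatVOA K)} {A' : Module.End ℂ (LatVOA ℂ)}
    (hA : IsExtension A A') : latLim A = latExt A' := eq_latExt (trivialization_latLim hA)

theorem lie_latExt (A B : Module.End ℂ (LatVOA ℂ)) : ⁅latExt A, latExt B⁆ = latExt ⁅A, B⁆ := by
  rw [Ring.lie_def, Ring.lie_def, map_sub, map_mul, map_mul]

theorem lie_latExt_el (A : Module.End ℂ (LatVOA ℂ)) (n : ℤ) : ⁅latExt A, el n⁆ = 0 := by
  refine LinearMap.ext fun x => ?_
  rw [lie_apply_end, LinearMap.zero_apply, sub_eq_zero]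
  refine trivialization.injective ?_
  rw [trivialization_latExt, trivialization_el, trivialization_el, trivialization_latExt,
    commute_rTensor_lTensor]

/-- The fields `A` and `A'` on `V_{√2ℤ}` and on the limit correspond to each other. -/
def IsLatField (A' : VertexOperator ℂ Limit) (A : VertexOperator ℂ (LatVOA ℂ)) : Prop :=
  ∀ n, mode A' n = latExt (mode A n)

/-- In this form, compatibility with products is an instance of the general statement for
intertwining maps. -/
theorem isLatField_iff {A' : VertexOperator ℂ Limit} {A : VertexOperator ℂ (LatVOA ℂ)} :
    IsLatField A' A ↔ Intertwines trivialization.toLinearMap.toAddMonoidHom A' (rightField A) := by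
  constructor
  · intro h n x
    rw [h, mode_rightField]
    exact trivialization_latExt _ x
  · intro h n
    refine eq_latExt fun x => ?_
    have := h n x
    rwa [mode_rightField] at this

theorem IsLatField.nprod {A' B' : VertexOperator ℂ Limit} {A B : VertexOperator ℂ (LatVOA ℂ)}
    (hA : IsLatField A' A) (hB : IsLatField B' B) (p : ℤ) :
    IsLatField (nprod A' p B') (nprod A p B) := by
  rw [isLatField_iff, ← nprod_rightField]
  exact (isLatField_iff.1 hA).nprod p (isLatField_iff.1 hB)

theorem IsLatField.normOrd {A' B' : VertexOperator ℂ Limit} {A B : VertexOperator ℂ (LatVOA ℂ)}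
    (hA : IsLatField A' A) (hB : IsLatField B' B) : IsLatField (normOrd A' B') (normOrd A B) :=
  hA.nprod hB (-1)

theorem hasLim_lat {A : Module.End K (LatVOA K)} {A' : Module.End ℂ (LatVOA ℂ)}
    (hA : IsExtension A A') : HasLim (A.lTensor (VirVac K centralCharge)) (latExt A') := by
  rw [← latLim_eq hA]
  exact hasLim_latLim hA

/-- The limit of `e(z)`. -/
abbrev limE : VertexOperator ℂ Limit := limitField famE

/-- The limit of `f(z)`. -/
abbrev limF : VertexOperator ℂ Limit := limitField famF

/-- The limit of `h(z)`. -/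
abbrev limH : VertexOperator ℂ Limit := limitField famH

theorem isLatField_limE : IsLatField limE (eField ℂ) := fun n => by
  refine (hasLimField_gen famE_mem n).unique ?_
  rw [famE, mode_rightField]
  exact hasLim_lat (isExtension_exp 1 n)

theorem isLatField_limF : IsLatField limF (fField ℂ) := fun n => by
  refine (hasLimField_gen famF_mem n).unique ?_
  rw [famF, mode_rightField]
  exact hasLim_lat (isExtension_exp (-1) n)

theorem isLatField_limH : IsLatField limH (heisField ℂ) := fun n => by
  refine (hasLimField_gen famH_mem n).unique ?_
  rw [famH, mode_rightField]
  exact hasLim_lat (isExtension_heis n)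

theorem hasLimField_famExp (m : ℤ) : HasLimField (famExp m) (limitField (famExp m)) :=
  hasLimField_limitField fun n => by
    rw [famExp, mode_rightField]
    exact (hasLim_lat (isExtension_exp m n)).1

theorem sugawara_limH (n : ℤ) :
    (1 / 4 : ℂ) • mode (normOrd limH limH) (n + 1) = latExt (latL ℂ n) := by
  rw [(isLatField_limH.normOrd isLatField_limH) (n + 1), ← map_smul]
  rfl

/-- The field `ℓ(z) e(z)`. -/
def ellE : VertexOperator ℂ Limit := normOrd elField limE

/-- The ℓₖ commute with lattice fields, so the ordering is irrelevant and the product is a plain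
convolution. The index shift comes from `mode_elField`: the n-th mode is ℓₙ₋₁. -/
theorem mode_normOrd_elField {A' : VertexOperator ℂ Limit} {A : VertexOperator ℂ (LatVOA ℂ)}
    (hA : IsLatField A' A) (n : ℤ) (x : Limit) :
    (Function.support fun k : ℤ => el k (mode A' (n - k - 1) x)).Finite ∧
    mode (normOrd elField A') (n + 1) x = ∑ᶠ k : ℤ, el k (mode A' (n - k - 1) x) := by
  have hterm : ∀ i, ordTerm elField A' 0 (n + 1 - 1) i x = el (i - 1) (mode A' (n - (i - 1) - 1) x) := by
    intro i
    have hc := LinearMap.congr_fun (lie_latExt_el (mode A (n + 1 - 1 - i)) (i - 1)) x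
    rw [lie_apply_end, LinearMap.zero_apply, sub_eq_zero] at hc
    rw [ordTerm, mode_elField, hA, hA, show n - (i - 1) - 1 = n + 1 - 1 - i by ring]
    split_ifs
    · rfl
    · exact hc
  have hf := ordTerm_finite elField A' 0 (n + 1 - 1) x
  rw [mode_normOrd_apply]
  rw [finsum_congr hterm]
  simp only [hterm] at hf
  refine ⟨?_, finsum_comp_equiv (Equiv.subRight (1 : ℤ))
    (f := fun k => el k (mode A' (n - k - 1) x))⟩
  have := hf.preimage (f := fun k : ℤ => k + 1) (fun a _ b _ hab => by simpa using hab)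
  refine this.subset fun k hk => ?_
  rw [Set.mem_preimage, Function.mem_support, add_sub_cancel_right]
  exact hk

theorem ellE_apply (n : ℤ) (x : Limit) :
    mode ellE (n + 1) x = ∑ᶠ k : ℤ, el k (mode limE (n - k - 1) x) :=
  (mode_normOrd_elField isLatField_limE n x).2

end LatticeOperators

section Coefficients

theorem hasRed_one_sub : HasRed (1 - b⁻¹ ^ 2) 1 :=
  (HasRed.one.sub (HasRed.bInv.pow 2)).congr rfl (by norm_num)

theorem hasRed_one_sub_four : HasRed (1 - b⁻¹ ^ 4) 1 :=
  (HasRed.one.sub (HasRed.bInv.pow 4)).congr rfl (by norm_num)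

theorem HasRed.ne_zero {a : K} {c : ℂ} (h : HasRed a c) (hc : c ≠ 0) : a ≠ 0 := by
  obtain ⟨r, rfl, rfl⟩ := h
  rintro h0
  have : r = 0 := Subtype.ext h0
  exact hc (by rw [this, map_zero])

theorem one_sub_ne_zero : (1 - b⁻¹ ^ 2 : K) ≠ 0 := hasRed_one_sub.ne_zero one_ne_zero

theorem sub_inv_eq : (b - b⁻¹ : K) = b * (1 - b⁻¹ ^ 2) := by
  have := b_ne_zero
  field_simp

theorem sq_sub_inv_eq : (b ^ 2 - b⁻¹ ^ 2 : K) = b ^ 2 * (1 - b⁻¹ ^ 4) := by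
  have := b_ne_zero
  field_simp

theorem sq_sub_one_eq : (b ^ 2 - 1 : K) = b ^ 2 * (1 - b⁻¹ ^ 2) := by
  have := b_ne_zero
  field_simp

theorem C_ne_zero {ε : ℂ} (hε : ε ≠ 0) : (RatFunc.C ε : K) ≠ 0 := (map_ne_zero _).2 hε

end Coefficients

end Urod

namespace Urod

/-! ### Limits of T^(b₁) and T^(b₂) -/

section LimitsOfConformalFields

theorem HasLimField.unique {A : VertexOperator K Fam} {A' A'' : VertexOperator ℂ Limit}
    (h : HasLimField A A') (h' : HasLimField A A'') : A' = A'' := by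
  rw [← h.limitField_eq, h'.limitField_eq]

theorem hasLimField_E : HasLimField famE limE := hasLimField_gen famE_mem

theorem hasLimField_F : HasLimField famF limF := hasLimField_gen famF_mem

theorem hasLimField_H : HasLimField famH limH := hasLimField_gen famH_mem

theorem hasLimField_T : HasLimField (b⁻¹ ^ 2 • Tb) elField := hasLimField_gen famT_mem

theorem normOrd_heis_e : normOrd (heisField K) (eField K) = derivField (eField K) := by
  refine field_ext fun k x => ?_
  have := mode_normOrd_heis_exp (F := K) 1 k
  rw [Int.cast_one, one_smul] at this
  rw [eField, this, mode_derivField, LinearMap.smul_apply, LinearMap.smul_apply,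
    ← Int.cast_smul_eq_zsmul K, Int.cast_neg]

theorem normOrd_fam_heis_e : normOrd famH famE = derivField famE := by
  rw [famH, famE, normOrd_rightField, normOrd_heis_e, derivField_rightField]

/-- Differentiate :he: = ∂e once more by the Leibniz rule. In T^(b₂) the two terms on the left have
the same limiting coefficient ε, so they combine to ε∂²e. -/
theorem normOrd_heis_heis_e : normOrd famH (normOrd famH famE) + normOrd (derivField famH) famE =
    derivField (derivField famE) := by
  conv_rhs => rw [← normOrd_fam_heis_e, derivField_normOrd, ← normOrd_fam_heis_e]
  exact add_comm _ _

variable (ε : ℂ)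

/-- The limit of `T^(b₁)(z)`. -/
def limT1 : VertexOperator ℂ Limit :=
  (1 / (2 * ε)) • limF + (1 / 4 : ℂ) • normOrd limH limH - elField - (2 * ε) • ellE

theorem hasRed_coeffF (hε : ε ≠ 0) :
    HasRed ((b + b⁻¹) / (2 * (b - b⁻¹) * RatFunc.C ε)) (1 / (2 * ε)) := by
  have h : HasRed ((1 + b⁻¹ ^ 2) / (2 * (1 - b⁻¹ ^ 2) * RatFunc.C ε)) _ :=
    (HasRed.one.add (HasRed.bInv.pow 2)).div (((HasRed.ofNat 2).mul hasRed_one_sub).mul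
      (HasRed.const ε)) (by simpa using hε)
  refine h.congr ?_ (by norm_num)
  have hb := b_ne_zero
  have hC := C_ne_zero hε
  have h1 := one_sub_ne_zero
  rw [sub_inv_eq]
  rw [show b + b⁻¹ = b * (1 + b⁻¹ ^ 2) by field_simp]
  rw [show 2 * (b * (1 - b⁻¹ ^ 2)) * RatFunc.C ε = b * (2 * (1 - b⁻¹ ^ 2) * RatFunc.C ε) by ring]
  rw [mul_div_mul_left _ _ hb]

/-- Coefficients of the form `b^k p / (b - b⁻¹)`. -/
theorem hasRed_div_sub {p : K} {c : ℂ} (h : HasRed (p / b) c) :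
    HasRed (p / (b - b⁻¹)) c := by
  refine (h.div hasRed_one_sub one_ne_zero).congr ?_ (div_one c)
  rw [sub_inv_eq, div_div]

theorem hasRed_div_sq_sub {p : K} {c : ℂ} (h : HasRed (p / b ^ 2) c) :
    HasRed (p / (b ^ 2 - b⁻¹ ^ 2)) c := by
  refine (h.div hasRed_one_sub_four one_ne_zero).congr ?_ (div_one c)
  rw [sq_sub_inv_eq, div_div]

theorem hasRed_b_div (d : ℕ) [d.AtLeastTwo] : 
    HasRed (b / (OfNat.ofNat d * (b - b⁻¹))) (1 / OfNat.ofNat d) := by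
  have h : HasRed (b / (b - b⁻¹)) 1 := hasRed_div_sub (HasRed.one.congr (div_self b_ne_zero).symm rfl)
  refine (h.div (HasRed.ofNat d) (OfNat.ofNat_ne_zero d)).congr ?_ rfl
  rw [div_div, mul_comm (b - b⁻¹)]

theorem hasRed_bInv_div (d : ℕ) [d.AtLeastTwo] :
    HasRed (b⁻¹ / (OfNat.ofNat d * (b - b⁻¹))) 0 := by
  have h : HasRed (b⁻¹ / (b - b⁻¹)) 0 := hasRed_div_sub
    ((HasRed.bInv.pow 2).congr (by rw [pow_two, div_eq_mul_inv]) (by norm_num))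
  refine (h.div (HasRed.ofNat d) (OfNat.ofNat_ne_zero d)).congr ?_ (zero_div _)
  rw [div_div, mul_comm (b - b⁻¹)]

/-- The terms containing T^b are rewritten in terms of b⁻²T^b, which preserves the integral form,
and then have limiting coefficients -1 and -2ε. Of the others, only f and :hh: have nonzero limiting
coefficients. -/
theorem hasLimField_T1 (hε : ε ≠ 0) : HasLimField (T1 ε) (limT1 ε) := by
  have hb := b_ne_zero
  have t1 := hasLimField_F.smul' (hasRed_coeffF ε hε)
  have t2 := (hasLimField_H.normOrd hasLimField_H).smul' (hasRed_b_div 4)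
  have t3 := hasLimField_H.derivField.smul' (hasRed_bInv_div 2)
  have h4 : HasRed ((1 + 2 * b⁻¹ ^ 2) * RatFunc.C ε / (2 * (b ^ 2 - b⁻¹ ^ 2))) 0 := by
    have h : HasRed ((1 + 2 * b⁻¹ ^ 2) * RatFunc.C ε / 2 / (b ^ 2 - b⁻¹ ^ 2)) 0 := by
      refine hasRed_div_sq_sub ?_
      refine (((HasRed.one.add ((HasRed.ofNat 2).mul (HasRed.bInv.pow 2))).mul (HasRed.const ε)).div
        (HasRed.ofNat 2) two_ne_zero |>.mul (HasRed.bInv.pow 2)).congr ?_ (by norm_num)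
      rw [inv_pow, div_eq_mul_inv _ (b ^ 2)]
    exact h.congr (div_div _ _ _) rfl
  have t4 := (hasLimField_H.normOrd (hasLimField_H.normOrd hasLimField_E)).smul' h4
  have h5 : HasRed (b⁻¹ * RatFunc.C ε / (b - b⁻¹)) 0 := hasRed_div_sub
    (((HasRed.bInv.pow 2).mul (HasRed.const ε)).congr (by field_simp) (by norm_num))
  have t5 := (hasLimField_H.derivField.normOrd hasLimField_E).smul' h5
  have h6 : HasRed (2 * RatFunc.C ε ^ 2 / (b ^ 2 - b⁻¹ ^ 2)) 0 := hasRed_div_sq_sub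
    ((((HasRed.ofNat 2).mul ((HasRed.const ε).pow 2)).mul (HasRed.bInv.pow 2)).congr
      (by rw [inv_pow, div_eq_mul_inv]) (by norm_num))
  have t6 := (hasLimField_famExp 2).smul' h6
  have h7 : HasRed (b / (b - b⁻¹)) 1 := hasRed_div_sub (HasRed.one.congr (div_self hb).symm rfl)
  have t7 := hasLimField_T.smul' h7
  have h8 : HasRed (2 * RatFunc.C ε / (1 - b⁻¹ ^ 4)) (2 * ε) :=
    (((HasRed.ofNat 2).mul (HasRed.const ε)).div hasRed_one_sub_four one_ne_zero).congr rfl (div_one _)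
  have t8 := (hasLimField_T.normOrd hasLimField_E).smul' h8
  have e7 : (b / (b - b⁻¹)) • b⁻¹ ^ 2 • Tb = (b⁻¹ / (b - b⁻¹)) • Tb := by
    rw [smul_smul]
    congr 1
    field_simp
  have e8 : (2 * RatFunc.C ε / (1 - b⁻¹ ^ 4)) • normOrd (b⁻¹ ^ 2 • Tb) famE =
      (2 * RatFunc.C ε / (b ^ 2 - b⁻¹ ^ 2)) • normOrd Tb famE := by
    rw [normOrd_smul_left, smul_smul, sq_sub_inv_eq]
    congr 1
    rw [inv_pow b 2, ← div_eq_mul_inv, div_div, mul_comm (b ^ 2)]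
  rw [e7] at t7
  rw [e8] at t8
  have := ((((((t1.add t2).sub t3).sub t4).sub t5).sub t6).sub t7).sub t8
  simp only [zero_smul, one_smul, sub_zero] at this
  exact this

theorem mode_limT1 (n : ℤ) : mode (limT1 ε) (n + 1) = (1 / (2 * ε)) • latExt (mode (fField ℂ) (n + 1)) +
    latExt (latL ℂ n) - el n - (2 * ε) • mode ellE (n + 1) := by
  rw [limT1, mode_sub, mode_sub, mode_add, mode_smul, mode_smul, mode_smul, sugawara_limH,
    isLatField_limF, mode_elField, add_sub_cancel_right]

theorem hasLim_L1 (hε : ε ≠ 0) (n : ℤ) : HasLim (L1 ε n)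
    ((1 / (2 * ε)) • latExt (mode (fField ℂ) (n + 1)) + latExt (latL ℂ n) - el n -
      (2 * ε) • mode ellE (n + 1)) := by
  rw [← mode_limT1]
  exact hasLimField_T1 ε hε (n + 1)

/-- The summands of `T^(b₂)(z)` other than the multiple of `T^b(z)`. -/
def regT2 : VertexOperator K Fam :=
  -((b + b⁻¹) / (2 * (b - b⁻¹) * RatFunc.C ε)) • famF
  - (b⁻¹ / (4 * (b - b⁻¹))) • normOrd famH famH
  + (b / (2 * (b - b⁻¹))) • derivField famH
  + ((1 + 2 * b ^ 2) * RatFunc.C ε / (2 * (b ^ 2 - b⁻¹ ^ 2))) • normOrd famH (normOrd famH famE)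
  + (b * RatFunc.C ε / (b - b⁻¹)) • normOrd (derivField famH) famE
  + (2 * RatFunc.C ε ^ 2 / (b ^ 2 - b⁻¹ ^ 2)) • famExp 2
  + (2 * RatFunc.C ε / (b ^ 2 - b⁻¹ ^ 2)) • normOrd Tb famE

theorem T2_eq : T2 ε = regT2 ε + (b / (b - b⁻¹)) • Tb := by
  rw [T2, regT2]
  abel

/-- The limit of `regT2`. -/
def limRegT2 : VertexOperator ℂ Limit :=
  -(1 / (2 * ε)) • limF + (1 / 2 : ℂ) • derivField limH + ε • derivField (derivField limE)
    + (2 * ε) • ellE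

theorem hasLimField_regT2 (hε : ε ≠ 0) : HasLimField (regT2 ε) (limRegT2 ε) := by
  have hb := b_ne_zero
  have t1 := hasLimField_F.smul' (hasRed_coeffF ε hε).neg
  have t2 := (hasLimField_H.normOrd hasLimField_H).smul' (hasRed_bInv_div 4)
  have t3 := hasLimField_H.derivField.smul' (hasRed_b_div 2)
  have h4 : HasRed ((1 + 2 * b ^ 2) * RatFunc.C ε / (2 * (b ^ 2 - b⁻¹ ^ 2))) ε := by
    have h : HasRed ((1 + 2 * b ^ 2) * RatFunc.C ε / 2 / (b ^ 2 - b⁻¹ ^ 2)) ε := by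
      refine hasRed_div_sq_sub ?_
      refine ((((HasRed.bInv.pow 2).add (HasRed.ofNat 2)).mul (HasRed.const ε)).div
        (HasRed.ofNat 2) two_ne_zero).congr ?_ (by norm_num)
      field_simp
    exact h.congr (div_div _ _ _) rfl
  have t4 := (hasLimField_H.normOrd (hasLimField_H.normOrd hasLimField_E)).smul' h4
  have h5 : HasRed (b * RatFunc.C ε / (b - b⁻¹)) ε := hasRed_div_sub
    ((HasRed.const ε).congr (by field_simp) rfl)
  have t5 := (hasLimField_H.derivField.normOrd hasLimField_E).smul' h5
  have h6 : HasRed (2 * RatFunc.C ε ^ 2 / (b ^ 2 - b⁻¹ ^ 2)) 0 := hasRed_div_sq_sub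
    ((((HasRed.ofNat 2).mul ((HasRed.const ε).pow 2)).mul (HasRed.bInv.pow 2)).congr
      (by rw [inv_pow, div_eq_mul_inv]) (by norm_num))
  have t6 := (hasLimField_famExp 2).smul' h6
  have h8 : HasRed (2 * RatFunc.C ε / (1 - b⁻¹ ^ 4)) (2 * ε) :=
    (((HasRed.ofNat 2).mul (HasRed.const ε)).div hasRed_one_sub_four one_ne_zero).congr rfl (div_one _)
  have t8 := (hasLimField_T.normOrd hasLimField_E).smul' h8
  have e8 : (2 * RatFunc.C ε / (1 - b⁻¹ ^ 4)) • normOrd (b⁻¹ ^ 2 • Tb) famE =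
      (2 * RatFunc.C ε / (b ^ 2 - b⁻¹ ^ 2)) • normOrd Tb famE := by
    rw [normOrd_smul_left, smul_smul, sq_sub_inv_eq]
    congr 1
    rw [inv_pow b 2, ← div_eq_mul_inv, div_div, mul_comm (b ^ 2)]
  rw [e8] at t8
  -- The identity holds before the limit, and limits of fields are unique.
  have e9 : normOrd limH (normOrd limH limE) + normOrd (derivField limH) limE =
      derivField (derivField limE) := by
    have h1 := (hasLimField_H.normOrd (hasLimField_H.normOrd hasLimField_E)).add
      (hasLimField_H.derivField.normOrd hasLimField_E)
    rw [normOrd_heis_heis_e] at h1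
    exact h1.unique hasLimField_E.derivField.derivField
  have := (((((t1.sub t2).add t3).add t4).add t5).add t6).add t8
  simp only [zero_smul, sub_zero, add_zero] at this
  rw [add_assoc _ (ε • _) (ε • _), ← smul_add, e9] at this
  exact this

theorem hasLim_L2_div (hε : ε ≠ 0) (n : ℤ) : HasLim ((b ^ 2 - 1)⁻¹ • L2 ε n) (el n) := by
  have hb := b_ne_zero
  have h1 := one_sub_ne_zero
  have r1 : HasRed (b ^ 2 - 1)⁻¹ 0 := by
    refine ((HasRed.bInv.pow 2).div hasRed_one_sub one_ne_zero).congr ?_ (by norm_num)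
    rw [sq_sub_one_eq, mul_inv, inv_pow, div_eq_mul_inv]
  -- The coefficient of T^b is (b²-1)⁻¹·b/(b-b⁻¹) = b⁻²/(1-b⁻²)².
  have r2 : HasRed (1 / (1 - b⁻¹ ^ 2) ^ 2) 1 :=
    (HasRed.one.div (hasRed_one_sub.pow 2) (by norm_num)).congr rfl (by norm_num)
  have t := ((hasLimField_regT2 ε hε (n + 1)).smul' r1).add ((hasLim_el n).smul' r2)
  refine t.congr ?_ (by rw [zero_smul, zero_add, one_smul])
  rw [L2, T2_eq, mode_add, smul_add, mode_smul, smul_smul, smul_smul, Lb]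
  congr 2
  rw [sub_inv_eq, sq_sub_one_eq]
  generalize 1 - b⁻¹ ^ 2 = s at *
  field_simp

theorem ell_eq (hε : ε ≠ 0) (n : ℤ) : ell ε n = el n := (hasLim_L2_div ε hε n).2

/-- For these n the vacuum is annihilated and the central term is zero, so [Lₙ, b⁻²Lₖ] =
(n-k)b⁻²Lₙ₊ₖ stays integral although Lₙ itself is not rescaled. -/
theorem preserves_Lb {n : ℤ} (hn : n = -1 ∨ n = 0 ∨ n = 1) : Preserves (Lb n) := by
  let N : Submodule O Fam :=
    { carrier := {x | Lb n x ∈ integralForm}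
      add_mem' := fun {x y} hx hy => by
        rw [Set.mem_ofPred_eq, map_add]
        exact integralForm.add_mem hx hy
      zero_mem' := by
        rw [Set.mem_ofPred_eq, map_zero]
        exact integralForm.zero_mem
      smul_mem' := fun r x hx => by
        have : Lb n (r • x) = r • Lb n x := map_smul _ (r : K) x
        rw [Set.mem_ofPred_eq, this]
        exact integralForm.smul_mem r hx }
  have hN : integralForm ≤ N := by
    refine integralForm_le ?_ fun G hG k x hx hxN => ?_
    · change Lb n famVacuum ∈ integralForm
      rw [Lb_eq, famVacuum, LinearMap.rTensor_tmul, virL_apply, virGen_smul_vacuum _ _ (by omega),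
        TensorProduct.zero_tmul]
      exact integralForm.zero_mem
    · have hext : ∀ B : VertexOperator K (LatVOA K),
          (∀ y ∈ integralForm, mode (rightField B) k y ∈ integralForm) →
          mode (rightField B) k x ∈ N := fun B hB => by
        change Lb n _ ∈ integralForm
        have h := hB _ hxN
        rw [mode_rightField, Lb_eq, ← commute_rTensor_lTensor, ← Lb_eq] at h
        rw [mode_rightField]
        exact h
      rcases hG with rfl | rfl | rfl | rfl
      · change Lb n _ ∈ integralForm
        have h1 := LinearMap.congr_fun (lie_Lb n (k - 1)) x
        rw [lie_apply_end, sub_eq_iff_eq_add, LinearMap.add_apply, LinearMap.smul_apply,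
          LinearMap.smul_apply] at h1
        have h0 : (if n + (k - 1) = 0 then centralCharge / 12 * ((n : K) ^ 3 - (n : K)) else 0) = 0 := by
          rcases hn with rfl | rfl | rfl <;> norm_num
        have e : ∀ j : ℤ, mode (b⁻¹ ^ 2 • Tb) j = b⁻¹ ^ 2 • Lb (j - 1) := fun j => by
          rw [mode_smul, Lb, sub_add_cancel]
        rw [e, LinearMap.smul_apply, map_smul, h1, h0, zero_smul, add_zero, smul_add]
        refine integralForm.add_mem ?_ ?_
        · rw [smul_comm]
          have := (hasLim_el (n + (k - 1))).1 x hx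
          have := integralForm.smul_mem ((n - (k - 1) : ℤ) : O) this
          exact this
        · exact (hasLim_el (k - 1)).1 _ hxN
      · exact hext _ (preserves_gen famE_mem k)
      · exact hext _ (preserves_gen famH_mem k)
      · exact hext _ (preserves_gen famF_mem k)
  exact fun x hx => hN hx

theorem mode_limRegT2 (n : ℤ) : mode (limRegT2 ε) (n + 1) =
    latExt (sl2Op ε n) + (2 * ε) • mode ellE (n + 1) := by
  have h1 : (ε * (n * (n + 1))) • mode limE (n - 1) =
      ε • mode (derivField (derivField limE)) (n + 1) := by
    rw [mode_derivField, mode_derivField, add_sub_cancel_right, smul_smul, ← Int.cast_smul_eq_zsmul ℂ,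
      smul_smul]
    congr 1
    push_cast
    ring
  have h2 : mode (derivField limH) (n + 1) = latExt (mode (derivField (heisField ℂ)) (n + 1)) := by
    rw [mode_derivField, mode_derivField, map_zsmul, isLatField_limH]
  rw [limRegT2, mode_add, mode_add, mode_add, mode_smul, mode_smul, mode_smul, mode_smul, ← h1, sl2Op,
    map_add, map_add, map_smul, map_smul, map_smul, h2, isLatField_limF, isLatField_limE]

theorem hasLim_L2 (hε : ε ≠ 0) {n : ℤ} (hn : n = -1 ∨ n = 0 ∨ n = 1) : HasLim (L2 ε n)
    (latExt (sl2Op ε n) + limitOp (Lb n) + (2 * ε) • mode ellE (n + 1)) := by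
  have h7 : HasRed (b / (b - b⁻¹)) 1 :=
    hasRed_div_sub (HasRed.one.congr (div_self b_ne_zero).symm rfl)
  have t := (hasLimField_regT2 ε hε (n + 1)).add ((preserves_Lb hn).hasLim.smul' h7)
  refine t.congr ?_ ?_
  · rw [L2, T2_eq, mode_add, mode_smul, Lb]
  · rw [mode_limRegT2, one_smul]
    abel

end LimitsOfConformalFields

end Urod

namespace Urod

/-! ### Level-one brackets over ℂ and the sl₂-action on V_{√2ℤ} -/

section SlTwo

theorem lie_h_e (m n : ℤ) : ⁅mode (heisField ℂ) m, mode (eField ℂ) n⁆ =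
    (2 : ℂ) • mode (eField ℂ) (m + n) := by
  rw [hasCharge_eField, add_comm]

theorem lie_h_f (m n : ℤ) : ⁅mode (heisField ℂ) m, mode (fField ℂ) n⁆ =
    (-2 : ℂ) • mode (fField ℂ) (m + n) := by
  rw [hasCharge_fField, add_comm]

theorem lie_e_f (m n : ℤ) : ⁅mode (eField ℂ) m, mode (fField ℂ) n⁆ =
    mode (heisField ℂ) (m + n) + (if m + n = 0 then (m : ℂ) else 0) • 1 := by
  rw [mode_heisField]
  exact lie_exp_neg_exp m n

theorem lie_f_e (m n : ℤ) : ⁅mode (fField ℂ) m, mode (eField ℂ) n⁆ =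
    (-1 : ℂ) • mode (heisField ℂ) (m + n) + (if m + n = 0 then (m : ℂ) else 0) • 1 := by
  rw [lie_swap_end, lie_e_f, add_comm n m]
  split_ifs with h
  · obtain rfl : n = -m := by omega
    push_cast
    module
  · module

theorem lie_f_f (m n : ℤ) : ⁅mode (fField ℂ) m, mode (fField ℂ) n⁆ = 0 :=
  lie_exp_exp_self (by norm_num) m n

theorem lie_e_e (m n : ℤ) : ⁅mode (eField ℂ) m, mode (eField ℂ) n⁆ = 0 :=
  lie_exp_exp_self (by norm_num) m n

theorem lie_latL_e (m n : ℤ) : ⁅latL ℂ m, mode (eField ℂ) n⁆ =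
    -(n : ℂ) • mode (eField ℂ) (m + n) := lie_latL_exp 1 (by norm_num) m n

theorem lie_latL_f (m n : ℤ) : ⁅latL ℂ m, mode (fField ℂ) n⁆ =
    -(n : ℂ) • mode (fField ℂ) (m + n) := lie_latL_exp (-1) (by norm_num) m n

theorem sl2Op_eq (ε : ℂ) (n : ℤ) : sl2Op ε n = -(1 / (2 * ε)) • mode (fField ℂ) (n + 1)
    + (-(((n : ℂ) + 1) / 2)) • mode (heisField ℂ) n + (ε * (n * (n + 1))) • mode (eField ℂ) (n - 1) := by
  have h : mode (derivField (heisField ℂ)) (n + 1) = (-((n : ℂ) + 1)) • mode (heisField ℂ) n := by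
    refine LinearMap.ext fun x => ?_
    rw [mode_derivField, LinearMap.smul_apply, LinearMap.smul_apply, ← Int.cast_smul_eq_zsmul ℂ,
      add_sub_cancel_right]
    push_cast
    rfl
  rw [sl2Op, h]
  module

/-- A finite computation in the current algebra; none of the brackets that occur has a central
contribution. -/
theorem isSl2Action_sl2Op {ε : ℂ} (hε : ε ≠ 0) : IsSl2Action (sl2Op ε) := by
  have e1 : sl2Op ε 1 = -(1 / (2 * ε)) • mode (fField ℂ) 2 - mode (heisField ℂ) 1
      + (2 * ε) • mode (eField ℂ) 0 := by
    rw [sl2Op_eq, one_add_one_eq_two, sub_self]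
    push_cast
    module
  have e0 : sl2Op ε 0 = -(1 / (2 * ε)) • mode (fField ℂ) 1 - (1 / 2 : ℂ) • mode (heisField ℂ) 0 := by
    rw [sl2Op_eq, zero_add]
    push_cast
    module
  have e2 : sl2Op ε (-1) = -(1 / (2 * ε)) • mode (fField ℂ) 0 := by
    rw [sl2Op_eq, neg_add_cancel]
    push_cast
    module
  have hf : ∀ m n, ⁅mode (fField ℂ) m, mode (heisField ℂ) n⁆ = (2 : ℂ) • mode (fField ℂ) (n + m) :=
    fun m n => by rw [lie_swap_end, lie_h_f]; module
  have fe : ⁅mode (fField ℂ) 1, mode (eField ℂ) 0⁆ = -mode (heisField ℂ) 1 := by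
    rw [lie_swap_end, lie_e_f]; simp
  have ef : ⁅mode (eField ℂ) 0, mode (fField ℂ) 0⁆ = mode (heisField ℂ) 0 := by
    rw [lie_e_f]; simp
  have hh : ⁅mode (heisField ℂ) 0, mode (heisField ℂ) 1⁆ = 0 := by
    rw [isHeisenberg_heisField]; simp
  refine ⟨?_, ?_, ?_⟩
  · rw [e1, e0, e2]
    simp only [add_lie_end, sub_lie_end, smul_lie_end, lie_smul_end, lie_f_f, lie_h_f, ef]
    norm_num
    match_scalars
    all_goals field_simp
  · rw [e0, e2]
    simp only [sub_lie_end, smul_lie_end, lie_smul_end, lie_f_f, lie_h_f]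
    norm_num
    match_scalars <;> field_simp
  · rw [e0, e1]
    simp only [sub_lie_end, lie_add_end, lie_sub_end, smul_lie_end, lie_smul_end, lie_f_f,
      lie_h_f, fe, hf, hh, lie_h_e]
    norm_num
    match_scalars <;> field_simp <;> ring

end SlTwo

/-! ### Brackets with :ℓe: and the Virasoro relations of the limit -/

section Brackets

/-- The modes of `ℓ(z) e(z)`. -/
abbrev ellEMode (n : ℤ) : Module.End ℂ Limit := mode ellE (n + 1)

theorem lie_ellE_apply (D : Module.End ℂ Limit) (n : ℤ) (x : Limit) :
    (Function.support fun k : ℤ => ⁅D, el k * mode limE (n - k - 1)⁆ x).Finite ∧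
    ⁅D, ellEMode n⁆ x = ∑ᶠ k : ℤ, ⁅D, el k * mode limE (n - k - 1)⁆ x := by
  obtain ⟨f1, e1⟩ := mode_normOrd_elField isLatField_limE n x
  obtain ⟨f2, e2⟩ := mode_normOrd_elField isLatField_limE n (D x)
  have f1' : (Function.support fun k : ℤ => D (el k (mode limE (n - k - 1) x))).Finite :=
    f1.subset fun k hk h => hk (by
      change el k (mode limE (n - k - 1) x) = 0 at h
      change D (el k (mode limE (n - k - 1) x)) = 0
      rw [h, map_zero])
  refine ⟨(f1'.union f2).subset (Function.support_sub _ _), ?_⟩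
  rw [lie_apply_end, ellEMode, ellE, e1, e2]
  have := D.toAddMonoidHom.map_finsum f1
  simp only [LinearMap.toAddMonoidHom_coe] at this
  rw [this, ← finsum_sub_distrib f1' f2]
  rfl

theorem lie_ellE_apply_of_comm {D : Module.End ℂ Limit} (hD : ∀ k, ⁅D, el k⁆ = 0) (n : ℤ) (x : Limit) :
    (Function.support fun k : ℤ => el k (⁅D, mode limE (n - k - 1)⁆ x)).Finite ∧
    ⁅D, ellEMode n⁆ x = ∑ᶠ k : ℤ, el k (⁅D, mode limE (n - k - 1)⁆ x) := by
  have := lie_ellE_apply D n x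
  simp only [lie_mul_end, hD, zero_mul, zero_add] at this
  exact this

theorem ellEMode_apply (n : ℤ) (x : Limit) :
    (Function.support fun k : ℤ => el k (mode limE (n - k - 1) x)).Finite ∧
    ellEMode n x = ∑ᶠ k : ℤ, el k (mode limE (n - k - 1) x) :=
  mode_normOrd_elField isLatField_limE n x

theorem lie_latExt_ellE_apply (A : Module.End ℂ (LatVOA ℂ)) (n : ℤ) (x : Limit) :
    (Function.support fun k : ℤ => el k (latExt ⁅A, mode (eField ℂ) (n - k - 1)⁆ x)).Finite ∧
    ⁅latExt A, ellEMode n⁆ x = ∑ᶠ k : ℤ, el k (latExt ⁅A, mode (eField ℂ) (n - k - 1)⁆ x) := by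
  have := lie_ellE_apply_of_comm (lie_latExt_el A) n x
  simp only [isLatField_limE _, lie_latExt] at this
  exact this

theorem lie_el_ellE (k n : ℤ) : ⁅el k, ellEMode n⁆ = 0 := by
  refine LinearMap.ext fun x => ?_
  rw [(lie_ellE_apply_of_comm (lie_el_el k) n x).2]
  refine finsum_eq_zero_of_forall_eq_zero fun j => ?_
  rw [isLatField_limE, lie_swap_end, lie_latExt_el, neg_zero, LinearMap.zero_apply, map_zero]

theorem lie_ellE_ellE (m n : ℤ) : ⁅ellEMode m, ellEMode n⁆ = 0 := by
  have h : ∀ j, ⁅ellEMode m, mode limE j⁆ = 0 := fun j => by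
    rw [lie_swap_end, neg_eq_zero]
    refine LinearMap.ext fun x => ?_
    rw [isLatField_limE, (lie_latExt_ellE_apply _ m x).2]
    refine finsum_eq_zero_of_forall_eq_zero fun j => ?_
    rw [lie_e_e, map_zero, LinearMap.zero_apply, map_zero]
  refine LinearMap.ext fun x => ?_
  rw [(lie_ellE_apply_of_comm (fun k => by rw [lie_swap_end, lie_el_ellE, neg_zero]) n x).2]
  refine finsum_eq_zero_of_forall_eq_zero fun j => ?_
  rw [h, LinearMap.zero_apply, map_zero]

theorem lie_h_ellE (m n : ℤ) : ⁅latExt (mode (heisField ℂ) m), ellEMode n⁆ =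
    (2 : ℂ) • ellEMode (m + n) := by
  refine LinearMap.ext fun x => ?_
  obtain ⟨f, e⟩ := ellEMode_apply (m + n) x
  rw [(lie_latExt_ellE_apply _ n x).2, LinearMap.smul_apply, e, smul_finsum' _ f]
  refine finsum_congr fun k => ?_
  rw [lie_h_e, map_smul, LinearMap.smul_apply, map_smul, isLatField_limE,
    show m + (n - k - 1) = m + n - k - 1 by ring]

/-- One bracket alone has coefficients depending on k and is not a mode of :ℓe:. In the
antisymmetrized combination, which is all that the Virasoro relations need, k cancels. -/
theorem lie_latL_ellE (m n : ℤ) : ⁅latExt (latL ℂ m), ellEMode n⁆ =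
    ⁅latExt (latL ℂ n), ellEMode m⁆ + ((m : ℂ) - n) • ellEMode (m + n) := by
  refine LinearMap.ext fun x => ?_
  obtain ⟨f, e⟩ := ellEMode_apply (m + n) x
  obtain ⟨f1, e1⟩ := lie_latExt_ellE_apply (latL ℂ m) n x
  obtain ⟨f2, e2⟩ := lie_latExt_ellE_apply (latL ℂ n) m x
  rw [LinearMap.add_apply, LinearMap.smul_apply, e, e1, e2, smul_finsum' _ f, ← sub_eq_iff_eq_add',
    ← finsum_sub_distrib f1 f2]
  refine finsum_congr fun k => ?_
  rw [lie_latL_e, lie_latL_e, map_smul, map_smul, LinearMap.smul_apply, LinearMap.smul_apply,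
    map_smul, map_smul, isLatField_limE, show m + (n - k - 1) = m + n - k - 1 by ring,
    show n + (m - k - 1) = m + n - k - 1 by ring, ← sub_smul]
  congr 1
  push_cast
  ring

/-- The central term of [f, e] contributes for the single index k = m+n and leaves a multiple of
ℓₘ₊ₙ. The :ℓh: part depends only on m+n and cancels under antisymmetrization. -/
theorem lie_f_ellE (m n : ℤ) : ⁅latExt (mode (fField ℂ) (m + 1)), ellEMode n⁆ =
    ((m : ℂ) + 1) • el (m + n) - mode (normOrd elField limH) (m + n + 2) := by
  refine LinearMap.ext fun x => ?_
  obtain ⟨f, e⟩ := mode_normOrd_elField isLatField_limH (m + n + 1) x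
  have key : ∀ k : ℤ, el k (latExt ⁅mode (fField ℂ) (m + 1), mode (eField ℂ) (n - k - 1)⁆ x) =
      (if k = m + n then (((m : ℂ) + 1) • el (m + n)) x else 0) -
        el k (mode limH (m + n + 1 - k - 1) x) := by
    intro k
    rw [lie_f_e, isLatField_limH, show m + 1 + (n - k - 1) = m + n + 1 - k - 1 by ring]
    simp only [map_add, map_smul, map_one, LinearMap.add_apply, LinearMap.smul_apply,
      Module.End.one_apply]
    by_cases h : k = m + n
    · subst h
      rw [if_pos (by ring), if_pos rfl]
      push_cast
      module
    · rw [if_neg (by omega), if_neg h]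
      module
  have f3 := finsum_ite_eq_apply ((((m : ℂ) + 1) • el (m + n)) x) (m + n)
  rw [(lie_latExt_ellE_apply _ n x).2, finsum_congr key, finsum_sub_distrib f3.1 f, f3.2,
    LinearMap.sub_apply, show m + n + 2 = m + n + 1 + 1 by ring, e]

/-- The two brackets of (1/2ε)f with -2ε:ℓe: add up to -(m-n)ℓₘ₊ₙ, as required by the summand -ℓₙ.
The central charge 1 comes only from the lattice Virasoro operators. -/
theorem lie_limitL1 {ε : ℂ} (hε : ε ≠ 0) (m n : ℤ) : ⁅limitOp (L1 ε m), limitOp (L1 ε n)⁆ =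
    ((m : ℂ) - n) • limitOp (L1 ε (m + n)) +
      (if m + n = 0 then ((m : ℂ) ^ 3 - m) / 12 else 0) • (1 : Module.End ℂ Limit) := by
  rw [(hasLim_L1 ε hε m).2, (hasLim_L1 ε hε n).2, (hasLim_L1 ε hε (m + n)).2]
  have hff : ⁅latExt (mode (fField ℂ) (m + 1)), latExt (mode (fField ℂ) (n + 1))⁆ = 0 := by
    rw [lie_latExt, lie_f_f, map_zero]
  have hLf : ∀ m n : ℤ, ⁅latExt (latL ℂ m), latExt (mode (fField ℂ) (n + 1))⁆ =
      -((n : ℂ) + 1) • latExt (mode (fField ℂ) (m + n + 1)) := fun m n => by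
    rw [lie_latExt, lie_latL_f, map_smul, ← add_assoc]
    push_cast
    rfl
  have hfL : ⁅latExt (mode (fField ℂ) (m + 1)), latExt (latL ℂ n)⁆ =
      ((m : ℂ) + 1) • latExt (mode (fField ℂ) (m + n + 1)) := by
    rw [lie_swap_end, hLf, add_comm n m]
    module
  have hLL : ⁅latExt (latL ℂ m), latExt (latL ℂ n)⁆ = ((m : ℂ) - n) • latExt (latL ℂ (m + n)) +
      (if m + n = 0 then ((m : ℂ) ^ 3 - m) / 12 else 0) • (1 : Module.End ℂ Limit) := by
    rw [lie_latExt, lie_latL_latL, map_add, map_smul, map_smul, map_one]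
  have hlA : ∀ (k : ℤ) A, ⁅el k, latExt A⁆ = 0 := fun k A => by
    rw [lie_swap_end, lie_latExt_el, neg_zero]
  have hSl : ∀ k : ℤ, ⁅ellEMode m, el k⁆ = 0 := fun k => by
    rw [lie_swap_end, lie_el_ellE, neg_zero]
  have hSf : ⁅ellEMode m, latExt (mode (fField ℂ) (n + 1))⁆ =
      -(((n : ℂ) + 1) • el (m + n) - mode (normOrd elField limH) (m + n + 2)) := by
    rw [lie_swap_end, lie_f_ellE, add_comm n m]
  have hSL : ⁅ellEMode m, latExt (latL ℂ n)⁆ = -⁅latExt (latL ℂ n), ellEMode m⁆ := lie_swap_end _ _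
  have hLS := lie_latL_ellE m n
  have hfS := lie_f_ellE m n
  have hSS := lie_ellE_ellE m n
  have hlS := lie_el_ellE m n
  simp only [ellEMode] at hSf hSL hLS hfS hSS hlS hSl
  simp only [add_lie_end, sub_lie_end, lie_add_end, lie_sub_end, smul_lie_end, lie_smul_end, hff, hLf,
    hfL, hLL, hlA, hSl, hSf, hSL, hLS, hfS, hSS, hlS, lie_el_el, lie_latExt_el]
  match_scalars <;> field_simp <;> ring

end Brackets

end Urod

namespace Urod

/-! ### The sl₂-action on the limit -/

section SlTwoLimit

/-- The limit of `Lₙ^(b)` for `n = -1, 0, 1`. -/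
def limLb (n : ℤ) : Module.End ℂ Limit := limitOp (Lb n)

theorem hasLim_Lb {n : ℤ} (hn : n = -1 ∨ n = 0 ∨ n = 1) : HasLim (Lb n) (limLb n) :=
  (preserves_Lb hn).hasLim

theorem lie_Lb_of_index {m : ℤ} (hm : m = -1 ∨ m = 0 ∨ m = 1) (n : ℤ) :
    ⁅Lb m, Lb n⁆ = ((m - n : ℤ) : K) • Lb (m + n) := by
  have h0 : (if m + n = 0 then centralCharge / 12 * ((m : K) ^ 3 - (m : K)) else 0) = 0 := by
    rcases hm with rfl | rfl | rfl <;> norm_num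
  rw [lie_Lb, h0, zero_smul, add_zero]

theorem lie_limLb_limLb {m n : ℤ} (hm : m = -1 ∨ m = 0 ∨ m = 1) (hn : n = -1 ∨ n = 0 ∨ n = 1)
    (hmn : m + n = -1 ∨ m + n = 0 ∨ m + n = 1) :
    ⁅limLb m, limLb n⁆ = ((m : ℂ) - n) • limLb (m + n) := by
  refine ((hasLim_Lb hm).lie (hasLim_Lb hn)).unique ?_
  rw [lie_Lb_of_index hm]
  have := (hasLim_Lb hmn).smul' (HasRed.intCast (m - n))
  exact this.congr rfl (by push_cast; rfl)

theorem lie_limLb_el {m : ℤ} (hm : m = -1 ∨ m = 0 ∨ m = 1) (n : ℤ) :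
    ⁅limLb m, el n⁆ = ((m : ℂ) - n) • el (m + n) := by
  refine ((hasLim_Lb hm).lie (hasLim_el n)).unique ?_
  rw [lie_smul_end, lie_Lb_of_index hm]
  have := (hasLim_el (m + n)).smul' (HasRed.intCast (m - n))
  refine this.congr (smul_comm _ _ _) (by push_cast; rfl)

theorem lie_limLb_latExt {m : ℤ} (hm : m = -1 ∨ m = 0 ∨ m = 1) {A : Module.End K (LatVOA K)}
    {A' : Module.End ℂ (LatVOA ℂ)} (hA : IsExtension A A') : ⁅limLb m, latExt A'⁆ = 0 := by
  refine ((hasLim_Lb hm).lie (hasLim_lat hA)).unique (HasLim.zero.congr ?_ rfl)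
  rw [Lb_eq, lie_rTensor_lTensor]

theorem IsExtension.add {A B : Module.End K (LatVOA K)} {A' B' : Module.End ℂ (LatVOA ℂ)}
    (hA : IsExtension A A') (hB : IsExtension B B') : IsExtension (A + B) (A' + B') := fun v => by
  rw [LinearMap.add_apply, LinearMap.add_apply, hA, hB, map_add]

theorem IsExtension.smul {A : Module.End K (LatVOA K)} {A' : Module.End ℂ (LatVOA ℂ)} (c : ℂ)
    (hA : IsExtension A A') : IsExtension (RatFunc.C c • A) (c • A') := fun v => by
  rw [LinearMap.smul_apply, LinearMap.smul_apply, hA, mapLat_smul]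

theorem exists_isExtension_sl2Op (ε : ℂ) (n : ℤ) : ∃ A, IsExtension A (sl2Op ε n) := by
  have h := (((isExtension_exp (-1) (n + 1)).smul (-(1 / (2 * ε)))).add
    ((isExtension_heis n).smul (-(((n : ℂ) + 1) / 2)))).add
    ((isExtension_exp 1 (n - 1)).smul (ε * (n * (n + 1))))
  refine ⟨_, fun v => (h v).trans ?_⟩
  rw [sl2Op_eq]
  congr 1

theorem lie_limLb_sl2Op {m : ℤ} (hm : m = -1 ∨ m = 0 ∨ m = 1) (ε : ℂ) (n : ℤ) :
    ⁅limLb m, latExt (sl2Op ε n)⁆ = 0 := by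
  obtain ⟨A, hA⟩ := exists_isExtension_sl2Op ε n
  exact lie_limLb_latExt hm hA

/-- Lₘ acts only on the factor ℓₖ and raises its index by m; reindexing turns the coefficient m-k
into 2m-k. -/
theorem lie_limLb_ellE_apply {m : ℤ} (hm : m = -1 ∨ m = 0 ∨ m = 1) (n : ℤ) (x : Limit) :
    (Function.support fun k : ℤ => (2 * (m : ℂ) - k) • el k (mode limE (m + n - k - 1) x)).Finite ∧
    ⁅limLb m, ellEMode n⁆ x =
      ∑ᶠ k : ℤ, (2 * (m : ℂ) - k) • el k (mode limE (m + n - k - 1) x) := by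
  have hE : ∀ j, ⁅limLb m, mode limE j⁆ = 0 := fun j => by
    rw [isLatField_limE]
    exact lie_limLb_latExt hm (isExtension_exp 1 j)
  obtain ⟨f, e⟩ := lie_ellE_apply (limLb m) n x
  have key : ∀ k, ⁅limLb m, el k * mode limE (n - k - 1)⁆ x =
      (2 * (m : ℂ) - (k + m : ℤ)) • el (k + m) (mode limE (m + n - (k + m) - 1) x) := fun k => by
    rw [lie_mul_end, hE, mul_zero, add_zero, lie_limLb_el hm, smul_mul_assoc, LinearMap.smul_apply,
      Module.End.mul_apply, add_comm m k, show m + n - (k + m) - 1 = n - k - 1 by ring]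
    congr 1
    push_cast
    ring
  rw [e, finsum_congr key]
  refine ⟨finite_support_smul (ellEMode_apply (m + n) x).1 _, ?_⟩
  exact finsum_comp_equiv (Equiv.addRight m)
    (f := fun k : ℤ => (2 * (m : ℂ) - k) • el k (mode limE (m + n - k - 1) x))

theorem lie_limLb_ellE {m n : ℤ} (hm : m = -1 ∨ m = 0 ∨ m = 1) (hn : n = -1 ∨ n = 0 ∨ n = 1) :
    ⁅limLb m, ellEMode n⁆ = ⁅limLb n, ellEMode m⁆ + (2 * ((m : ℂ) - n)) • ellEMode (m + n) := by
  refine LinearMap.ext fun x => ?_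
  obtain ⟨f, e⟩ := ellEMode_apply (m + n) x
  obtain ⟨f1, e1⟩ := lie_limLb_ellE_apply hm n x
  obtain ⟨f2, e2⟩ := lie_limLb_ellE_apply hn m x
  rw [LinearMap.add_apply, LinearMap.smul_apply, e, e1, e2, smul_finsum' _ f, ← sub_eq_iff_eq_add',
    ← finsum_sub_distrib f1 f2]
  refine finsum_congr fun k => ?_
  rw [add_comm n m, ← sub_smul]
  congr 1
  ring

/-- For m+n ≥ -1 the term ℓₘ₊ₙ vanishes and the :ℓh: part is symmetric. What remains, -(m-n):ℓe:,
combines with 2(m-n):ℓe: from `lie_limLb_ellE` to the required (m-n):ℓe:. -/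
theorem lie_sl2Op_ellE (ε : ℂ) {m n : ℤ} (hmn : -1 ≤ m + n) :
    ⁅latExt (sl2Op ε m), ellEMode n⁆ =
      ⁅latExt (sl2Op ε n), ellEMode m⁆ - ((m : ℂ) - n) • ellEMode (m + n) := by
  have h : ∀ m n : ℤ, -1 ≤ m + n → ⁅latExt (sl2Op ε m), ellEMode n⁆ =
      (1 / (2 * ε)) • mode (normOrd elField limH) (m + n + 2) - ((m : ℂ) + 1) • ellEMode (m + n) := by
    intro m n hmn
    have he : ⁅latExt (mode (eField ℂ) (m - 1)), ellEMode n⁆ = 0 := by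
      refine LinearMap.ext fun x => ?_
      rw [(lie_latExt_ellE_apply _ n x).2]
      refine finsum_eq_zero_of_forall_eq_zero fun j => ?_
      rw [lie_e_e, map_zero, LinearMap.zero_apply, map_zero]
    rw [sl2Op_eq, map_add, map_add, map_smul, map_smul, map_smul, add_lie_end, add_lie_end, smul_lie_end,
      smul_lie_end, smul_lie_end, he, lie_h_ellE, lie_f_ellE, el_eq_zero hmn]
    module
  rw [h m n hmn, h n m (by omega), add_comm n m]
  module

theorem limitL2_eq {ε : ℂ} (hε : ε ≠ 0) {n : ℤ} (hn : n = -1 ∨ n = 0 ∨ n = 1) :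
    limitOp (L2 ε n) = latExt (sl2Op ε n) + limLb n + (2 * ε) • ellEMode n :=
  (hasLim_L2 ε hε hn).2

theorem lie_limitL2_el {ε : ℂ} (hε : ε ≠ 0) {n : ℤ} (hn : n = -1 ∨ n = 0 ∨ n = 1) (k : ℤ) :
    ⁅limitOp (L2 ε n), el k⁆ = ((n : ℂ) - k) • el (n + k) := by
  have hSl : ⁅ellEMode n, el k⁆ = 0 := by rw [lie_swap_end, lie_el_ellE, neg_zero]
  rw [limitL2_eq hε hn, add_lie_end, add_lie_end, smul_lie_end, hSl, lie_latExt_el, lie_limLb_el hn]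
  module

theorem lie_limitL2 {ε : ℂ} (hε : ε ≠ 0) {m n : ℤ} (hm : m = -1 ∨ m = 0 ∨ m = 1) (hn : n = -1 ∨ n = 0 ∨ n = 1)
    (hmn : m + n = -1 ∨ m + n = 0 ∨ m + n = 1)
    (h : ⁅sl2Op ε m, sl2Op ε n⁆ = ((m : ℂ) - n) • sl2Op ε (m + n)) :
    ⁅limitOp (L2 ε m), limitOp (L2 ε n)⁆ = ((m : ℂ) - n) • limitOp (L2 ε (m + n)) := by
  have hA : ⁅latExt (sl2Op ε m), latExt (sl2Op ε n)⁆ = ((m : ℂ) - n) • latExt (sl2Op ε (m + n)) := by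
    rw [lie_latExt, h, map_smul]
  have hAL : ⁅latExt (sl2Op ε m), limLb n⁆ = 0 := by
    rw [lie_swap_end, lie_limLb_sl2Op hn, neg_zero]
  have hSA : ⁅ellEMode m, latExt (sl2Op ε n)⁆ = -⁅latExt (sl2Op ε n), ellEMode m⁆ := lie_swap_end _ _
  have hSL : ⁅ellEMode m, limLb n⁆ = -⁅limLb n, ellEMode m⁆ := lie_swap_end _ _
  have hAS := lie_sl2Op_ellE ε (m := m) (n := n) (by omega)
  have hLS := lie_limLb_ellE hm hn
  rw [limitL2_eq hε hm, limitL2_eq hε hn, limitL2_eq hε hmn]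
  simp only [add_lie_end, lie_add_end, smul_lie_end, lie_smul_end, hA, hAL, hSA, hSL, hAS, hLS,
    lie_limLb_sl2Op hm, lie_limLb_limLb hm hn hmn, lie_ellE_ellE]
  module

theorem isSl2Action_limitL2 {ε : ℂ} (hε : ε ≠ 0) : IsSl2Action fun n => limitOp (L2 ε n) := by
  obtain ⟨h1, h2, h3⟩ := isSl2Action_sl2Op hε
  refine ⟨?_, ?_, ?_⟩
  · have := lie_limitL2 hε (m := 1) (n := -1) (by norm_num) (by norm_num) (by norm_num)
      (by rw [h1]; norm_num)
    rw [this]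
    norm_num
  · have := lie_limitL2 hε (m := 0) (n := -1) (by norm_num) (by norm_num) (by norm_num)
      (by rw [h2]; norm_num)
    rw [this]
    norm_num
  · have := lie_limitL2 hε (m := 0) (n := 1) (by norm_num) (by norm_num) (by norm_num)
      (by rw [h3]; norm_num; module)
    rw [this]
    norm_num

end SlTwoLimit

end Urod

namespace Urod

/-! ### Centrality and lattice states in the limit -/

section Centrality

theorem Intertwines.smul {R V V' : Type*} [CommRing R] [AddCommGroup V] [Module R V]
    [AddCommGroup V'] [Module R V'] (φ : V →ₗ[R] V') {A : VertexOperator R V}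
    {A' : VertexOperator R V'} (hA : Intertwines φ.toAddMonoidHom A A') (r : R) :
    Intertwines φ.toAddMonoidHom (r • A) (r • A') := fun n x => by
  have h : φ (mode A n x) = mode A' n (φ x) := hA n x
  change φ (mode (r • A) n x) = mode (r • A') n (φ x)
  rw [mode_smul, mode_smul, LinearMap.smul_apply, LinearMap.smul_apply, map_smul, h]

theorem IsLatField.commute_el {A' : VertexOperator ℂ Limit} {A : VertexOperator ℂ (LatVOA ℂ)}
    (hA : IsLatField A' A) (n : ℤ) : Intertwines (el n).toAddMonoidHom A' A' := fun k x => by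
  have h := LinearMap.congr_fun (lie_latExt_el (mode A k) n) x
  rw [lie_apply_end, LinearMap.zero_apply, sub_eq_zero] at h
  rw [hA]
  exact h.symm

/-- Commuting with a fixed operator means that this operator intertwines the field with itself, a
property inherited by all products of the generators. -/
theorem StateField.intertwines_el {a : Limit} {A : VertexOperator ℂ Limit}
    (h : StateField limitVacuum limitGens a A) (n : ℤ) : Intertwines (el n).toAddMonoidHom A A := by
  induction h with
  | vacuum => exact Intertwines.idField _
  | gen A hA =>
    rcases hA with rfl | rfl | rfl | rfl
    · intro k x
      change el n (mode elField k x) = mode elField k (el n x)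
      rw [mode_elField]
      exact el_apply_comm _ _ x
    · exact isLatField_limE.commute_el n
    · exact isLatField_limH.commute_el n
    · exact isLatField_limF.commute_el n
  | add a b A B _ _ hA hB => exact hA.add hB
  | smul r a A _ hA => exact Intertwines.smul (el n) hA r
  | nprod p a b A B _ _ hA hB => exact hA.nprod p hB

end Centrality

section Trivialization

theorem latExt_section (A : Module.End ℂ (LatVOA ℂ)) (v : LatVOA ℂ) :
    latExt A (trivialization.symm (1 ⊗ₜ[ℂ] v)) = trivialization.symm (1 ⊗ₜ[ℂ] A v) := by
  rw [LinearEquiv.eq_symm_apply, trivialization_latExt, LinearEquiv.apply_symm_apply,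
    LinearMap.lTensor_tmul]

theorem symm_vacuum : trivialization.symm (1 ⊗ₜ[ℂ] latVacuum ℂ) = limitVacuum := by
  rw [← trivialization_vacuum, LinearEquiv.symm_apply_apply]

/-- Induction on the construction of the field: each lattice generator has its limit as counterpart,
and the correspondence is compatible with sums, scalars and products. -/
theorem exists_stateField_limit {v : LatVOA ℂ} {A : VertexOperator ℂ (LatVOA ℂ)}
    (h : StateField (latVacuum ℂ) (latGens ℂ) v A) : ∃ B : VertexOperator ℂ Limit,
      StateField limitVacuum limitGens (trivialization.symm (1 ⊗ₜ[ℂ] v)) B ∧ IsLatField B A := by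
  induction h with
  | vacuum =>
    refine ⟨idField, ?_, fun n => ?_⟩
    · rw [symm_vacuum]
      exact StateField.vacuum
    · rw [mode_idField, mode_idField]
      split_ifs
      · exact (map_one latExt).symm
      · exact (map_zero latExt).symm
  | gen A hA =>
    have key : ∀ {B : VertexOperator ℂ Limit}, B ∈ limitGens → IsLatField B A →
        ∃ B : VertexOperator ℂ Limit, StateField limitVacuum limitGens
          (trivialization.symm (1 ⊗ₜ[ℂ] mode A (-1) (latVacuum ℂ))) B ∧ IsLatField B A :=
      fun {B} hB hBA => by
      refine ⟨B, ?_, hBA⟩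
      rw [← latExt_section, symm_vacuum, ← hBA]
      exact StateField.gen B hB
    rcases hA with rfl | rfl | rfl
    · exact key (limitField_gen_mem famE_mem) isLatField_limE
    · exact key (limitField_gen_mem famH_mem) isLatField_limH
    · exact key (limitField_gen_mem famF_mem) isLatField_limF
  | add a b A B _ _ hA hB =>
    obtain ⟨A', hA, hA'⟩ := hA
    obtain ⟨B', hB, hB'⟩ := hB
    refine ⟨A' + B', ?_, fun n => ?_⟩
    · rw [TensorProduct.tmul_add, map_add]
      exact hA.add _ _ _ _ hB
    · rw [mode_add, mode_add, map_add, hA', hB']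
  | smul r a A _ hA =>
    obtain ⟨A', hA, hA'⟩ := hA
    refine ⟨r • A', ?_, fun n => ?_⟩
    · rw [TensorProduct.tmul_smul, map_smul]
      exact hA.smul r _ _
    · rw [mode_smul, mode_smul, map_smul, hA']
  | nprod p a b A B _ _ hA hB =>
    obtain ⟨A', hA, hA'⟩ := hA
    obtain ⟨B', hB, hB'⟩ := hB
    refine ⟨nprod A' p B', ?_, hA'.nprod hB' p⟩
    rw [← latExt_section, ← hA']
    exact hA.nprod p _ _ _ _ hB

end Trivialization

/-! ### Fibres over Sturm-Liouville operators -/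

section Fibres

/-- The evaluation of a `V_{√2ℤ}`-valued function at a Sturm-Liouville operator. -/
def fibreMap (q : SturmLiouville) : Limit →ₗ[ℂ] LatVOA ℂ :=
  (TensorProduct.lift ((LinearMap.lsmul ℂ (LatVOA ℂ)).comp (evalAt q).toLinearMap)).comp
    trivialization.toLinearMap

@[simp]
theorem fibreMap_symm_tmul (q : SturmLiouville) (p : MvPolynomial ℕ ℂ) (v : LatVOA ℂ) :
    fibreMap q (trivialization.symm (p ⊗ₜ[ℂ] v)) = evalAt q p • v := by
  simp [fibreMap]

theorem limit_tensor_induction {p : Limit → Prop} (hadd : ∀ x y, p x → p y → p (x + y))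
    (htmul : ∀ P v, p (trivialization.symm (P ⊗ₜ[ℂ] v))) (x : Limit) : p x := by
  obtain ⟨y, rfl⟩ := trivialization.symm.surjective x
  induction y using TensorProduct.induction_on with
  | zero =>
    have := htmul 0 0
    rwa [TensorProduct.zero_tmul] at this
  | tmul P v => exact htmul P v
  | add x y hx hy =>
    rw [map_add]
    exact hadd _ _ hx hy

theorem fibreMap_latExt (q : SturmLiouville) (A : Module.End ℂ (LatVOA ℂ)) (x : Limit) :
    fibreMap q (latExt A x) = A (fibreMap q x) := by
  induction x using limit_tensor_induction with
  | hadd x y hx hy => rw [map_add, map_add, hx, hy, map_add, map_add]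
  | htmul P v =>
    have : latExt A (trivialization.symm (P ⊗ₜ[ℂ] v)) = trivialization.symm (P ⊗ₜ[ℂ] A v) := by
      rw [LinearEquiv.eq_symm_apply, trivialization_latExt, LinearEquiv.apply_symm_apply,
        LinearMap.lTensor_tmul]
    rw [this, fibreMap_symm_tmul, fibreMap_symm_tmul, map_smul]

theorem el_symm_tmul (n : ℤ) (P : MvPolynomial ℕ ℂ) (v : LatVOA ℂ) :
    el n (trivialization.symm (P ⊗ₜ[ℂ] v)) = trivialization.symm ((coord n * P) ⊗ₜ[ℂ] v) := by
  rw [LinearEquiv.eq_symm_apply, trivialization_el, LinearEquiv.apply_symm_apply,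
    LinearMap.rTensor_tmul, LinearMap.mulLeft_apply]

theorem evalAt_coord {q : SturmLiouville} (hq : q.IsRegular) (n : ℤ) :
    evalAt q (coord n) = q.coeff n := by
  rw [coord]
  split_ifs with h
  · rw [evalAt, MvPolynomial.aeval_X]
    congr 1
    omega
  · rw [map_zero, hq n (by omega)]

theorem fibreMap_el {q : SturmLiouville} (hq : q.IsRegular) (n : ℤ) (x : Limit) :
    fibreMap q (el n x) = q.coeff n • fibreMap q x := by
  induction x using limit_tensor_induction with
  | hadd x y hx hy => rw [map_add, map_add, hx, hy, map_add, smul_add]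
  | htmul P v =>
    rw [el_symm_tmul, fibreMap_symm_tmul, fibreMap_symm_tmul, map_mul, evalAt_coord hq, mul_smul]

theorem fibreMap_surjective (q : SturmLiouville) : Function.Surjective (fibreMap q) := fun v =>
  ⟨trivialization.symm (1 ⊗ₜ[ℂ] v), by rw [fibreMap_symm_tmul, map_one, one_smul]⟩

theorem mem_fibreRel {ε : ℂ} (hε : ε ≠ 0) (q : SturmLiouville) (n : ℤ) (x : Limit) :
    el n x - q.coeff n • x ∈ fibreRel ε q := by
  refine Submodule.mem_iSup_of_mem n ⟨x, ?_⟩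
  rw [ell_eq ε hε]
  rfl

/-- Modulo the relations ℓₙ = qₙ every p(ℓ)v equals p(q)v, by induction on p. An element whose
evaluation vanishes is therefore a combination of relations. -/
theorem ker_fibreMap {ε : ℂ} (hε : ε ≠ 0) {q : SturmLiouville} (hq : q.IsRegular) :
    LinearMap.ker (fibreMap q) = fibreRel ε q := by
  refine le_antisymm (fun x hx => ?_) (iSup_le fun n => ?_)
  · have key : x - trivialization.symm (1 ⊗ₜ[ℂ] fibreMap q x) ∈ fibreRel ε q := by
      clear hx
      induction x using limit_tensor_induction with
      | hadd x y hx hy =>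
        rw [map_add, TensorProduct.tmul_add, map_add, add_sub_add_comm]
        exact Submodule.add_mem _ hx hy
      | htmul P v =>
        rw [fibreMap_symm_tmul]
        induction P using MvPolynomial.induction_on with
        | C a =>
          rw [MvPolynomial.algHom_C, ← mul_one (MvPolynomial.C a), ← MvPolynomial.smul_eq_C_mul,
            TensorProduct.smul_tmul, Algebra.algebraMap_self_apply, sub_self]
          exact Submodule.zero_mem _
        | add P Q hP hQ =>
          rw [map_add, add_smul, TensorProduct.add_tmul, TensorProduct.tmul_add, map_add, map_add,
            add_sub_add_comm]
          exact Submodule.add_mem _ hP hQ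
        | mul_X P k hP =>
          have hc : coord (-k - 2) = MvPolynomial.X k := by
            rw [coord, if_pos (by omega)]
            congr 1
            omega
          have he : evalAt q (MvPolynomial.X k) = q.coeff (-k - 2) := by rw [← hc, evalAt_coord hq]
          have h1 := mem_fibreRel hε q (-k - 2) (trivialization.symm (P ⊗ₜ[ℂ] v))
          have h2 := Submodule.smul_mem _ (q.coeff (-k - 2)) hP
          have h3 := Submodule.add_mem _ h1 h2
          rw [el_symm_tmul, hc, mul_comm, smul_sub, sub_add_sub_cancel, ← map_smul trivialization.symm,
            ← TensorProduct.tmul_smul, smul_smul, ← he,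
            ← map_mul, mul_comm (MvPolynomial.X k) P] at h3
          exact h3
    rw [LinearMap.mem_ker] at hx
    rwa [hx, TensorProduct.tmul_zero, map_zero, sub_zero] at key
  · rintro _ ⟨x, rfl⟩
    rw [LinearMap.mem_ker, LinearMap.sub_apply, ell_eq ε hε, LinearMap.smul_apply, LinearMap.id_apply,
      map_sub, map_smul, fibreMap_el hq, sub_self]

/-- The fibre over a regular Sturm-Liouville operator is `V_{√2ℤ}`. -/
def fibreEquiv {ε : ℂ} (hε : ε ≠ 0) {q : SturmLiouville} (hq : q.IsRegular) :
    Fibre ε q ≃ₗ[ℂ] LatVOA ℂ :=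
  (Submodule.quotEquivOfEq _ _ (ker_fibreMap hε hq).symm).trans
    ((fibreMap q).quotKerEquivOfSurjective (fibreMap_surjective q))

theorem fibreEquiv_toFibre {ε : ℂ} (hε : ε ≠ 0) {q : SturmLiouville} (hq : q.IsRegular) (x : Limit) :
    fibreEquiv hε hq (toFibre ε q x) = fibreMap q x := rfl

/-- For n ≥ -1 one has ℓₙ = 0, so a nonzero qₙ puts every x = -qₙ⁻¹(ℓₙ - qₙ)x into the relations. -/
theorem nontrivial_fibre_iff {ε : ℂ} (hε : ε ≠ 0) (q : SturmLiouville) :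
    Nontrivial (Fibre ε q) ↔ q.IsRegular := by
  constructor
  · intro h n hn
    by_contra hq
    rw [Submodule.Quotient.nontrivial_iff] at h
    refine h (eq_top_iff.2 fun x _ => ?_)
    have h1 := Submodule.smul_mem _ (-(q.coeff n)⁻¹) (mem_fibreRel hε q n x)
    rwa [el_eq_zero hn, LinearMap.zero_apply, zero_sub, smul_neg, neg_smul, neg_neg, smul_smul,
      inv_mul_cancel₀ hq, one_smul] at h1
  · exact fun hq => (fibreEquiv hε hq).toEquiv.nontrivial

theorem fibreMap_ellE {q : SturmLiouville} (hq : q.IsRegular) (n : ℤ) (x : Limit) :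
    fibreMap q (ellEMode n x) = ∑ᶠ k : ℤ, q.coeff k • mode (eField ℂ) (n - k - 1) (fibreMap q x) := by
  obtain ⟨f, e⟩ := ellEMode_apply n x
  rw [e]
  refine ((fibreMap q).toAddMonoidHom.map_finsum f).trans (finsum_congr fun k => ?_)
  change fibreMap q _ = _
  rw [fibreMap_el hq, isLatField_limE, fibreMap_latExt]

theorem fibreMap_L1 {ε : ℂ} (hε : ε ≠ 0) {q : SturmLiouville} (hq : q.IsRegular) (n : ℤ) (x : Limit) :
    fibreMap q (limitOp (L1 ε n) x) = deformedL ε q n (fibreMap q x) := by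
  rw [(hasLim_L1 ε hε n).2, deformedL, ← fibreMap_ellE hq]
  simp only [LinearMap.add_apply, LinearMap.sub_apply, LinearMap.smul_apply, map_add, map_sub, map_smul,
    fibreMap_latExt, fibreMap_el hq]

theorem mem_eigenspace_of_lie {A : Module.End ℂ (LatVOA ℂ)} {k : ℤ}
    (hA : ⁅latL ℂ 0, A⁆ = -(k : ℂ) • A) {d : ℤ} {v : LatVOA ℂ}
    (hv : v ∈ Module.End.eigenspace (latL ℂ 0) (d : ℂ)) :
    A v ∈ Module.End.eigenspace (latL ℂ 0) ((d - k : ℤ) : ℂ) := by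
  rw [Module.End.mem_eigenspace_iff] at hv ⊢
  have h := LinearMap.congr_fun hA v
  rw [lie_apply_end, hv, map_smul, LinearMap.smul_apply, sub_eq_iff_eq_add] at h
  rw [h, ← add_smul]
  congr 1
  push_cast
  ring

/-- From weight d, fₙ₊₁ leads to d-n-1, the scalar qₙ stays at d, and eₙ₋ₖ₋₁ leads to d-n+k+1.
Regularity leaves only n ≤ -2 and k ≤ -2 in the last two, so all are below d-n. -/
theorem deformedL_sub_latL_mem (ε : ℂ) {q : SturmLiouville} (hq : q.IsRegular) (n d : ℤ) {v : LatVOA ℂ}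
    (hv : v ∈ Module.End.eigenspace (latL ℂ 0) (d : ℂ)) : deformedL ε q n v - latL ℂ n v ∈
      ⨆ (d' : ℤ) (_ : d' < d - n), Module.End.eigenspace (latL ℂ 0) (d' : ℂ) := by
  have hle : ∀ d' : ℤ, d' < d - n → Module.End.eigenspace (latL ℂ 0) (d' : ℂ) ≤
      ⨆ (d' : ℤ) (_ : d' < d - n), Module.End.eigenspace (latL ℂ 0) (d' : ℂ) :=
    fun d' h => le_iSup₂_of_le d' h le_rfl
  set N := ⨆ (d' : ℤ) (_ : d' < d - n), Module.End.eigenspace (latL ℂ 0) (d' : ℂ)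
  have h1 : mode (fField ℂ) (n + 1) v ∈ N := hle (d - (n + 1)) (by omega)
    (mem_eigenspace_of_lie (by rw [lie_latL_f, zero_add]) hv)
  have h2 : q.coeff n • v ∈ N := by
    by_cases h : -1 ≤ n
    · rw [hq n h, zero_smul]
      exact N.zero_mem
    · exact N.smul_mem _ (hle d (by omega) hv)
  have h3 : ∑ᶠ k : ℤ, q.coeff k • mode (eField ℂ) (n - k - 1) v ∈ N := by
    refine finsum_induction (p := (· ∈ N)) N.zero_mem (fun _ _ => N.add_mem) fun k => ?_
    by_cases h : -1 ≤ k
    · rw [hq k h, zero_smul]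
      exact N.zero_mem
    · exact N.smul_mem _ (hle (d - (n - k - 1)) (by omega)
        (mem_eigenspace_of_lie (by rw [lie_latL_e, zero_add]) hv))
  have e : deformedL ε q n v - latL ℂ n v = (1 / (2 * ε)) • mode (fField ℂ) (n + 1) v - q.coeff n • v
      - (2 * ε) • ∑ᶠ k : ℤ, q.coeff k • mode (eField ℂ) (n - k - 1) v := by
    rw [deformedL]
    abel
  rw [e]
  exact N.sub_mem (N.sub_mem (N.smul_mem _ h1) h2) (N.smul_mem _ h3)

end Fibres

/-! ### The fibre at q = 0 as a vertex algebra -/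

section ZeroFibre

theorem isRegular_zero : (0 : SturmLiouville).IsRegular := fun _ _ => rfl

theorem fibreMap_zero_el (n : ℤ) (x : Limit) : fibreMap 0 (el n x) = 0 := by
  rw [fibreMap_el isRegular_zero]
  exact zero_smul ℂ _

theorem fibreMap_zero_ellE (n : ℤ) (x : Limit) : fibreMap 0 (ellEMode n x) = 0 := by
  rw [fibreMap_ellE isRegular_zero]
  exact finsum_eq_zero_of_forall_eq_zero fun k => zero_smul ℂ _

theorem fibreMap_limitVacuum (q : SturmLiouville) : fibreMap q limitVacuum = latVacuum ℂ := by
  rw [← symm_vacuum, fibreMap_symm_tmul, map_one, one_smul]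

theorem exists_stateField_zeroFibre {a : Limit} {A : VertexOperator ℂ Limit}
    (h : StateField limitVacuum limitGens a A) : ∃ B : VertexOperator ℂ (LatVOA ℂ),
      StateField (latVacuum ℂ) (latGens ℂ) (fibreMap 0 a) B ∧
        Intertwines (fibreMap 0).toAddMonoidHom A B := by
  induction h with
  | vacuum =>
    refine ⟨idField, ?_, Intertwines.idField _⟩
    rw [fibreMap_limitVacuum]
    exact StateField.vacuum
  | gen A hA =>
    have key : ∀ {B : VertexOperator ℂ (LatVOA ℂ)}, B ∈ latGens ℂ → IsLatField A B →
        ∃ B : VertexOperator ℂ (LatVOA ℂ), StateField (latVacuum ℂ) (latGens ℂ)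
          (fibreMap 0 (mode A (-1) limitVacuum)) B ∧
          Intertwines (fibreMap 0).toAddMonoidHom A B := fun {B} hB hBA => by
      refine ⟨B, ?_, fun n x => ?_⟩
      · rw [hBA, fibreMap_latExt, fibreMap_limitVacuum]
        exact StateField.gen B hB
      · rw [hBA]
        exact fibreMap_latExt 0 _ x
    rcases hA with rfl | rfl | rfl | rfl
    · refine ⟨(0 : ℂ) • idField, ?_, fun n x => ?_⟩
      · change StateField _ _ (fibreMap 0 (mode elField (-1) limitVacuum)) _
        rw [mode_elField, fibreMap_zero_el]
        have := (StateField.vacuum (vac := latVacuum ℂ) (G := latGens ℂ)).smul 0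
        rwa [zero_smul] at this
      · change fibreMap 0 (mode elField n x) = _
        rw [mode_elField, fibreMap_zero_el, mode_smul, zero_smul, LinearMap.zero_apply]
    · exact key (Or.inl rfl) isLatField_limE
    · exact key (Or.inr (Or.inl rfl)) isLatField_limH
    · exact key (Or.inr (Or.inr rfl)) isLatField_limF
  | add a b A B _ _ hA hB =>
    obtain ⟨A', hA, hA'⟩ := hA
    obtain ⟨B', hB, hB'⟩ := hB
    refine ⟨A' + B', ?_, hA'.add hB'⟩
    rw [map_add]
    exact hA.add _ _ _ _ hB
  | smul r a A _ hA =>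
    obtain ⟨A', hA, hA'⟩ := hA
    refine ⟨r • A', ?_, Intertwines.smul (fibreMap 0) hA' r⟩
    rw [map_smul]
    exact hA.smul r _ _
  | nprod p a b A B _ _ hA hB =>
    obtain ⟨A', hA, hA'⟩ := hA
    obtain ⟨B', hB, hB'⟩ := hB
    refine ⟨nprod A' p B', ?_, hA'.nprod p hB'⟩
    have := hA' p b
    change fibreMap 0 (mode A p b) = mode A' p (fibreMap 0 b) at this
    rw [this]
    exact hA.nprod p _ _ _ _ hB

/-- Only the coefficient at k = -1 is nonzero, and the quadratic term vanishes because f² = 0 as a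
matrix. -/
theorem connectionL_fConnection (ε : ℂ) (n : ℤ) (v : LatVOA ℂ) :
    connectionL (fConnection ε) n v = latL ℂ n v + (1 / (2 * ε)) • mode (fField ℂ) (n + 1) v := by
  have h1 : ∑ᶠ k : ℤ, current (fConnection ε k) (n - k) v = (1 / (2 * ε)) • mode (fField ℂ) (n + 1) v := by
    rw [finsum_eq_single _ (-1)]
    · rw [fConnection, if_pos rfl, current, sub_neg_eq_add]
      simp
    · intro k hk
      rw [fConnection, if_neg hk, current]
      simp
  have h2 : ∑ᶠ k : ℤ, Matrix.trace ((fConnection ε k : Matrix (Fin 2) (Fin 2) ℂ) *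
      (fConnection ε (n - k) : Matrix (Fin 2) (Fin 2) ℂ)) = 0 := by
    refine finsum_eq_zero_of_forall_eq_zero fun k => ?_
    simp only [fConnection]
    split_ifs <;> simp
  rw [connectionL, h1, h2, mul_zero, zero_smul, add_zero]

theorem fibreMap_zero_L1 {ε : ℂ} (hε : ε ≠ 0) (n : ℤ) (x : Limit) :
    fibreMap 0 (limitOp (L1 ε n) x) = connectionL (fConnection ε) n (fibreMap 0 x) := by
  rw [(hasLim_L1 ε hε n).2, connectionL_fConnection]
  simp only [LinearMap.add_apply, LinearMap.sub_apply, LinearMap.smul_apply, map_add, map_sub, map_smul,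
    fibreMap_latExt, fibreMap_zero_el, fibreMap_zero_ellE, smul_zero, sub_zero]
  exact add_comm _ _

/-- Lₙ^(b) kills the vacuum, commutes with the lattice factor, and its brackets with ℓₘ are again
multiples of some ℓ, which vanish at q = 0. Hence it acts by zero on the zero fibre. -/
theorem fibreMap_zero_limLb {n : ℤ} (hn : n = -1 ∨ n = 0 ∨ n = 1) (x : Limit) :
    fibreMap 0 (limLb n x) = 0 := by
  have hN : LinearMap.ker ((fibreMap 0).comp (limLb n)) = ⊤ := by
    refine limit_submodule_eq_top _ ?_ (fun m x hx => ?_) fun A A' hA x hx => ?_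
    · have h : limLb n limitVacuum = 0 := by
        rw [limLb, limitVacuum, limitOp_toLimit (preserves_Lb hn), ← map_zero toLimit]
        refine congrArg toLimit (Subtype.ext ?_)
        change Lb n famVacuum = 0
        rw [Lb_eq, famVacuum, LinearMap.rTensor_tmul, virL_apply, virGen_smul_vacuum _ _ (by omega),
          TensorProduct.zero_tmul]
      rw [LinearMap.mem_ker, LinearMap.comp_apply, h, map_zero]
    · have h := LinearMap.congr_fun (lie_limLb_el hn m) x
      rw [lie_apply_end, sub_eq_iff_eq_add] at h
      rw [LinearMap.mem_ker, LinearMap.comp_apply, h, map_add, LinearMap.smul_apply, map_smul,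
        fibreMap_zero_el, fibreMap_zero_el, smul_zero, add_zero]
    · have h := LinearMap.congr_fun (lie_limLb_latExt hn hA) x
      rw [lie_apply_end, LinearMap.zero_apply, sub_eq_zero] at h
      rw [LinearMap.mem_ker, LinearMap.comp_apply] at hx ⊢
      rw [latLim_eq hA, h, fibreMap_latExt, hx, map_zero]
  exact LinearMap.congr_fun (LinearMap.ker_eq_top.1 hN) x

theorem fibreMap_zero_L2 {ε : ℂ} (hε : ε ≠ 0) {n : ℤ} (hn : n = -1 ∨ n = 0 ∨ n = 1) (x : Limit) :
    fibreMap 0 (limitOp (L2 ε n) x) = sl2Op ε n (fibreMap 0 x) := by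
  rw [limitL2_eq hε hn]
  simp only [LinearMap.add_apply, LinearMap.smul_apply, map_add, map_smul, fibreMap_latExt,
    fibreMap_zero_limLb hn, fibreMap_zero_ellE, smul_zero, add_zero]

end ZeroFibre

end Urod

end

theorem mainTheorem5 (ε : ℂ) (hε : ε ≠ 0) :
    -- `Vir^b ⊗ V_{√2ℤ}` with its integral form is a deformable family: the integral form spans, it is
    -- closed under the vertex operators `Y(a, z)`, and these reduce to vertex operators of the limit
    (Submodule.span K (integralForm : Set Fam) = ⊤ ∧
      ∀ a : integralForm, ∃ A : VertexOperator K Fam,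
        StateField famVacuum famGens (a : Fam) A ∧ (∀ n, Preserves (mode A n)) ∧
        StateField limitVacuum limitGens (toLimit a) (limitField A)) ∧
    -- the operators `Lₙ^(b₁)` and `Lₙ^(b₂) / b₂²` have limits, the latter being `lim Lₙ^(b) / b²`
    (∀ n : ℤ, Preserves (L1 ε n) ∧ Preserves ((b ^ 2 - 1)⁻¹ • L2 ε n) ∧
      Preserves (b⁻¹ ^ 2 • Lb n) ∧ ell ε n = limitOp (b⁻¹ ^ 2 • Lb n)) ∧
    -- the `ℓₙ` are central
    (∀ (n : ℤ) (a : Limit) (A : VertexOperator ℂ Limit), StateField limitVacuum limitGens a A →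
      ∀ k : ℤ, Commute (ell ε n) (mode A k)) ∧
    -- the limits of the `Lₙ^(b₁)` are a Virasoro action (of central charge `1`)
    (∀ m n : ℤ, ⁅limitOp (L1 ε m), limitOp (L1 ε n)⁆ =
      ((m : ℂ) - n) • limitOp (L1 ε (m + n)) +
        (if m + n = 0 then ((m : ℂ) ^ 3 - m) / 12 else 0) • (1 : Module.End ℂ Limit)) ∧
    -- the limit is a (trivial) bundle with fibre `V_{√2ℤ}` over the regular Sturm-Liouville operators
    ∃ Ψ : Limit ≃ₗ[ℂ] MvPolynomial ℕ ℂ ⊗[ℂ] LatVOA ℂ,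
      Ψ limitVacuum = 1 ⊗ₜ[ℂ] latVacuum ℂ ∧
      (∀ (n : ℤ) (x : Limit),
        Ψ (ell ε n x) = (LinearMap.mulLeft ℂ (coord n)).rTensor (LatVOA ℂ) (Ψ x)) ∧
      (∀ (v : LatVOA ℂ) (A : VertexOperator ℂ (LatVOA ℂ)), StateField (latVacuum ℂ) (latGens ℂ) v A →
        ∃ B : VertexOperator ℂ Limit,
          StateField limitVacuum limitGens (Ψ.symm (1 ⊗ₜ[ℂ] v)) B ∧
          ∀ (n : ℤ) (x : Limit), Ψ (mode B n x) =
            (mode A n).lTensor (MvPolynomial ℕ ℂ) (Ψ x)) ∧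
      -- the fibre is nonzero exactly over the regular operators
      (∀ q : SturmLiouville, Nontrivial (Fibre ε q) ↔ q.IsRegular) ∧
      -- over a regular operator the fibre is `V_{√2ℤ}` with deformed Virasoro action
      (∀ q : SturmLiouville, q.IsRegular → ∃ Φ : Fibre ε q ≃ₗ[ℂ] LatVOA ℂ,
        (∀ (p : MvPolynomial ℕ ℂ) (v : LatVOA ℂ),
          Φ (toFibre ε q (Ψ.symm (p ⊗ₜ[ℂ] v))) = evalAt q p • v) ∧
        (∀ (v : LatVOA ℂ) (A : VertexOperator ℂ (LatVOA ℂ)), StateField (latVacuum ℂ) (latGens ℂ) v A →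
          ∃ B : VertexOperator ℂ Limit,
            StateField limitVacuum limitGens (Ψ.symm (1 ⊗ₜ[ℂ] v)) B ∧
            ∀ (n : ℤ) (x : Limit),
              Φ (toFibre ε q (mode B n x)) = mode A n (Φ (toFibre ε q x))) ∧
        (∀ (n : ℤ) (x : Limit),
          Φ (toFibre ε q (limitOp (L1 ε n) x)) = deformedL ε q n (Φ (toFibre ε q x)))) ∧
      -- all deforming terms are degree-lowering for the grading by the eigenvalues of `L₀`
      (∀ q : SturmLiouville, q.IsRegular → ∀ (n d : ℤ),
        ∀ v ∈ Module.End.eigenspace (latL ℂ 0) (d : ℂ), deformedL ε q n v - latL ℂ n v ∈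
          ⨆ (d' : ℤ) (_ : d' < d - n), Module.End.eigenspace (latL ℂ 0) (d' : ℂ)) ∧
      -- the action of `sl₂` on the limit by `Lₙ^(b₂)`, `n = -1, 0, 1`
      (∀ n ∈ ({-1, 0, 1} : Set ℤ), Preserves (L2 ε n) ∧ Preserves (Lb n) ∧
        (∀ x : Limit, limitOp (L2 ε n) x =
          -(1 / (2 * ε)) • mode (limitField famF) (n + 1) x
          - (((n : ℂ) + 1) / 2) • mode (limitField famH) n x
          + (ε * (n * (n + 1))) • mode (limitField famE) (n - 1) x
          + limitOp (Lb n) x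
          + (2 * ε) • ∑ᶠ k : ℤ, ell ε k (mode (limitField famE) (n - k - 1) x)) ∧
        ∀ k : ℤ, ⁅limitOp (L2 ε n), ell ε k⁆ = ((n : ℂ) - k) • ell ε (n + k)) ∧
      IsSl2Action (fun n => limitOp (L2 ε n)) ∧
      -- the zero fibre is the vertex algebra `V_{√2ℤ}` deformed by the connection `d + (1/2ε) f`,
      -- and the action of `sl₂` descends to it
      ∃ Φ₀ : Fibre ε 0 ≃ₗ[ℂ] LatVOA ℂ,
        (∀ v : LatVOA ℂ, Φ₀ (toFibre ε 0 (Ψ.symm (1 ⊗ₜ[ℂ] v))) = v) ∧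
        (∀ (a : Limit) (A : VertexOperator ℂ Limit), StateField limitVacuum limitGens a A →
          ∃ B : VertexOperator ℂ (LatVOA ℂ),
            StateField (latVacuum ℂ) (latGens ℂ) (Φ₀ (toFibre ε 0 a)) B ∧
            ∀ (n : ℤ) (x : Limit),
              Φ₀ (toFibre ε 0 (mode A n x)) = mode B n (Φ₀ (toFibre ε 0 x))) ∧
        (∀ (n : ℤ) (x : Limit), Φ₀ (toFibre ε 0 (limitOp (L1 ε n) x)) =
          connectionL (fConnection ε) n (Φ₀ (toFibre ε 0 x))) ∧
        (∀ n ∈ ({-1, 0, 1} : Set ℤ), ∀ x : Limit, Φ₀ (toFibre ε 0 (limitOp (L2 ε n) x)) =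
          sl2Op ε n (Φ₀ (toFibre ε 0 x))) ∧
        IsSl2Action (sl2Op ε) := by
  -- Membership in this explicit set unfolds definitionally to the disjunction used above.
  have hidx : ∀ {n : ℤ}, n ∈ ({-1, 0, 1} : Set ℤ) → n = -1 ∨ n = 0 ∨ n = 1 := fun h => h
  have hell := ell_eq ε hε
  refine ⟨⟨span_integralForm, exists_stateField⟩, fun n => ⟨(hasLim_L1 ε hε n).1,
    (hasLim_L2_div ε hε n).1, (hasLim_el n).1, hell n⟩, fun n a A hA k => ?_, lie_limitL1 hε,
    trivialization, trivialization_vacuum, fun n x => ?_, fun v A hA => ?_, nontrivial_fibre_iff hε,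
    fun q hq => ⟨fibreEquiv hε hq, fun p v => ?_, fun v A hA => ?_, fun n x => ?_⟩,
    fun q hq n d v hv => deformedL_sub_latL_mem ε hq n d hv,
    fun n hn => ⟨(hasLim_L2 ε hε (hidx hn)).1, preserves_Lb (hidx hn), fun x => ?_, fun k => ?_⟩,
    isSl2Action_limitL2 hε, fibreEquiv hε isRegular_zero, fun v => ?_, fun a A hA => ?_, fun n x => ?_,
    fun n hn x => ?_, isSl2Action_sl2Op hε⟩
  · rw [hell]
    exact LinearMap.ext fun x => hA.intertwines_el n k x
  · rw [hell]
    exact trivialization_el n x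
  · obtain ⟨B, hB, hB'⟩ := exists_stateField_limit hA
    exact ⟨B, hB, fun n x => by rw [hB', trivialization_latExt]⟩
  · exact fibreMap_symm_tmul q p v
  · obtain ⟨B, hB, hB'⟩ := exists_stateField_limit hA
    exact ⟨B, hB, fun n x => by
      rw [fibreEquiv_toFibre, fibreEquiv_toFibre, hB', fibreMap_latExt]⟩
  · exact fibreMap_L1 hε hq n x
  · simp only [hell]
    rw [limitL2_eq hε (hidx hn), ← ellE_apply, sl2Op_eq, map_add, map_add, map_smul, map_smul, map_smul,
      ← isLatField_limF, ← isLatField_limH, ← isLatField_limE]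
    simp only [LinearMap.add_apply, LinearMap.smul_apply, limLb]
    module
  · rw [hell, hell]
    exact lie_limitL2_el hε (hidx hn) k
  · rw [fibreEquiv_toFibre, fibreMap_symm_tmul, map_one, one_smul]
  · obtain ⟨B, hB, hB'⟩ := exists_stateField_zeroFibre hA
    exact ⟨B, hB, hB'⟩
  · exact fibreMap_zero_L1 hε n x
  · exact fibreMap_zero_L2 hε (hidx hn) x
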